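/- **Setting.** Let $\mathcal N$ be an infinite set of channels, $\overline{\mathcal N}=\{\overline a: a\in\mathcal N\}$, $\mathcal L=\mathcal N\cup\overline{\mathcal N}$ and $\mathcal A=\mathcal L\cup\{\tau\}$. RCCS terms are given by $$S,T::=\mathbf 0\mid X\mid \sum_{i\in I}\alpha_i.T_i\mid \bigoplus_{i\in I}p_i\tau.T_i\mid S\,|\,T\mid (L)T\mid \mu X.T,$$ with $I$ finite and non-empty, $\alpha_i\in\mathcal A$, $p_i\in(0,1)$, $\sum_{i\in I} p_i=1$, and $L\subseteq\mathcal N$ finite; CCS terms are those without $\bigoplus$. Processes are terms without free process variables; $\mathcal P_{\mathsf{CCS}}\subseteq\mathcal P_{\mathsf{RCCS}}$ are the sets of CCS and RCCS processes. $\mathscr D(\mathcal P_{\mathsf{RCCS}})$ is the set of finitely supported probability distributions on $\mathcal P_{\mathsf{RCCS}}$, and $\delta_P$ is the Dirac distribution at $P$. Parallel composition, localization and renaming extend (bi)linearly to distributions, e.g. $\mu\,|\,\nu=\sum_{A,B}\mu(A)\nu(B)\delta_{A|B}$. The relations $P\xrightarrow{\alpha}\rho$ between processes, actions and distributions are generated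 by the rules: $\sum_i\alpha_i.T_i\xrightarrow{\alpha_i}\delta_{T_i}$; $\bigoplus_ip_i\tau.T_i\xrightarrow{\tau}\sum_ip_i\delta_{T_i}$; if $S\xrightarrow{\beta}\rho$ then $S|T\xrightarrow{\beta}\rho|\delta_T$ and $T|S\xrightarrow{\beta}\delta_T|\rho$; if $S\xrightarrow{\ell}\rho_1$ and $T\xrightarrow{\overline\ell}\rho_2$ with $\ell\in\mathcal L$ then $S|T\xrightarrow{\tau}\rho_1|\rho_2$; if $T\xrightarrow{\beta}\rho$ and $\beta,\overline\beta\notin L$ then $(L)T\xrightarrow{\beta}(L)\rho$; if $T\{\mu X.T/X\}\xrightarrow{\beta}\rho$ then $\mu X.T\xrightarrow{\beta}\rho$. For distributions, $\mu\rightsquigarrow\nu$ means that $\nu$ is obtained from $\mu$ by finitely many steps, each replacing the current distribution $\mu'$ by $\mu'+\mu'(P)\,p\,(\rho-\delta_P)$ for some $P\in\mathsf{supp}(\mu')$, $P\xrightarrow{\tau}\rho$ and $p\in(0,1]$. For a set $\varphi$ of processes put $\chi^{\mathsf{may}}_\varphi(\mu)=\sup\{\nu(\varphi):\mu\rightsquigarrow\nu\}$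 and $\chi^{\mathsf{fair}}_\varphi(\mu)=\inf\{\chi^{\mathsf{may}}_\varphi(\nu):\mu\rightsquigarrow\nu\}$. A *testing context* is a set $\mathcal D$ with $\{\delta_P:P\in\mathcal P_{\mathsf{CCS}}\}\subseteq\mathcal D\subseteq\mathscr D(\mathcal P_{\mathsf{RCCS}})$ that is closed under parallel composition, localization to finite sets of channels, and (capture-free) renaming of finitely many global, i.e. non-localized, channels. A relation $\mathcal R$ on $\mathscr D(\mathcal P_{\mathsf{RCCS}})$ is *$\mathcal D$-extensional* if $\mu_1\mathcal R\mu_2$ implies $(\mu_1|\nu)\,\mathcal R\,(\mu_2|\nu)$ for all $\nu\in\mathcal D$ ($\mathcal D$-composition) and $(L)\mu_1\,\mathcal R\,(L)\mu_2$ for all finite $L\subseteq\mathcal N$ (localization). Let $\psi_{\mathcal L}$ be the set of processes $P$ such that $P\xrightarrow{\ell}\rho$ for some $\ell\in\mathcal L$ and some $\rho$. * The $\mathcal D$-diamond equivalence $=^{\mathcal D}_{\Diamond}$ (resp. $\mathcal D$-box equivalence $=^{\mathcal D}_{\Box}$) is the largest $\mathcal D$-extensional relation $\mathcal R$ such that $\mu_1\mathcal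 R\mu_2$ implies $\chi^{\mathsf{may}}_{\psi_{\mathcal L}}(\mu_1)=\chi^{\mathsf{may}}_{\psi_{\mathcal L}}(\mu_2)$ (resp. $\chi^{\mathsf{fair}}_{\psi_{\mathcal L}}(\mu_1)=\chi^{\mathsf{fair}}_{\psi_{\mathcal L}}(\mu_2)$). * Let $\omega\notin\mathcal A$ be a new action, without co-action, and extend the semantics to $\mathcal A\cup\{\omega\}$. The observers induced by $\mathcal D$ are the distributions $o[a\mapsto\omega]$ with $o\in\mathcal D$ and $a$ a channel of $o$ (such that no $\overline\omega$ arises), and $\psi_\omega=\{P: P\xrightarrow{\omega}\rho\text{ for some }\rho\}$. The $\mathcal D$-may equivalence $=^{\mathcal D}_{\mathsf{may}}$ (resp. $\mathcal D$-fair equivalence $=^{\mathcal D}_{\mathsf{fair}}$) is the largest equivalence $\mathcal R$ on $\mathscr D(\mathcal P_{\mathsf{RCCS}})$ such that $\mu_1\mathcal R\mu_2$ implies $\chi^{\mathsf{may}}_{\psi_\omega}(\mu_1|o)=\chi^{\mathsf{may}}_{\psi_\omega}(\mu_2|o)$ (resp. $\chi^{\mathsf{fair}}_{\psi_\omega}(\mu_1|o)=\chi^{\mathsf{fair}}_{\psi_\omega}(\mu_2|o)$)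 for all these observers $o$. The superscript $p$ stands for $\mathcal D=\mathscr D(\mathcal P_{\mathsf{RCCS}})$ (probabilistic observers) and $\Delta$ for $\mathcal D=\{\delta_P:P\in\mathcal P_{\mathsf{CCS}}\}$ (classical observers). The projection of $\mathcal R$ onto a set $\mathcal X$ of processes is $\{(P,Q)\in\mathcal X^2:\delta_P\,\mathcal R\,\delta_Q\}$. An equivalence $\mathcal E$ on $\mathcal P_{\mathsf{RCCS}}$ (resp. $\mathcal P_{\mathsf{CCS}}$) is extended to RCCS (resp. CCS) terms with free process variables by relating $S$ and $T$ iff $S\{\widetilde P/\widetilde X\}\,\mathcal E\,T\{\widetilde P/\widetilde X\}$ for all tuples $\widetilde P$ of RCCS (resp. CCS) processes. $\mathcal E$ is a *congruence* if this extension is preserved by all operators of the calculus: nondeterministic choice $\sum_{i\in I}\alpha_i.(\cdot)$, probabilistic choice $\bigoplus_{i\in I}p_i\tau.(\cdot)$ (for RCCS only), parallel composition, localization, and possibly unguarded recursion $\mu X.(\cdot)$. **Theorem (Congruence).** 1. For every testing context $\mathcal D$, the relations $=^{\mathcal D}_{\Diamond}$, $=^{\mathcal D}_{\Box}$, $=^{\mathcal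 D}_{\mathsf{fair}}$ and $=^{\mathcal D}_{\mathsf{may}}$ are equivalences that are preserved by $\mathcal D$-composition, localization and finite convex combinations. 2. The projections of $=^{p}_{\Diamond}$ and $=^{p}_{\Box}$ onto $\mathcal P_{\mathsf{RCCS}}$, and of $=^{\Delta}_{\Diamond}$ and $=^{\Delta}_{\Box}$ onto $\mathcal P_{\mathsf{CCS}}$, are congruences. 3. The projections of $=^{p}_{\mathsf{may}}$ and $=^{p}_{\mathsf{fair}}$ onto $\mathcal P_{\mathsf{RCCS}}$, and of $=^{\Delta}_{\mathsf{may}}$ and $=^{\Delta}_{\mathsf{fair}}$ onto $\mathcal P_{\mathsf{CCS}}$, are congruences. -/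

import Mathlib

universe u v

namespace RCCS

/-! ### Finitely supported distributions -/

/-- Probability distributions with finite support over `S` (Mathlib's `StdSimplex ℝ S`:
a finitely supported nonnegative weight function of total weight `1`). -/
abbrev FinDist (S : Type u) : Type u := Convexity.StdSimplex ℝ S

/-- The Dirac distribution at `x`. -/
noncomputable abbrev dirac {S : Type u} (x : S) : FinDist S := Convexity.StdSimplex.single x

/-- The probability `μ(φ) = ∑_{x ∈ φ} μ(x)`. -/
noncomputable def FinDist.prob {S : Type u} (μ : FinDist S) (φ : Set S) : ℝ :=
  ∑ x ∈ μ.weights.support, φ.indicator (fun y => μ.weights y) x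

/-- The convex combination `∑ i, p i • μ i` of a finite family of distributions. -/
noncomputable def convexComb {S : Type u} {k : ℕ} (p : Fin k → ℝ) (hp : ∀ i, 0 ≤ p i)
    (hsum : ∑ i, p i = 1) (μ : Fin k → FinDist S) : FinDist S where
  weights := ∑ i, p i • (μ i).weights
  nonneg := Finset.sum_nonneg fun i _ => smul_nonneg (hp i) (μ i).nonneg
  total := by
    classical
    rw [← Finsupp.sum_finsetSum_index (h := fun _ r => r) (by simp) (by simp)]
    rw [← hsum]
    refine Finset.sum_congr rfl fun i _ => ?_
    rw [Finsupp.sum_smul_index (by simp)]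
    have h := (μ i).total
    rw [Finsupp.sum] at h
    rw [Finsupp.sum, ← Finset.mul_sum, h, mul_one]

/-- The push-forward of the product distribution along a binary operation:
`∑_{A} ∑_{B} μ(A) ν(B) δ_{f A B}`. -/
noncomputable def FinDist.map₂ {S : Type u} {T : Type v} {U : Type*} (f : S → T → U)
    (μ : FinDist S) (ν : FinDist T) : FinDist U where
  weights := μ.weights.sum fun A a => ν.weights.sum fun B b => Finsupp.single (f A B) (a * b)
  nonneg := Finset.sum_nonneg fun A _ => Finset.sum_nonneg fun B _ =>
    Finsupp.single_nonneg.2 (mul_nonneg (μ.nonneg A) (ν.nonneg B))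
  total := by
    have h1 : ∀ A a, (ν.weights.sum fun B b => Finsupp.single (f A B) (a * b)).sum
        (fun _ r => r) = a := by
      intro A a
      rw [Finsupp.sum_sum_index (fun _ => rfl) (fun _ _ _ => rfl)]
      simp only [Finsupp.sum_single_index]
      have h2 := ν.total
      rw [Finsupp.sum] at h2
      rw [Finsupp.sum, ← Finset.mul_sum, h2, mul_one]
    rw [Finsupp.sum_sum_index (fun _ => rfl) (fun _ _ _ => rfl)]
    simp only [h1]
    exact μ.total

/-! ### Actions and terms -/

/-- The external actions (labels) over a set `C` of channels: `a` and its co-action `ā`. -/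
inductive Label (C : Type u) : Type u
  | pos (a : C) : Label C
  | neg (a : C) : Label C

/-- The complement of a label. -/
def Label.compl {C : Type u} : Label C → Label C
  | .pos a => .neg a
  | .neg a => .pos a

/-- The underlying channel of a label. -/
def Label.chan {C : Type u} : Label C → C
  | .pos a => a
  | .neg a => a

/-- Actions: external actions and the internal action `τ`. -/
inductive Act (C : Type u) : Type u
  | ext (l : Label C) : Act C
  | tau : Act C

/-- The set of channels of an action. -/
def Act.channels {C : Type u} : Act C → Set C
  | .ext l => {l.chan}
  | .tau => ∅

/-- Applying a function on channels to an action. -/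
def Act.map {C : Type u} {C' : Type v} (f : C → C') : Act C → Act C'
  | .ext (.pos a) => .ext (.pos (f a))
  | .ext (.neg a) => .ext (.neg (f a))
  | .tau => .tau

/-- `n`-ary RCCS terms over the channels `C`, with the free process variables among
`X_0, …, X_{n-1}`. Process variables are de Bruijn indices: `fix T` is `μX.T`, where `X` is the
variable `0` of `T` and the variable `i + 1` of `T` is the variable `i` of `fix T`.
`sum m α T` is the nondeterministic choice `∑_{i ≤ m} α_i.T_i`, `psum m p _ _ T` is the
probabilistic choice `⨁_{i ≤ m} p_i τ.T_i`, both over a nonempty finite index set. -/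
inductive Term (C : Type u) : ℕ → Type u
  | nil {n : ℕ} : Term C n
  | var {n : ℕ} (i : Fin n) : Term C n
  | sum {n : ℕ} (m : ℕ) (α : Fin (m + 1) → Act C) (T : Fin (m + 1) → Term C n) : Term C n
  | psum {n : ℕ} (m : ℕ) (p : Fin (m + 1) → ℝ) (hp : ∀ i, 0 < p i ∧ p i < 1)
      (hsum : ∑ i, p i = 1) (T : Fin (m + 1) → Term C n) : Term C n
  | par {n : ℕ} (S T : Term C n) : Term C n
  | res {n : ℕ} (L : Finset C) (T : Term C n) : Term C n
  | fix {n : ℕ} (T : Term C (n + 1)) : Term C n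

/-- Processes: terms without free process variables. -/
abbrev Proc (C : Type u) : Type u := Term C 0

namespace Term

/-- Renaming of the free process variables. -/
def renVar {C : Type u} : {n k : ℕ} → Term C n → (Fin n → Fin k) → Term C k
  | _, _, nil, _ => nil
  | _, _, var i, r => var (r i)
  | _, _, sum m α T, r => sum m α fun i => (T i).renVar r
  | _, _, psum m p hp hs T, r => psum m p hp hs fun i => (T i).renVar r
  | _, _, par S T, r => par (S.renVar r) (T.renVar r)
  | _, _, res L T, r => res L (T.renVar r)
  | _, _, fix T, r => fix (T.renVar (Fin.cases 0 fun i => (r i).succ))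

/-- Simultaneous capture-avoiding substitution of terms for the free process variables. -/
def subst {C : Type u} : {n k : ℕ} → Term C n → (Fin n → Term C k) → Term C k
  | _, _, nil, _ => nil
  | _, _, var i, σ => σ i
  | _, _, sum m α T, σ => sum m α fun i => (T i).subst σ
  | _, _, psum m p hp hs T, σ => psum m p hp hs fun i => (T i).subst σ
  | _, _, par S T, σ => par (S.subst σ) (T.subst σ)
  | _, _, res L T, σ => res L (T.subst σ)
  | _, _, fix T, σ => fix (T.subst (Fin.cases (var 0) fun i => (σ i).renVar Fin.succ))

/-- CCS terms: RCCS terms without probabilistic choice. -/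
def IsCCS {C : Type u} : {n : ℕ} → Term C n → Prop
  | _, nil => True
  | _, var _ => True
  | _, sum _ _ T => ∀ i, (T i).IsCCS
  | _, psum _ _ _ _ _ => False
  | _, par S T => S.IsCCS ∧ T.IsCCS
  | _, res _ T => T.IsCCS
  | _, fix T => T.IsCCS

/-- The channels occurring in a term (in an action or in a localization). -/
def channels {C : Type u} : {n : ℕ} → Term C n → Set C
  | _, nil => ∅
  | _, var _ => ∅
  | _, sum _ α T => ⋃ i, ((α i).channels ∪ (T i).channels)
  | _, psum _ _ _ _ T => ⋃ i, (T i).channels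
  | _, par S T => S.channels ∪ T.channels
  | _, res L T => ↑L ∪ T.channels
  | _, fix T => T.channels

/-- The channels having a global (i.e. not localized) occurrence in a term. -/
def globals {C : Type u} : {n : ℕ} → Term C n → Set C
  | _, nil => ∅
  | _, var _ => ∅
  | _, sum _ α T => ⋃ i, ((α i).channels ∪ (T i).globals)
  | _, psum _ _ _ _ T => ⋃ i, (T i).globals
  | _, par S T => S.globals ∪ T.globals
  | _, res L T => T.globals \ ↑L
  | _, fix T => T.globals

open Classical in
/-- Replace every global occurrence of a channel `c` by `f c` and every local one by `e c`. -/
noncomputable def rename {C : Type u} {C' : Type v} (e : C ↪ C') :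
    {n : ℕ} → (C → C') → Term C n → Term C' n
  | _, _, nil => nil
  | _, _, var i => var i
  | _, f, sum m α T => sum m (fun i => (α i).map f) fun i => (T i).rename e f
  | _, f, psum m p hp hs T => psum m p hp hs fun i => (T i).rename e f
  | _, f, par S T => par (S.rename e f) (T.rename e f)
  | _, f, res L T => res (L.map e) (T.rename e fun c => if c ∈ L then e c else f c)
  | _, f, fix T => fix (T.rename e f)

/-- Replacing the global channels `c` of the term by `f c` (local channels are left alone) does not
move a global channel into the scope of a localization that binds it. -/
def CaptureFree {C : Type u} (f : C → C) : {n : ℕ} → Term C n → Prop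
  | _, nil => True
  | _, var _ => True
  | _, sum _ _ T => ∀ i, (T i).CaptureFree f
  | _, psum _ _ _ _ T => ∀ i, (T i).CaptureFree f
  | _, par S T => S.CaptureFree f ∧ T.CaptureFree f
  | _, res L T => (∀ c ∈ T.globals, c ∉ L → f c ∉ L) ∧
      T.CaptureFree (fun c => open Classical in if c ∈ L then c else f c)
  | _, fix T => T.CaptureFree f

end Term

/-! ### Operations on distributions of processes -/

/-- Parallel composition of distributions. -/
noncomputable def FinDist.par {C : Type u} (μ ν : FinDist (Proc C)) : FinDist (Proc C) :=
  μ.map₂ Term.par ν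

/-- Localization of a distribution. -/
noncomputable def FinDist.res {C : Type u} (L : Finset C) (μ : FinDist (Proc C)) :
    FinDist (Proc C) :=
  μ.map (Term.res L)

/-- The renaming `μ[f]`. -/
noncomputable def FinDist.rename {C : Type u} (f : C → C) (μ : FinDist (Proc C)) :
    FinDist (Proc C) :=
  μ.map (Term.rename (Function.Embedding.refl C) f)

/-- The channels occurring in the support of a distribution. -/
def FinDist.channels {C : Type u} (μ : FinDist (Proc C)) : Set C :=
  ⋃ P ∈ μ.weights.support, Term.channels P

/-! ### Operational semantics -/

/-- The probabilistic labelled transition system on processes: `Step P α ρ` is `P -α→ ρ`. -/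
inductive Step {C : Type u} : Proc C → Act C → FinDist (Proc C) → Prop
  | sum (m : ℕ) (α : Fin (m + 1) → Act C) (T : Fin (m + 1) → Proc C) (i : Fin (m + 1)) :
      Step (.sum m α T) (α i) (dirac (T i))
  | psum (m : ℕ) (p : Fin (m + 1) → ℝ) (hp : ∀ i, 0 < p i ∧ p i < 1) (hsum : ∑ i, p i = 1)
      (T : Fin (m + 1) → Proc C) :
      Step (.psum m p hp hsum T) .tau
        (convexComb p (fun i => (hp i).1.le) hsum fun i => dirac (T i))
  | parL {S T : Proc C} {β : Act C} {ρ : FinDist (Proc C)} (h : Step S β ρ) :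
      Step (.par S T) β (ρ.par (dirac T))
  | parR {S T : Proc C} {β : Act C} {ρ : FinDist (Proc C)} (h : Step T β ρ) :
      Step (.par S T) β ((dirac S : FinDist (Proc C)).par ρ)
  | comm {S T : Proc C} {l : Label C} {ρ₁ ρ₂ : FinDist (Proc C)} (h₁ : Step S (.ext l) ρ₁)
      (h₂ : Step T (.ext l.compl) ρ₂) : Step (.par S T) .tau (ρ₁.par ρ₂)
  | res {T : Proc C} {L : Finset C} {β : Act C} {ρ : FinDist (Proc C)} (h : Step T β ρ)
      (hL : ∀ c ∈ β.channels, c ∉ L) : Step (.res L T) β (ρ.res L)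
  | fix {T : Term C 1} {β : Act C} {ρ : FinDist (Proc C)}
      (h : Step (T.subst fun _ => .fix T) β ρ) : Step (.fix T) β ρ

/-- The transition `μ -(α,p)→ ν` on distributions: some transition `P -α→ ρ` of a process `P` in
the support of `μ` is activated with probability `p ∈ (0,1]`, i.e. `ν = μ + μ(P) p (ρ - δ_P)`. -/
def DStep {C : Type u} (μ : FinDist (Proc C)) (α : Act C) (p : ℝ) (ν : FinDist (Proc C)) : Prop :=
  0 < p ∧ p ≤ 1 ∧ ∃ P ∈ μ.weights.support, ∃ ρ : FinDist (Proc C), Step P α ρ ∧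
    ν.weights = μ.weights + (μ.weights P * p) • (ρ.weights - (dirac P : FinDist (Proc C)).weights)

/-- Finite internal transition sequences `μ ⇝ ν`. -/
def Reach {C : Type u} : FinDist (Proc C) → FinDist (Proc C) → Prop :=
  Relation.ReflTransGen fun μ ν => ∃ p : ℝ, DStep μ .tau p ν

/-- The set of testing outcomes of `μ` with respect to the predicate `φ`. -/
def outcomes {C : Type u} (φ : Set (Proc C)) (μ : FinDist (Proc C)) : Set ℝ :=
  {x | ∃ ν, Reach μ ν ∧ ν.prob φ = x}

/-- The may characteristic: the supremum of the testing outcomes. -/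
noncomputable def chiMay {C : Type u} (φ : Set (Proc C)) (μ : FinDist (Proc C)) : ℝ :=
  sSup (outcomes φ μ)

/-- The fair characteristic: the infimum of the may characteristics of all `ν` with `μ ⇝ ν`. -/
noncomputable def chiFair {C : Type u} (φ : Set (Proc C)) (μ : FinDist (Proc C)) : ℝ :=
  sInf {x | ∃ ν, Reach μ ν ∧ sSup (outcomes φ ν) = x}

/-! ### Model-independent testing equivalences -/

/-- The processes that can immediately perform an external action. -/
def psiExt (C : Type u) : Set (Proc C) := {P | ∃ l ρ, Step P (.ext l) ρ}

/-- The Dirac distributions at CCS processes. -/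
def diracCCS (C : Type u) : Set (FinDist (Proc C)) := {μ | ∃ P : Proc C, P.IsCCS ∧ μ = dirac P}

/-- Testing contexts: sets of distributions that contain all Dirac distributions at CCS processes
and are closed under parallel composition, localization and renaming along functions that move
only finitely many channels. (A renaming is applied only to distributions for which it does not
capture channels.) -/
structure IsTestingContext {C : Type u} (D : Set (FinDist (Proc C))) : Prop where
  diracCCS_subset : diracCCS C ⊆ D
  par : ∀ μ ∈ D, ∀ ν ∈ D, μ.par ν ∈ D
  res : ∀ μ ∈ D, ∀ L : Finset C, μ.res L ∈ D
  rename : ∀ μ ∈ D, ∀ f : C → C, {c | f c ≠ c}.Finite →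
    (∀ P ∈ μ.weights.support, Term.CaptureFree f P) → μ.rename f ∈ D

/-- Relations on distributions of processes. -/
abbrev DistRel (C : Type u) : Type u := FinDist (Proc C) → FinDist (Proc C) → Prop

/-- Probabilistic equipollence. -/
def Equipollent {C : Type u} (R : DistRel C) : Prop :=
  ∀ μ₁ μ₂, R μ₁ μ₂ → chiMay (psiExt C) μ₁ = chiMay (psiExt C) μ₂

/-- Probabilistic strong equipollence. -/
def StronglyEquipollent {C : Type u} (R : DistRel C) : Prop :=
  ∀ μ₁ μ₂, R μ₁ μ₂ → chiFair (psiExt C) μ₁ = chiFair (psiExt C) μ₂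

/-- `R` is preserved by composition with the elements of `D`. -/
def Compositional {C : Type u} (D : Set (FinDist (Proc C))) (R : DistRel C) : Prop :=
  ∀ μ₁ μ₂, R μ₁ μ₂ → ∀ ν ∈ D, R (μ₁.par ν) (μ₂.par ν)

/-- `R` is preserved by localization. -/
def Localizable {C : Type u} (R : DistRel C) : Prop :=
  ∀ μ₁ μ₂, R μ₁ μ₂ → ∀ L : Finset C, R (μ₁.res L) (μ₂.res L)

/-- `D`-extensional relations. -/
def Extensional {C : Type u} (D : Set (FinDist (Proc C))) (R : DistRel C) : Prop :=
  Compositional D R ∧ Localizable R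

/-- The `D`-diamond equivalence: the largest probabilistically equipollent, `D`-extensional
relation, i.e. the union of all such relations. -/
def Diamond {C : Type u} (D : Set (FinDist (Proc C))) : DistRel C := fun μ₁ μ₂ =>
  ∃ R : DistRel C, Equipollent R ∧ Extensional D R ∧ R μ₁ μ₂

/-- The `D`-box equivalence: the largest probabilistically strongly equipollent, `D`-extensional
relation, i.e. the union of all such relations. -/
def Box {C : Type u} (D : Set (FinDist (Proc C))) : DistRel C := fun μ₁ μ₂ =>
  ∃ R : DistRel C, StronglyEquipollent R ∧ Extensional D R ∧ R μ₁ μ₂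

theorem isGreatest_diamond {C : Type u} (D : Set (FinDist (Proc C))) :
    IsGreatest {R : DistRel C | Equipollent R ∧ Extensional D R} (Diamond D) := by
  refine ⟨⟨?_, ?_, ?_⟩, fun R hR μ₁ μ₂ h => ⟨R, hR.1, hR.2, h⟩⟩
  · rintro μ₁ μ₂ ⟨R, h1, -, h⟩
    exact h1 _ _ h
  · rintro μ₁ μ₂ ⟨R, h1, h2, h⟩ ν hν
    exact ⟨R, h1, h2, h2.1 _ _ h ν hν⟩
  · rintro μ₁ μ₂ ⟨R, h1, h2, h⟩ L
    exact ⟨R, h1, h2, h2.2 _ _ h L⟩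

theorem isGreatest_box {C : Type u} (D : Set (FinDist (Proc C))) :
    IsGreatest {R : DistRel C | StronglyEquipollent R ∧ Extensional D R} (Box D) := by
  refine ⟨⟨?_, ?_, ?_⟩, fun R hR μ₁ μ₂ h => ⟨R, hR.1, hR.2, h⟩⟩
  · rintro μ₁ μ₂ ⟨R, h1, -, h⟩
    exact h1 _ _ h
  · rintro μ₁ μ₂ ⟨R, h1, h2, h⟩ ν hν
    exact ⟨R, h1, h2, h2.1 _ _ h ν hν⟩
  · rintro μ₁ μ₂ ⟨R, h1, h2, h⟩ L
    exact ⟨R, h1, h2, h2.2 _ _ h L⟩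

/-! ### External testing equivalences -/

/-- Processes as processes over the channels `C ∪ {ω}`; here `ω` is `none : Option C`. -/
noncomputable def withOmega {C : Type u} (μ : FinDist (Proc C)) : FinDist (Proc (Option C)) :=
  μ.map (Term.rename Function.Embedding.some some)

open Classical in
/-- The distribution `o[a ↦ ω]`. -/
noncomputable def toOmega {C : Type u} (a : C) (o : FinDist (Proc C)) :
    FinDist (Proc (Option C)) :=
  o.map (Term.rename Function.Embedding.some fun c => if c = a then none else some c)

/-- The terms over the action set extended by `ω` alone: the success action has no co-action and
is never localized. -/
def Term.IsOmega {C : Type u} : {n : ℕ} → Term (Option C) n → Prop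
  | _, nil => True
  | _, var _ => True
  | _, sum _ α T => ∀ i, α i ≠ .ext (.neg none) ∧ (T i).IsOmega
  | _, psum _ _ _ _ T => ∀ i, (T i).IsOmega
  | _, par S T => S.IsOmega ∧ T.IsOmega
  | _, res L T => none ∉ L ∧ T.IsOmega
  | _, fix T => T.IsOmega

/-- The observer distributions induced by a testing context: the `o[a ↦ ω]` with `o ∈ D` and `a` a
channel of `o` (such that no co-action of `ω` arises). -/
def observers {C : Type u} (D : Set (FinDist (Proc C))) : Set (FinDist (Proc (Option C))) :=
  {o' | (∀ P ∈ o'.weights.support, Term.IsOmega P) ∧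
    ∃ o ∈ D, ∃ a ∈ o.channels, o' = toOmega a o}

/-- The processes that can immediately perform the action `ω`. -/
def psiOmega (C : Type u) : Set (Proc (Option C)) := {P | ∃ ρ, Step P (.ext (.pos none)) ρ}

/-- The `D`-may predicate on relations. -/
def MayPredicate {C : Type u} (D : Set (FinDist (Proc C))) (R : DistRel C) : Prop :=
  ∀ μ₁ μ₂, R μ₁ μ₂ → ∀ o ∈ observers D,
    chiMay (psiOmega C) ((withOmega μ₁).par o) = chiMay (psiOmega C) ((withOmega μ₂).par o)

/-- The `D`-fair predicate on relations. -/
def FairPredicate {C : Type u} (D : Set (FinDist (Proc C))) (R : DistRel C) : Prop :=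
  ∀ μ₁ μ₂, R μ₁ μ₂ → ∀ o ∈ observers D,
    chiFair (psiOmega C) ((withOmega μ₁).par o) = chiFair (psiOmega C) ((withOmega μ₂).par o)

/-- The `D`-may equivalence: the largest equivalence satisfying the `D`-may predicate. -/
def May {C : Type u} (D : Set (FinDist (Proc C))) : DistRel C := fun μ₁ μ₂ =>
  ∃ R : DistRel C, Equivalence R ∧ MayPredicate D R ∧ R μ₁ μ₂

/-- The `D`-fair equivalence: the largest equivalence satisfying the `D`-fair predicate. -/
def Fair {C : Type u} (D : Set (FinDist (Proc C))) : DistRel C := fun μ₁ μ₂ =>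
  ∃ R : DistRel C, Equivalence R ∧ FairPredicate D R ∧ R μ₁ μ₂

theorem may_iff {C : Type u} (D : Set (FinDist (Proc C))) (μ₁ μ₂ : FinDist (Proc C)) :
    May D μ₁ μ₂ ↔ ∀ o ∈ observers D,
      chiMay (psiOmega C) ((withOmega μ₁).par o) = chiMay (psiOmega C) ((withOmega μ₂).par o) :=
  ⟨fun ⟨_, _, h, hr⟩ => h _ _ hr, fun h => ⟨fun μ ν => ∀ o ∈ observers D,
      chiMay (psiOmega C) ((withOmega μ).par o) = chiMay (psiOmega C) ((withOmega ν).par o),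
    ⟨fun _ _ _ => rfl, fun h o ho => (h o ho).symm, fun h h' o ho => (h o ho).trans (h' o ho)⟩,
    fun _ _ h => h, h⟩⟩

theorem fair_iff {C : Type u} (D : Set (FinDist (Proc C))) (μ₁ μ₂ : FinDist (Proc C)) :
    Fair D μ₁ μ₂ ↔ ∀ o ∈ observers D,
      chiFair (psiOmega C) ((withOmega μ₁).par o) = chiFair (psiOmega C) ((withOmega μ₂).par o) :=
  ⟨fun ⟨_, _, h, hr⟩ => h _ _ hr, fun h => ⟨fun μ ν => ∀ o ∈ observers D,
      chiFair (psiOmega C) ((withOmega μ).par o) = chiFair (psiOmega C) ((withOmega ν).par o),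
    ⟨fun _ _ _ => rfl, fun h o ho => (h o ho).symm, fun h h' o ho => (h o ho).trans (h' o ho)⟩,
    fun _ _ h => h, h⟩⟩

theorem isGreatest_may {C : Type u} (D : Set (FinDist (Proc C))) :
    IsGreatest {R : DistRel C | Equivalence R ∧ MayPredicate D R} (May D) := by
  refine ⟨⟨⟨fun μ => ?_, fun h => ?_, fun h h' => ?_⟩, fun μ ν h => (may_iff D μ ν).1 h⟩,
    fun R hR μ₁ μ₂ h => ⟨R, hR.1, hR.2, h⟩⟩
  · exact (may_iff D _ _).2 fun _ _ => rfl
  · exact (may_iff D _ _).2 fun o ho => ((may_iff D _ _).1 h o ho).symm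
  · exact (may_iff D _ _).2 fun o ho =>
      ((may_iff D _ _).1 h o ho).trans ((may_iff D _ _).1 h' o ho)

theorem isGreatest_fair {C : Type u} (D : Set (FinDist (Proc C))) :
    IsGreatest {R : DistRel C | Equivalence R ∧ FairPredicate D R} (Fair D) := by
  refine ⟨⟨⟨fun μ => ?_, fun h => ?_, fun h h' => ?_⟩, fun μ ν h => (fair_iff D μ ν).1 h⟩,
    fun R hR μ₁ μ₂ h => ⟨R, hR.1, hR.2, h⟩⟩
  · exact (fair_iff D _ _).2 fun _ _ => rfl
  · exact (fair_iff D _ _).2 fun o ho => ((fair_iff D _ _).1 h o ho).symm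
  · exact (fair_iff D _ _).2 fun o ho =>
      ((fair_iff D _ _).1 h o ho).trans ((fair_iff D _ _).1 h' o ho)

/-! ### Congruence -/

/-- `R` is preserved by finite convex combinations. -/
def ConvexClosed {C : Type u} (R : DistRel C) : Prop :=
  ∀ (k : ℕ) (p : Fin k → ℝ) (hp : ∀ i, 0 ≤ p i) (hsum : ∑ i, p i = 1)
    (μ ν : Fin k → FinDist (Proc C)), (∀ i, R (μ i) (ν i)) →
    R (convexComb p hp hsum μ) (convexComb p hp hsum ν)

/-- The projection of `R` onto a set `X` of processes: the relation between `P, Q ∈ X` that holds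
iff `R` relates their Dirac distributions. -/
def proj {C : Type u} (X : Set (Proc C)) (R : DistRel C) (P Q : Proc C) : Prop :=
  P ∈ X ∧ Q ∈ X ∧ R (dirac P) (dirac Q)

/-- The class of all RCCS terms (of every arity). -/
def rccsTerms (C : Type u) (n : ℕ) : Set (Term C n) := Set.univ

/-- The class of all CCS terms (of every arity). -/
def ccsTerms (C : Type u) (n : ℕ) : Set (Term C n) := {T | T.IsCCS}

/-- The extension of a relation `E` on processes to `n`-ary terms of the class `K`: `S` and `T` are
related iff all their instances by tuples of processes of the class are related by `E`. -/
def OpenRel {C : Type u} (K : (n : ℕ) → Set (Term C n)) (E : Proc C → Proc C → Prop)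
    {n : ℕ} (S T : Term C n) : Prop :=
  S ∈ K n ∧ T ∈ K n ∧
    ∀ σ : Fin n → Proc C, (∀ i, σ i ∈ K 0) → E (S.subst σ) (T.subst σ)

/-- `E` is an equivalence on the processes of the class `K` and is preserved by all operators of
the class: nondeterministic choice, probabilistic choice (as far as it belongs to the class),
parallel composition, localization, and (possibly unguarded) recursion. The case `n = 0` of the
first four operators is the statement on processes. -/
structure IsCongruence {C : Type u} (K : (n : ℕ) → Set (Term C n)) (E : Proc C → Proc C → Prop) :
    Prop where
  refl : ∀ P ∈ K 0, E P P
  symm : ∀ {P Q}, E P Q → E Q P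
  trans : ∀ {P Q R}, E P Q → E Q R → E P R
  sum : ∀ {n : ℕ} (m : ℕ) (α : Fin (m + 1) → Act C) (S T : Fin (m + 1) → Term C n),
    (∀ i, OpenRel K E (S i) (T i)) → OpenRel K E (.sum m α S) (.sum m α T)
  psum : ∀ {n : ℕ} (m : ℕ) (p : Fin (m + 1) → ℝ) (hp : ∀ i, 0 < p i ∧ p i < 1)
    (hsum : ∑ i, p i = 1) (S T : Fin (m + 1) → Term C n),
    (∀ i, OpenRel K E (S i) (T i)) →
    Term.psum m p hp hsum S ∈ K n → Term.psum m p hp hsum T ∈ K n →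
    OpenRel K E (.psum m p hp hsum S) (.psum m p hp hsum T)
  par : ∀ {n : ℕ} (S₁ T₁ S₂ T₂ : Term C n), OpenRel K E S₁ T₁ → OpenRel K E S₂ T₂ →
    OpenRel K E (.par S₁ S₂) (.par T₁ T₂)
  res : ∀ {n : ℕ} (L : Finset C) (S T : Term C n), OpenRel K E S T →
    OpenRel K E (.res L S) (.res L T)
  fix : ∀ {n : ℕ} (S T : Term C (n + 1)), OpenRel K E S T → OpenRel K E (.fix S) (.fix T)

/-- `R` is an equivalence preserved by composition with elements of `D`, by localization and by
convex combinations. -/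
structure IsPreserved {C : Type u} (D : Set (FinDist (Proc C))) (R : DistRel C) : Prop where
  equivalence : Equivalence R
  compositional : Compositional D R
  localizable : Localizable R
  convexClosed : ConvexClosed R

end RCCS

/-! Internal runs of a convex combination can be carried out component by component
(`reach_bind_map`), so both characteristics are affine: `chiMay_eq_ev` and `chiFair_eq_ev` write
them as expectations of their values at single processes. The may value is the least nonnegative
function that is at least 1 on the observed set and does not increase in expectation along internal
steps. The fair value is the greatest function below the may value that does not decrease in
expectation. Values are therefore compared by exhibiting such functions on families of processes
closed under internal steps (`may_le_of_cover`, `le_fair_of_cover`); bisimilar processes have equal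
values (`TauSpan.val_eq`).

Since values are invariant under injective renaming, the success action can be played by a fresh
ordinary channel `w` (`TestEq.chi_eq`, `IsTestingContext.testEq`). A component or a localization can
then be moved from the tested process to the observer, which gives preservation; convexity is
affinity. Diamond equals may and box equals fair (`IsTestingContext.exists_extensional_iff`):
localizing every channel except `w` turns observation of `w` into observation of any external
action, and conversely an observer that answers every visible action by `w` copies external
observations to `w`. Only testing equivalences remain.

For choices, the tested process is followed up to its first transition, which the other process
matches (`Matches.may_le`, `Matches.fair_le`). The fair case needs may equivalence as well; it
follows because an observer that drops its success signal on receiving `w` has fair value one minus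
a may value (`fair_par_eq`).

For recursion, let `S` and `T` agree on all processes. Then every iterate of `S` started at `fix T`
is equivalent to `fix T` (`ProcEq.iter`). A finite run of `fix S` uses finitely many unfoldings and
is thus also a run of a long enough iterate (`Reach.exists_fill`), which settles may. For fair, the
states reached by the run and by its copy are one term filled with `fix S` and with iterates
respectively; their may values agree because may equivalence is already known to be substitutive.
This is why the may congruence is completed before the fair one. -/

namespace RCCS

/-! ### Expectations -/

namespace FinDist

variable {S T U : Type*}

/-- The expectation of a real function with respect to a distribution. -/
noncomputable def ev (μ : FinDist S) (f : S → ℝ) : ℝ :=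
  Finsupp.linearCombination ℝ f μ.weights

theorem ev_eq_sum (μ : FinDist S) (f : S → ℝ) :
    μ.ev f = ∑ x ∈ μ.weights.support, μ.weights x * f x := by
  simp [ev, Finsupp.linearCombination_apply, Finsupp.sum]

@[simp] theorem ev_dirac (x : S) (f : S → ℝ) : (dirac x : FinDist S).ev f = f x := by
  simp [ev]

@[simp] theorem ev_map (μ : FinDist S) (g : S → T) (f : T → ℝ) :
    ev (μ.map g) f = μ.ev fun x => f (g x) := by
  simp only [ev, Convexity.StdSimplex.weights_map, Finsupp.linearCombination_mapDomain]
  rfl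

@[simp] theorem ev_map₂ (μ : FinDist S) (ν : FinDist T) (g : S → T → U) (f : U → ℝ) :
    (map₂ g μ ν).ev f = μ.ev fun x => ν.ev fun y => f (g x y) := by
  rw [ev]
  simp only [ev_eq_sum, Finset.mul_sum, map₂, Finsupp.sum, map_sum,
    Finsupp.linearCombination_single, smul_eq_mul, mul_assoc]

theorem ev_convexComb {k : ℕ} (p : Fin k → ℝ) (hp : ∀ i, 0 ≤ p i) (hsum : ∑ i, p i = 1)
    (μ : Fin k → FinDist S) (f : S → ℝ) :
    (convexComb p hp hsum μ).ev f = ∑ i, p i * (μ i).ev f := by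
  simp [ev, convexComb]

/-- Expectations of point indicators recover the weights. Identities between distributions thus
reduce to the rewriting rules for expectations, which is how residuals of transitions are compared
throughout. -/
theorem ext_ev {μ ν : FinDist S} (h : ∀ f, μ.ev f = ν.ev f) : μ = ν := by
  classical
  refine Convexity.StdSimplex.ext (Finsupp.ext fun x => ?_)
  have := h (Pi.single x 1)
  have key : ∀ κ : FinDist S, κ.ev (Pi.single x 1) = κ.weights x := by
    intro κ
    rw [ev_eq_sum]
    simp +contextual [Pi.single_apply]
  rwa [key, key] at this

theorem ev_congr {μ : FinDist S} {f g : S → ℝ} (h : ∀ x ∈ μ.weights.support, f x = g x) :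
    μ.ev f = μ.ev g := by
  rw [ev_eq_sum, ev_eq_sum]
  exact Finset.sum_congr rfl fun x hx => by rw [h x hx]

theorem ev_mono {μ : FinDist S} {f g : S → ℝ} (h : ∀ x ∈ μ.weights.support, f x ≤ g x) :
    μ.ev f ≤ μ.ev g := by
  rw [ev_eq_sum, ev_eq_sum]
  exact Finset.sum_le_sum fun x hx => mul_le_mul_of_nonneg_left (h x hx) (μ.nonneg x)

@[simp] theorem ev_const (μ : FinDist S) (c : ℝ) : (μ.ev fun _ => c) = c := by
  have h := μ.total
  rw [Finsupp.sum] at h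
  rw [ev_eq_sum, ← Finset.sum_mul, h, one_mul]

theorem ev_add (μ : FinDist S) (f g : S → ℝ) : (μ.ev fun x => f x + g x) = μ.ev f + μ.ev g := by
  simp only [ev_eq_sum, mul_add, Finset.sum_add_distrib]

theorem ev_const_sub (μ : FinDist S) (c : ℝ) (f : S → ℝ) :
    (μ.ev fun x => c - f x) = c - μ.ev f := by
  have h := μ.ev_add (fun x => c - f x) f
  simp only [sub_add_cancel, ev_const] at h
  linarith

theorem ev_le {μ : FinDist S} {f : S → ℝ} {c : ℝ} (h : ∀ x ∈ μ.weights.support, f x ≤ c) :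
    μ.ev f ≤ c := (ev_mono h).trans_eq (ev_const μ c)

theorem le_ev {μ : FinDist S} {f : S → ℝ} {c : ℝ} (h : ∀ x ∈ μ.weights.support, c ≤ f x) :
    c ≤ μ.ev f := (ev_const μ c).symm.trans_le (ev_mono h)

theorem ev_comm (μ : FinDist S) (ν : FinDist T) (f : S → T → ℝ) :
    (μ.ev fun x => ν.ev fun y => f x y) = ν.ev fun y => μ.ev fun x => f x y := by
  simp only [ev_eq_sum, Finset.mul_sum]
  rw [Finset.sum_comm]
  exact Finset.sum_congr rfl fun _ _ => Finset.sum_congr rfl fun _ _ => by ring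

open Classical in
theorem prob_eq_ev (μ : FinDist S) (φ : Set S) :
    μ.prob φ = μ.ev fun x => if x ∈ φ then 1 else 0 := by
  rw [ev_eq_sum, prob]
  refine Finset.sum_congr rfl fun x _ => ?_
  simp [Set.indicator_apply]

theorem prob_nonneg (μ : FinDist S) (φ : Set S) : 0 ≤ μ.prob φ := by
  classical
  rw [prob_eq_ev]
  exact le_ev fun x _ => by split_ifs <;> simp

theorem prob_le_one (μ : FinDist S) (φ : Set S) : μ.prob φ ≤ 1 := by
  classical
  rw [prob_eq_ev]
  exact ev_le fun x _ => by split_ifs <;> simp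

/-- The monadic composition of a distribution with a family of distributions. -/
noncomputable def bind (μ : FinDist S) (k : S → FinDist T) : FinDist T :=
  (Convexity.StdSimplex.map k μ).join

theorem weights_bind (μ : FinDist S) (k : S → FinDist T) :
    (μ.bind k).weights = ∑ x ∈ μ.weights.support, μ.weights x • (k x).weights := by
  rw [bind, Convexity.StdSimplex.weights_join, Convexity.StdSimplex.weights_map,
    Finsupp.sum_mapDomain_index (by simp) (by simp [add_smul]), Finsupp.sum]

@[simp] theorem ev_bind (μ : FinDist S) (k : S → FinDist T) (f : T → ℝ) :
    (μ.bind k).ev f = μ.ev fun x => (k x).ev f := by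
  rw [ev, weights_bind, map_sum, ev_eq_sum]
  simp [ev]

/-- Every element of the support satisfies `p`. -/
def All (p : S → Prop) (μ : FinDist S) : Prop := ∀ x ∈ μ.weights.support, p x

-- A sum of nonnegative terms vanishes iff each term does, so support conditions can be handled by
-- the calculus of expectations.
open Classical in
theorem all_iff_ev (p : S → Prop) (μ : FinDist S) :
    μ.All p ↔ (μ.ev fun x => if p x then 0 else 1) = 0 := by
  rw [ev_eq_sum, Finset.sum_eq_zero_iff_of_nonneg]
  · refine forall₂_congr fun x hx => ?_
    have : μ.weights x ≠ 0 := by simpa using hx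
    simp [this]
  · intro x _
    have := μ.nonneg x
    simp only [Finsupp.coe_zero, Pi.zero_apply] at this
    split_ifs <;> simp [this]

theorem All.mono {p q : S → Prop} {μ : FinDist S} (h : μ.All p) (hpq : ∀ x, p x → q x) :
    μ.All q := fun x hx => hpq x (h x hx)

@[simp] theorem all_dirac {p : S → Prop} {x : S} : (dirac x : FinDist S).All p ↔ p x := by
  classical
  simp [all_iff_ev]

@[simp] theorem all_map {p : T → Prop} {μ : FinDist S} {g : S → T} :
    All p (μ.map g) ↔ μ.All fun x => p (g x) := by
  classical
  simp [all_iff_ev]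

theorem All.map₂ {p : S → Prop} {q : T → Prop} {r : U → Prop} {g : S → T → U} {μ : FinDist S}
    {ν : FinDist T} (hμ : μ.All p) (hν : ν.All q) (h : ∀ x y, p x → q y → r (g x y)) :
    (map₂ g μ ν).All r := by
  classical
  rw [all_iff_ev, ev_map₂]
  refine (ev_congr fun x hx => ?_).trans (ev_const μ 0)
  refine (ev_congr fun y hy => ?_).trans (ev_const ν 0)
  rw [if_pos (h x y (hμ x hx) (hν y hy))]

theorem All.convexComb {p : S → Prop} {k : ℕ} {q : Fin k → ℝ} {hq : ∀ i, 0 ≤ q i}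
    {hsum : ∑ i, q i = 1} {μ : Fin k → FinDist S} (h : ∀ i, (μ i).All p) :
    (convexComb q hq hsum μ).All p := by
  classical
  rw [all_iff_ev, ev_convexComb]
  exact Finset.sum_eq_zero fun i _ => by rw [(all_iff_ev p (μ i)).1 (h i), mul_zero]

theorem exists_map_eq {μ : FinDist S} (f : T → S) (h : μ.All fun x => ∃ y, f y = x) :
    ∃ σ : FinDist T, Convexity.StdSimplex.map f σ = μ := by
  classical
  -- Points outside the support need an image too; a preimage of some support point serves as
  -- default.
  obtain ⟨x₀, hx₀⟩ := μ.support_weights_nonempty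
  obtain ⟨y₀, -⟩ := h x₀ hx₀
  refine ⟨Convexity.StdSimplex.map
    (fun x => if hx : ∃ y, f y = x then hx.choose else y₀) μ, ext_ev fun g => ?_⟩
  rw [ev_map, ev_map]
  refine ev_congr fun x hx => ?_
  rw [dif_pos (h x hx), (h x hx).choose_spec]

/-- Lifts the residual of a transition to the subtype indexing an invariant family, as the cover and
span arguments require. -/
theorem exists_map_subtype {p : S → Prop} {μ : FinDist S} (h : μ.All p) :
    ∃ σ : FinDist {x // p x}, Convexity.StdSimplex.map Subtype.val σ = μ :=
  exists_map_eq _ (h.mono fun x hx => ⟨⟨x, hx⟩, rfl⟩)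

@[simp] theorem ev_par {C : Type*} (μ ν : FinDist (Proc C)) (f : Proc C → ℝ) :
    (μ.par ν).ev f = μ.ev fun A => ν.ev fun B => f (.par A B) := ev_map₂ _ _ _ _

@[simp] theorem ev_res {C : Type*} (μ : FinDist (Proc C)) (L : Finset C) (f : Proc C → ℝ) :
    (μ.res L).ev f = μ.ev fun A => f (.res L A) := ev_map _ _ _

theorem par_dirac {C : Type*} (μ : FinDist (Proc C)) (Q : Proc C) :
    μ.par (dirac Q) = μ.map fun P => .par P Q := ext_ev fun f => by simp

end FinDist

/-! ### Internal transition sequences of convex combinations -/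

section Reach

variable {C : Type u}

/-- A single internal transition on finitely supported weight functions. -/
def WStep (M M' : Proc C →₀ ℝ) : Prop :=
  ∃ (P : Proc C) (ρ : FinDist (Proc C)) (r : ℝ), 0 < r ∧ r ≤ M P ∧ Step P .tau ρ ∧
    M' = M + r • (ρ.weights - (dirac P : FinDist (Proc C)).weights)

/-- The relative probability `p` is traded for the absolute mass `r = μ(P) p`. In this form a step
makes sense without normalization and survives scaling and the addition of inert mass. -/
theorem dStep_iff_wStep {μ ν : FinDist (Proc C)} :
    (∃ p, DStep μ .tau p ν) ↔ WStep μ.weights ν.weights := by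
  constructor
  · rintro ⟨p, hp, hp1, P, hP, ρ, hs, h⟩
    have hpos : 0 < μ.weights P :=
      lt_of_le_of_ne (μ.nonneg P) (by simpa using (Ne.symm (by simpa using hP)))
    exact ⟨P, ρ, _, mul_pos hpos hp, mul_le_of_le_one_right hpos.le hp1, hs, h⟩
  · rintro ⟨P, ρ, r, hr, hrP, hs, h⟩
    have hpos : 0 < μ.weights P := hr.trans_le hrP
    refine ⟨r / μ.weights P, div_pos hr hpos, (div_le_one hpos).2 hrP, P, by simpa using hpos.ne',
      ρ, hs, ?_⟩
    rw [h, mul_div_cancel₀ _ hpos.ne']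

theorem Reach.weights {μ ν : FinDist (Proc C)} (h : Reach μ ν) :
    Relation.ReflTransGen WStep μ.weights ν.weights :=
  Relation.ReflTransGen.lift _ (fun _ _ h => dStep_iff_wStep.1 h) _ _ h

theorem WStep.exists_finDist {μ : FinDist (Proc C)} {M : Proc C →₀ ℝ} (h : WStep μ.weights M) :
    ∃ ν : FinDist (Proc C), ν.weights = M := by
  classical
  obtain ⟨P, ρ, r, hr, hrP, -, rfl⟩ := h
  refine ⟨⟨_, ?_, ?_⟩, rfl⟩
  · intro Q
    have h1 := μ.nonneg Q
    have h2 := mul_nonneg hr.le (ρ.nonneg Q)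
    simp only [Finsupp.coe_zero, Pi.zero_apply] at h1 h2
    by_cases hQ : P = Q
    · subst hQ
      simp
      linarith
    · simp [hQ]
      linarith
  · have key : ∀ N : Proc C →₀ ℝ, (N.sum fun _ r => r) =
        Finsupp.linearCombination ℝ (fun _ => (1 : ℝ)) N := by
      intro N; simp [Finsupp.linearCombination_apply]
    rw [key, map_add, map_smul, map_sub, ← key, ← key, ← key, μ.total, ρ.total,
      Convexity.StdSimplex.total]
    simp

theorem exists_reach_of_weights {μ : FinDist (Proc C)} {M : Proc C →₀ ℝ}
    (h : Relation.ReflTransGen WStep μ.weights M) :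
    ∃ ν : FinDist (Proc C), ν.weights = M ∧ Reach μ ν := by
  induction h with
  | refl => exact ⟨μ, rfl, .refl⟩
  | tail _ hs ih =>
    obtain ⟨ν, rfl, hν⟩ := ih
    obtain ⟨κ, rfl⟩ := hs.exists_finDist
    exact ⟨κ, rfl, hν.tail (dStep_iff_wStep.2 hs)⟩

theorem WStep.add_right {M M' N : Proc C →₀ ℝ} (hN : 0 ≤ N) (h : WStep M M') :
    WStep (M + N) (M' + N) := by
  obtain ⟨P, ρ, r, hr, hrP, hs, rfl⟩ := h
  have := hN P
  simp only [Finsupp.coe_zero, Pi.zero_apply] at this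
  exact ⟨P, ρ, r, hr, by simp; linarith, hs, by abel⟩

theorem WStep.smul {M M' : Proc C →₀ ℝ} {c : ℝ} (hc : 0 < c) (h : WStep M M') :
    WStep (c • M) (c • M') := by
  obtain ⟨P, ρ, r, hr, hrP, hs, rfl⟩ := h
  exact ⟨P, ρ, c * r, mul_pos hc hr, by simpa using mul_le_mul_of_nonneg_left hrP hc.le, hs,
    by rw [smul_add, smul_smul]⟩

/-- The summands are run one after another, the remaining ones being inert mass meanwhile. The
intermediate summands are not normalized, hence the passage to weight functions. -/
theorem wReach_sum {ι : Type*} (s : Finset ι) (c : ι → ℝ) (M N : ι → FinDist (Proc C))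
    (hc : ∀ i ∈ s, 0 < c i) (h : ∀ i ∈ s, Reach (M i) (N i)) :
    Relation.ReflTransGen WStep (∑ i ∈ s, c i • (M i).weights) (∑ i ∈ s, c i • (N i).weights) := by
  classical
  induction s using Finset.induction_on with
  | empty => simpa using .refl
  | insert a s ha ih =>
    rw [Finset.sum_insert ha, Finset.sum_insert ha]
    have h1 : Relation.ReflTransGen WStep (c a • (M a).weights) (c a • (N a).weights) :=
      Relation.ReflTransGen.lift (c a • ·) (fun _ _ => WStep.smul (hc a (by simp))) _ _
        (h a (by simp)).weights
    have hs : (0 : Proc C →₀ ℝ) ≤ ∑ i ∈ s, c i • (M i).weights := Finset.sum_nonneg fun i hi =>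
      smul_nonneg (hc i (by simp [hi])).le (M i).nonneg
    refine (Relation.ReflTransGen.lift (· + ∑ i ∈ s, c i • (M i).weights)
      (fun _ _ => WStep.add_right hs) _ _ h1).trans ?_
    beta_reduce
    rw [add_comm, add_comm _ (∑ i ∈ s, c i • (N i).weights)]
    exact Relation.ReflTransGen.lift (· + c a • (N a).weights)
      (fun _ _ => WStep.add_right (smul_nonneg (hc a (by simp)).le (N a).nonneg)) _ _
      (ih (fun i hi => hc i (by simp [hi])) fun i hi => h i (by simp [hi]))

/-- The map `f` need not be injective: equal processes with different indices may follow different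
runs, since a step can activate just part of the mass at a process. -/
theorem reach_bind_map {X : Type*} {μ : FinDist X} {f : X → Proc C} {k : X → FinDist (Proc C)}
    (h : ∀ x, Reach (dirac (f x)) (k x)) : Reach (μ.map f) (μ.bind k) := by
  have h1 := wReach_sum μ.weights.support μ.weights (fun x => dirac (f x)) k
    (fun x hx => lt_of_le_of_ne (μ.nonneg x) (by simpa using (Ne.symm (by simpa using hx))))
    (fun x _ => h x)
  have h2 : ∑ x ∈ μ.weights.support, μ.weights x • (dirac (f x) : FinDist (Proc C)).weights
      = (μ.map f).weights := by
    have : μ.bind (fun x => dirac (f x)) = μ.map f := FinDist.ext_ev fun f => by simp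
    rw [← FinDist.weights_bind, this]
  rw [h2, ← FinDist.weights_bind] at h1
  obtain ⟨ν, hν, hr⟩ := exists_reach_of_weights h1
  rwa [Convexity.StdSimplex.ext hν] at hr

theorem reach_bind {μ : FinDist (Proc C)} {k : Proc C → FinDist (Proc C)}
    (h : ∀ P, Reach (dirac P) (k P)) : Reach μ (μ.bind k) := by
  have := reach_bind_map (μ := μ) (f := id) h
  rwa [Convexity.StdSimplex.map_id] at this

theorem Step.reach {P : Proc C} {ρ : FinDist (Proc C)} (h : Step P .tau ρ) :
    Reach (dirac P) ρ :=
  .single (dStep_iff_wStep.2 ⟨P, ρ, 1, one_pos, by simp, h, by simp⟩)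

/-- A step changes expectations by the activated mass times the change at the active process. -/
theorem DStep.ev_eq {μ ν : FinDist (Proc C)} {p : ℝ} (h : DStep μ .tau p ν) :
    ∃ (P : Proc C) (ρ : FinDist (Proc C)) (r : ℝ), P ∈ μ.weights.support ∧ 0 < r ∧
      Step P .tau ρ ∧ ∀ f, ν.ev f = μ.ev f + r * (ρ.ev f - f P) := by
  have hw := dStep_iff_wStep.1 ⟨p, h⟩
  obtain ⟨P, ρ, r, hr, hrP, hs, hν⟩ := hw
  refine ⟨P, ρ, r, by simpa using (hr.trans_le hrP).ne', hr, hs, fun f => ?_⟩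
  rw [FinDist.ev, hν, map_add, map_smul, map_sub]
  simp [FinDist.ev]

theorem Reach.ev_le {μ ν : FinDist (Proc C)} (h : Reach μ ν) {f : Proc C → ℝ}
    (hf : ∀ P ρ, Step P .tau ρ → ρ.ev f ≤ f P) : ν.ev f ≤ μ.ev f := by
  induction h with
  | refl => rfl
  | tail _ hs ih =>
    obtain ⟨p, hs⟩ := hs
    obtain ⟨P, ρ, r, -, hr, hst, he⟩ := hs.ev_eq
    have := hf P ρ hst
    rw [he]
    nlinarith

theorem Reach.le_ev {μ ν : FinDist (Proc C)} (h : Reach μ ν) {f : Proc C → ℝ}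
    (hf : ∀ P ρ, Step P .tau ρ → f P ≤ ρ.ev f) : μ.ev f ≤ ν.ev f := by
  induction h with
  | refl => rfl
  | tail _ hs ih =>
    obtain ⟨p, hs⟩ := hs
    obtain ⟨P, ρ, r, -, hr, hst, he⟩ := hs.ev_eq
    have := hf P ρ hst
    rw [he]
    nlinarith

end Reach
/-! ### May and fair characteristics of processes -/

section Chi

variable {C : Type u} {φ : Set (Proc C)}

/-- The indicator of the complement of an invariant does not increase in expectation along internal
steps. -/
theorem Reach.all {p : Proc C → Prop} {μ ν : FinDist (Proc C)} (h : Reach μ ν) (hμ : μ.All p)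
    (hp : ∀ P ρ, p P → Step P .tau ρ → ρ.All p) : ν.All p := by
  classical
  rw [FinDist.all_iff_ev] at hμ ⊢
  refine le_antisymm ((h.ev_le fun P ρ hs => ?_).trans_eq hμ)
    (FinDist.le_ev fun x _ => by split_ifs <;> simp)
  by_cases hP : p P
  · rw [if_pos hP, ((FinDist.all_iff_ev p ρ).1 (hp P ρ hP hs))]
  · rw [if_neg hP]
    exact FinDist.ev_le fun x _ => by split_ifs <;> simp

theorem bddAbove_outcomes (φ : Set (Proc C)) (μ : FinDist (Proc C)) :
    BddAbove (outcomes φ μ) := by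
  refine ⟨1, ?_⟩
  rintro _ ⟨ν, -, rfl⟩
  exact ν.prob_le_one φ

theorem Reach.prob_le_chiMay {μ ν : FinDist (Proc C)} (h : Reach μ ν) : ν.prob φ ≤ chiMay φ μ :=
  le_csSup (bddAbove_outcomes φ μ) ⟨ν, h, rfl⟩

theorem chiMay_le {μ : FinDist (Proc C)} {c : ℝ} (h : ∀ ν, Reach μ ν → ν.prob φ ≤ c) :
    chiMay φ μ ≤ c := by
  refine csSup_le ⟨_, μ, .refl, rfl⟩ ?_
  rintro _ ⟨ν, hν, rfl⟩
  exact h ν hν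

theorem Reach.chiMay_le {μ ν : FinDist (Proc C)} (h : Reach μ ν) : chiMay φ ν ≤ chiMay φ μ :=
  RCCS.chiMay_le fun _ hκ => Reach.prob_le_chiMay (h.trans hκ)

/-- The may characteristic of a process. -/
noncomputable def may (φ : Set (Proc C)) (P : Proc C) : ℝ := chiMay φ (dirac P)

/-- The fair characteristic of a process. -/
noncomputable def fair (φ : Set (Proc C)) (P : Proc C) : ℝ := chiFair φ (dirac P)

theorem chiMay_nonneg (μ : FinDist (Proc C)) : 0 ≤ chiMay φ μ :=
  (μ.prob_nonneg φ).trans (Reach.prob_le_chiMay .refl)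

theorem chiMay_le_one (μ : FinDist (Proc C)) : chiMay φ μ ≤ 1 :=
  chiMay_le fun ν _ => ν.prob_le_one φ

theorem may_nonneg (P : Proc C) : 0 ≤ may φ P := chiMay_nonneg _

theorem may_le_one (P : Proc C) : may φ P ≤ 1 := chiMay_le_one _

theorem may_eq_one {P : Proc C} (h : P ∈ φ) : may φ P = 1 := by
  classical
  refine le_antisymm (may_le_one P) ?_
  have := Reach.prob_le_chiMay (φ := φ) (μ := dirac P) .refl
  rwa [FinDist.prob_eq_ev, FinDist.ev_dirac, if_pos h] at this

/-- Choose an `ε`-optimal run for every process and execute these runs simultaneously on the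
components of `μ`. -/
theorem ev_may_le_chiMay (μ : FinDist (Proc C)) : μ.ev (may φ) ≤ chiMay φ μ := by
  classical
  refine le_of_forall_pos_le_add fun ε hε => ?_
  have : ∀ P, ∃ ν, Reach (dirac P) ν ∧ may φ P - ε < ν.prob φ := by
    intro P
    obtain ⟨_, ⟨ν, hν, rfl⟩, h⟩ := exists_lt_of_lt_csSup (s := outcomes φ (dirac P))
      ⟨_, _, .refl, rfl⟩ (show may φ P - ε < sSup _ from sub_lt_self _ hε)
    exact ⟨ν, hν, h⟩
  choose k hk hlt using this
  have h1 := (reach_bind (μ := μ) hk).prob_le_chiMay (φ := φ)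
  rw [FinDist.prob_eq_ev, FinDist.ev_bind] at h1
  have h2 : μ.ev (may φ) ≤ μ.ev fun P => (k P).ev (fun x => if x ∈ φ then 1 else 0) + ε :=
    FinDist.ev_mono fun P _ => by
      have := hlt P
      rw [FinDist.prob_eq_ev] at this
      linarith
  rw [FinDist.ev_add, FinDist.ev_const] at h2
  linarith

theorem Step.ev_may_le {P : Proc C} {ρ : FinDist (Proc C)} (h : Step P .tau ρ) :
    ρ.ev (may φ) ≤ may φ P :=
  (ev_may_le_chiMay ρ).trans h.reach.chiMay_le

theorem chiMay_le_ev (μ : FinDist (Proc C)) {f : Proc C → ℝ} (h0 : ∀ P, 0 ≤ f P)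
    (h1 : ∀ P ∈ φ, 1 ≤ f P) (hf : ∀ P ρ, Step P .tau ρ → ρ.ev f ≤ f P) :
    chiMay φ μ ≤ μ.ev f := by
  classical
  refine chiMay_le fun ν hν => le_trans ?_ (hν.ev_le hf)
  rw [FinDist.prob_eq_ev]
  refine FinDist.ev_mono fun P _ => ?_
  split_ifs with h
  · exact h1 P h
  · exact h0 P

/-- The value `may φ` is itself a majorant of the kind admitted by `chiMay_le_ev`: it equals 1 on
`φ` and does not increase in expectation along internal steps. -/
theorem chiMay_eq_ev (μ : FinDist (Proc C)) : chiMay φ μ = μ.ev (may φ) :=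
  le_antisymm (chiMay_le_ev μ may_nonneg (fun _ h => (may_eq_one h).ge) fun _ _ h => h.ev_may_le)
    (ev_may_le_chiMay μ)

theorem Reach.chiFair_le {μ ν : FinDist (Proc C)} (h : Reach μ ν) :
    chiFair φ μ ≤ chiMay φ ν := by
  refine csInf_le ⟨0, ?_⟩ ⟨ν, h, rfl⟩
  rintro _ ⟨κ, -, rfl⟩
  exact chiMay_nonneg κ

theorem le_chiFair {μ : FinDist (Proc C)} {c : ℝ} (h : ∀ ν, Reach μ ν → c ≤ chiMay φ ν) :
    c ≤ chiFair φ μ := by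
  refine le_csInf ⟨_, μ, .refl, rfl⟩ ?_
  rintro _ ⟨ν, hν, rfl⟩
  exact h ν hν

theorem fair_nonneg (P : Proc C) : 0 ≤ fair φ P := le_chiFair fun _ _ => chiMay_nonneg _

theorem fair_le_may (P : Proc C) : fair φ P ≤ may φ P := Reach.chiFair_le .refl

theorem chiFair_le_ev_fair (μ : FinDist (Proc C)) : chiFair φ μ ≤ μ.ev (fair φ) := by
  refine le_of_forall_pos_le_add fun ε hε => ?_
  have : ∀ P, ∃ ν, Reach (dirac P) ν ∧ chiMay φ ν < fair φ P + ε := by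
    intro P
    obtain ⟨_, ⟨ν, hν, rfl⟩, h⟩ := exists_lt_of_csInf_lt
      (s := {x | ∃ ν, Reach (dirac P) ν ∧ sSup (outcomes φ ν) = x})
      ⟨_, _, .refl, rfl⟩ (show sInf _ < fair φ P + ε from lt_add_of_pos_right _ hε)
    exact ⟨ν, hν, h⟩
  choose k hk hlt using this
  have h1 := (reach_bind (μ := μ) hk).chiFair_le (φ := φ)
  rw [chiMay_eq_ev, FinDist.ev_bind] at h1
  have h2 : (μ.ev fun P => (k P).ev (may φ)) ≤ μ.ev fun P => fair φ P + ε :=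
    FinDist.ev_mono fun P _ => by
      rw [← chiMay_eq_ev]
      exact (hlt P).le
  rw [FinDist.ev_add, FinDist.ev_const] at h2
  linarith

theorem Step.le_ev_fair {P : Proc C} {ρ : FinDist (Proc C)} (h : Step P .tau ρ) :
    fair φ P ≤ ρ.ev (fair φ) :=
  le_trans (le_chiFair fun _ hν => Reach.chiFair_le (h.reach.trans hν)) (chiFair_le_ev_fair ρ)

theorem ev_le_chiFair (μ : FinDist (Proc C)) {f : Proc C → ℝ} (h1 : ∀ P, f P ≤ may φ P)
    (hf : ∀ P ρ, Step P .tau ρ → f P ≤ ρ.ev f) : μ.ev f ≤ chiFair φ μ :=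
  le_chiFair fun ν hν => (hν.le_ev hf).trans <| by
    rw [chiMay_eq_ev]
    exact FinDist.ev_mono fun P _ => h1 P

theorem chiFair_eq_ev (μ : FinDist (Proc C)) : chiFair φ μ = μ.ev (fair φ) :=
  le_antisymm (chiFair_le_ev_fair μ) (ev_le_chiFair μ fair_le_may fun _ _ h => h.le_ev_fair)

theorem may_le_of_superharmonic {f : Proc C → ℝ} (h0 : ∀ P, 0 ≤ f P)
    (h1 : ∀ P ∈ φ, 1 ≤ f P) (hf : ∀ P ρ, Step P .tau ρ → ρ.ev f ≤ f P) (P : Proc C) :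
    may φ P ≤ f P := by
  simpa [may] using chiMay_le_ev (dirac P) h0 h1 hf

theorem le_fair_of_subharmonic {f : Proc C → ℝ} (h1 : ∀ P, f P ≤ may φ P)
    (hf : ∀ P ρ, Step P .tau ρ → f P ≤ ρ.ev f) (P : Proc C) : f P ≤ fair φ P := by
  simpa [fair] using ev_le_chiFair (dirac P) h1 hf

/-- An upper bound on the may characteristics of a family of processes that is closed under
internal transitions. -/
theorem may_le_of_cover {X : Type*} (f : X → Proc C) (v : X → ℝ) (h0 : ∀ x, 0 ≤ v x)
    (h1 : ∀ x, f x ∈ φ → 1 ≤ v x)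
    (hs : ∀ x ρ, Step (f x) .tau ρ → ∃ σ : FinDist X, ρ = σ.map f ∧ σ.ev v ≤ v x) (x : X) :
    may φ (f x) ≤ v x := by
  -- The bound descends to processes as an infimum over the fibre of `f`. Inserting 1 keeps this set
  -- nonempty and gives processes outside the range the trivial bound.
  let s : Proc C → Set ℝ := fun P => insert 1 {r | ∃ y, f y = P ∧ v y = r}
  have hb : ∀ P, BddBelow (s P) := by
    refine fun P => ⟨0, ?_⟩
    rintro _ (rfl | ⟨y, -, rfl⟩)
    · exact zero_le_one
    · exact h0 y
  have hne : ∀ P, (s P).Nonempty := fun P => ⟨1, Or.inl rfl⟩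
  have hv : ∀ y, sInf (s (f y)) ≤ v y := fun y => csInf_le (hb _) (Or.inr ⟨y, rfl, rfl⟩)
  refine (may_le_of_superharmonic (f := fun P => sInf (s P)) ?_ ?_ ?_ (f x)).trans (hv x)
  · intro P
    refine le_csInf (hne P) ?_
    rintro _ (rfl | ⟨y, -, rfl⟩)
    · exact zero_le_one
    · exact h0 y
  · intro P hP
    refine le_csInf (hne P) ?_
    rintro _ (rfl | ⟨y, rfl, rfl⟩)
    · exact le_rfl
    · exact h1 y hP
  · intro P ρ hst
    refine le_csInf (hne P) ?_
    rintro _ (rfl | ⟨y, rfl, rfl⟩)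
    · exact FinDist.ev_le fun Q _ => csInf_le (hb Q) (Or.inl rfl)
    · obtain ⟨σ, rfl, hσ⟩ := hs y ρ hst
      rw [FinDist.ev_map]
      exact (FinDist.ev_mono fun z _ => hv z).trans hσ

/-- A lower bound on the fair characteristics of a family of processes that is closed under
internal transitions. -/
theorem le_fair_of_cover {X : Type*} (f : X → Proc C) (v : X → ℝ)
    (h1 : ∀ x, v x ≤ may φ (f x))
    (hs : ∀ x ρ, Step (f x) .tau ρ → ∃ σ : FinDist X, ρ = σ.map f ∧ v x ≤ σ.ev v) (x : X) :
    v x ≤ fair φ (f x) := by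
  -- Dually, a supremum over the fibre with the trivial lower bound 0 inserted; it is bounded by the
  -- may value.
  let s : Proc C → Set ℝ := fun P => insert 0 {r | ∃ y, f y = P ∧ v y = r}
  have hm : ∀ P, may φ P ∈ upperBounds (s P) := by
    rintro P _ (rfl | ⟨y, rfl, rfl⟩)
    · exact may_nonneg P
    · exact h1 y
  have hb : ∀ P, BddAbove (s P) := fun P => ⟨_, hm P⟩
  have hne : ∀ P, (s P).Nonempty := fun P => ⟨0, Or.inl rfl⟩
  have hv : ∀ y, v y ≤ sSup (s (f y)) := fun y => le_csSup (hb _) (Or.inr ⟨y, rfl, rfl⟩)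
  refine (hv x).trans (le_fair_of_subharmonic (f := fun P => sSup (s P)) ?_ ?_ (f x))
  · exact fun P => csSup_le (hne P) (hm P)
  · intro P ρ hst
    refine csSup_le (hne P) ?_
    rintro _ (rfl | ⟨y, rfl, rfl⟩)
    · exact FinDist.le_ev fun Q _ => le_csSup (hb Q) (Or.inl rfl)
    · obtain ⟨σ, rfl, hσ⟩ := hs y ρ hst
      rw [FinDist.ev_map]
      exact hσ.trans (FinDist.ev_mono fun z _ => hv z)

end Chi

/-! ### Both characteristics at once, and their invariance under bisimulation -/

/-- The two kinds of testing characteristics. -/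
inductive Mode : Type
  | may
  | fair

/-- The characteristic of a distribution. -/
noncomputable def Mode.chi {C : Type u} : Mode → Set (Proc C) → FinDist (Proc C) → ℝ
  | .may => chiMay
  | .fair => chiFair

/-- The characteristic of a process. -/
noncomputable def Mode.val {C : Type u} (m : Mode) (φ : Set (Proc C)) (P : Proc C) : ℝ :=
  m.chi φ (dirac P)

theorem Mode.chi_eq_ev {C : Type u} (m : Mode) (φ : Set (Proc C)) (μ : FinDist (Proc C)) :
    m.chi φ μ = μ.ev (m.val φ) := by
  cases m
  · exact chiMay_eq_ev μ
  · exact chiFair_eq_ev μ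

/-- A span of processes that is a bisimulation for internal transitions and respects the
observations. -/
structure TauSpan {C : Type u} {C' : Type v} {X : Type*} (φ : Set (Proc C)) (φ' : Set (Proc C'))
    (f : X → Proc C) (g : X → Proc C') : Prop where
  obs : ∀ x, f x ∈ φ ↔ g x ∈ φ'
  forth : ∀ x ρ, Step (f x) .tau ρ → ∃ σ : FinDist X, ρ = σ.map f ∧ Step (g x) .tau (σ.map g)
  back : ∀ x ρ, Step (g x) .tau ρ → ∃ σ : FinDist X, ρ = σ.map g ∧ Step (f x) .tau (σ.map f)

namespace TauSpan

variable {C : Type u} {C' : Type v} {X : Type*} {φ : Set (Proc C)} {φ' : Set (Proc C')}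
  {f : X → Proc C} {g : X → Proc C'}

theorem symm (h : TauSpan φ φ' f g) : TauSpan φ' φ g f :=
  ⟨fun x => (h.obs x).symm, h.back, h.forth⟩

theorem may_le (h : TauSpan φ φ' f g) (x : X) : may φ (f x) ≤ may φ' (g x) := by
  refine may_le_of_cover f (fun x => may φ' (g x)) (fun _ => may_nonneg _)
    (fun x hx => (may_eq_one ((h.obs x).1 hx)).ge) (fun x ρ hs => ?_) x
  obtain ⟨σ, hσ, hs'⟩ := h.forth x ρ hs
  exact ⟨σ, hσ, by simpa using hs'.ev_may_le (φ := φ')⟩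

theorem may_eq (h : TauSpan φ φ' f g) (x : X) : may φ (f x) = may φ' (g x) :=
  le_antisymm (h.may_le x) (h.symm.may_le x)

/-- Along `g`, the fair value of `f x` does not decrease in expectation because moves of `g x` lift
back to `f x`. It lies below the may value of `g x` because the may values are already known to
agree. -/
theorem fair_le (h : TauSpan φ φ' f g) (x : X) : fair φ (f x) ≤ fair φ' (g x) := by
  refine le_fair_of_cover g (fun x => fair φ (f x))
    (fun x => (fair_le_may _).trans_eq (h.may_eq x)) (fun x ρ hs => ?_) x
  obtain ⟨σ, hσ, hs'⟩ := h.back x ρ hs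
  exact ⟨σ, hσ, by simpa using hs'.le_ev_fair (φ := φ)⟩

theorem val_eq (h : TauSpan φ φ' f g) (m : Mode) (x : X) : m.val φ (f x) = m.val φ' (g x) := by
  cases m
  · exact h.may_eq x
  · exact le_antisymm (h.fair_le x) (h.symm.fair_le x)

end TauSpan
/-! ### Substitution -/

namespace Term

variable {C : Type u}

theorem subst_renVar {n k l : ℕ} (T : Term C n) (r : Fin n → Fin k) (σ : Fin k → Term C l) :
    (T.renVar r).subst σ = T.subst fun i => σ (r i) := by
  induction T generalizing k l with
  | nil | var => rfl
  | sum m α T ih => simp only [renVar, subst, ih]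
  | psum m p hp hs T ih => simp only [renVar, subst, ih]
  | par S T ihS ihT => simp only [renVar, subst, ihS, ihT]
  | res L T ih => simp only [renVar, subst, ih]
  | fix T ih =>
    simp only [renVar, subst, ih]
    congr 2
    funext i
    cases i using Fin.cases <;> rfl

theorem renVar_renVar {n k l : ℕ} (T : Term C n) (r : Fin n → Fin k) (s : Fin k → Fin l) :
    (T.renVar r).renVar s = T.renVar fun i => s (r i) := by
  induction T generalizing k l with
  | nil | var => rfl
  | sum m α T ih => simp only [renVar, ih]
  | psum m p hp hs T ih => simp only [renVar, ih]
  | par S T ihS ihT => simp only [renVar, ihS, ihT]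
  | res L T ih => simp only [renVar, ih]
  | fix T ih =>
    simp only [renVar, ih]
    congr 2
    funext i
    cases i using Fin.cases <;> rfl

theorem renVar_subst {n k l : ℕ} (T : Term C n) (σ : Fin n → Term C k) (r : Fin k → Fin l) :
    (T.subst σ).renVar r = T.subst fun i => (σ i).renVar r := by
  induction T generalizing k l with
  | nil | var => rfl
  | sum m α T ih => simp only [renVar, subst, ih]
  | psum m p hp hs T ih => simp only [renVar, subst, ih]
  | par S T ihS ihT => simp only [renVar, subst, ihS, ihT]
  | res L T ih => simp only [renVar, subst, ih]
  | fix T ih =>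
    simp only [renVar, subst, ih]
    congr 2
    funext i
    cases i using Fin.cases
    · rfl
    · simp only [Fin.cases_succ, renVar_renVar]

theorem subst_subst {n k l : ℕ} (T : Term C n) (σ : Fin n → Term C k) (τ : Fin k → Term C l) :
    (T.subst σ).subst τ = T.subst fun i => (σ i).subst τ := by
  induction T generalizing k l with
  | nil | var => rfl
  | sum m α T ih => simp only [subst, ih]
  | psum m p hp hs T ih => simp only [subst, ih]
  | par S T ihS ihT => simp only [subst, ihS, ihT]
  | res L T ih => simp only [subst, ih]
  | fix T ih =>
    simp only [subst, ih]
    congr 2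
    funext i
    cases i using Fin.cases
    · rfl
    · simp only [Fin.cases_succ, renVar_subst, subst_renVar]

theorem subst_var {n : ℕ} (T : Term C n) : T.subst var = T := by
  induction T with
  | nil | var => rfl
  | sum m α T ih => simp only [subst, ih]
  | psum m p hp hs T ih => simp only [subst, ih]
  | par S T ihS ihT => simp only [subst, ihS, ihT]
  | res L T ih => simp only [subst, ih]
  | fix T ih =>
    simp only [subst]
    conv_rhs => rw [← ih]
    congr 2
    funext i
    cases i using Fin.cases <;> rfl

theorem subst_closed (P : Proc C) (σ : Fin 0 → Proc C) : P.subst σ = P := by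
  rw [Subsingleton.elim σ var, subst_var]

/-- Instantiating the variables of the body of a recursion other than the recursion variable. -/
theorem subst_lift_subst {n : ℕ} (T : Term C (n + 1)) (σ : Fin n → Proc C) (P : Proc C) :
    (T.subst (Fin.cases (var 0) fun i => (σ i).renVar Fin.succ) : Term C 1).subst (fun _ => P) =
      T.subst (Fin.cases P σ) := by
  rw [subst_subst]
  congr 1
  funext i
  cases i using Fin.cases
  · rfl
  · simp only [Fin.cases_succ, subst_renVar, subst_closed]

/-! ### Syntactic restrictions -/

/-- All actions of the term are in `A`, all its localizations are in `M`, and it has no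
probabilistic choice if `b` holds. -/
def Ok (A : Set (Act C)) (M : Set (Finset C)) (b : Prop) : {n : ℕ} → Term C n → Prop
  | _, nil => True
  | _, var _ => True
  | _, sum _ α T => ∀ i, α i ∈ A ∧ (T i).Ok A M b
  | _, psum _ _ _ _ T => ¬ b ∧ ∀ i, (T i).Ok A M b
  | _, par S T => S.Ok A M b ∧ T.Ok A M b
  | _, res L T => L ∈ M ∧ T.Ok A M b
  | _, fix T => T.Ok A M b

variable {A A' : Set (Act C)} {M M' : Set (Finset C)} {b b' : Prop}

theorem Ok.mono {n : ℕ} {T : Term C n} (h : T.Ok A M b) (hA : A ⊆ A') (hM : M ⊆ M')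
    (hb : b' → b) : T.Ok A' M' b' := by
  induction T with
  | nil | var => trivial
  | sum m α T ih => exact fun i => ⟨hA (h i).1, ih i (h i).2⟩
  | psum m p hp hs T ih => exact ⟨fun hb' => h.1 (hb hb'), fun i => ih i (h.2 i)⟩
  | par S T ihS ihT => exact ⟨ihS h.1, ihT h.2⟩
  | res L T ih => exact ⟨hM h.1, ih h.2⟩
  | fix T ih => exact ih h

theorem Ok.inter {n : ℕ} {T : Term C n} (h : T.Ok A M b) (h' : T.Ok A' M' b') :
    T.Ok (A ∩ A') (M ∩ M') (b ∨ b') := by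
  induction T with
  | nil | var => trivial
  | sum m α T ih => exact fun i => ⟨⟨(h i).1, (h' i).1⟩, ih i (h i).2 (h' i).2⟩
  | psum m p hp hs T ih => exact ⟨not_or.2 ⟨h.1, h'.1⟩, fun i => ih i (h.2 i) (h'.2 i)⟩
  | par S T ihS ihT => exact ⟨ihS h.1 h'.1, ihT h.2 h'.2⟩
  | res L T ih => exact ⟨⟨h.1, h'.1⟩, ih h.2 h'.2⟩
  | fix T ih => exact ih h h'

theorem Ok.renVar {n k : ℕ} {T : Term C n} (h : T.Ok A M b) (r : Fin n → Fin k) :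
    (T.renVar r).Ok A M b := by
  induction T generalizing k with
  | nil | var => trivial
  | sum m α T ih => exact fun i => ⟨(h i).1, ih i (h i).2 r⟩
  | psum m p hp hs T ih => exact ⟨h.1, fun i => ih i (h.2 i) r⟩
  | par S T ihS ihT => exact ⟨ihS h.1 r, ihT h.2 r⟩
  | res L T ih => exact ⟨h.1, ih h.2 r⟩
  | fix T ih => exact ih h _

theorem Ok.subst {n k : ℕ} {T : Term C n} (h : T.Ok A M b) {σ : Fin n → Term C k}
    (hσ : ∀ i, (σ i).Ok A M b) : (T.subst σ).Ok A M b := by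
  induction T generalizing k with
  | nil => trivial
  | var i => exact hσ i
  | sum m α T ih => exact fun i => ⟨(h i).1, ih i (h i).2 hσ⟩
  | psum m p hp hs T ih => exact ⟨h.1, fun i => ih i (h.2 i) hσ⟩
  | par S T ihS ihT => exact ⟨ihS h.1 hσ, ihT h.2 hσ⟩
  | res L T ih => exact ⟨h.1, ih h.2 hσ⟩
  | fix T ih =>
    refine ih h fun i => ?_
    cases i using Fin.cases
    · trivial
    · exact (hσ _).renVar _

theorem isCCS_iff_ok {n : ℕ} {T : Term C n} : T.IsCCS ↔ T.Ok Set.univ Set.univ True := by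
  induction T with
  | nil | var => exact Iff.rfl
  | sum m α T ih => simp [IsCCS, Ok, ih]
  | psum m p hp hs T ih => simp [IsCCS, Ok]
  | par S T ihS ihT => simp [IsCCS, Ok, ihS, ihT]
  | res L T ih => simp [IsCCS, Ok, ih]
  | fix T ih => simp [IsCCS, Ok, ih]

/-- Membership of a term in the class of CCS terms (if `b` holds) or of RCCS terms (otherwise). -/
abbrev Cls (b : Prop) {n : ℕ} (T : Term C n) : Prop := T.Ok Set.univ Set.univ b

theorem cls_of_not {n : ℕ} (T : Term C n) (hb : ¬ b) : T.Cls b := by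
  induction T with
  | nil | var => trivial
  | sum m α T ih => exact fun i => ⟨trivial, ih i⟩
  | psum m p hp hs T ih => exact ⟨hb, ih⟩
  | par S T ihS ihT => exact ⟨ihS, ihT⟩
  | res L T ih => exact ⟨trivial, ih⟩
  | fix T ih => exact ih

/-- The channel `w` occurs neither in an action nor in a localization. -/
abbrev Fresh (w : C) {n : ℕ} (T : Term C n) : Prop :=
  T.Ok {α | w ∉ α.channels} {L | w ∉ L} False

/-- The channel `w` occurs only in the action `w`, neither as a co-action nor in a localization. -/
abbrev Positive (w : C) {n : ℕ} (T : Term C n) : Prop :=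
  T.Ok {α | α ≠ .ext (.neg w)} {L | w ∉ L} False

theorem fresh_iff {w : C} {n : ℕ} {T : Term C n} : T.Fresh w ↔ w ∉ T.channels := by
  induction T with
  | nil | var => simp [Ok, channels]
  | sum m α T ih => simp only [Ok, channels, ih]; simp [not_or]
  | psum m p hp hs T ih => simp only [Ok, channels, ih]; simp
  | par S T ihS ihT => simp only [Ok, channels, ihS, ihT]; simp
  | res L T ih => simp only [Ok, channels, ih]; simp
  | fix T ih => simp only [Ok, channels, ih]

theorem Fresh.positive {w : C} {n : ℕ} {T : Term C n} (h : T.Fresh w) : T.Positive w :=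
  h.mono (fun α hα => by rintro rfl; exact hα rfl) subset_rfl id

theorem finite_channels {n : ℕ} (T : Term C n) : T.channels.Finite := by
  have hact : ∀ α : Act C, α.channels.Finite := by
    rintro (l | _)
    · exact Set.finite_singleton _
    · exact Set.finite_empty
  induction T with
  | nil | var => exact Set.finite_empty
  | sum m α T ih => exact Set.finite_iUnion fun i => (hact _).union (ih i)
  | psum m p hp hs T ih => exact Set.finite_iUnion ih
  | par S T ihS ihT => exact ihS.union ihT
  | res L T ih => exact (Finset.finite_toSet L).union ih
  | fix T ih => exact ih

theorem ok_channels {n : ℕ} (T : Term C n) {S : Set C} (h : T.channels ⊆ S) :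
    T.Ok {α | α.channels ⊆ S} Set.univ False := by
  induction T with
  | nil | var => trivial
  | sum m α T ih =>
    intro i
    have := (Set.subset_iUnion _ i).trans h
    exact ⟨Set.subset_union_left.trans this, ih i (Set.subset_union_right.trans this)⟩
  | psum m p hp hs T ih => exact ⟨id, fun i => ih i ((Set.subset_iUnion _ i).trans h)⟩
  | par S T ihS ihT =>
    exact ⟨ihS (Set.subset_union_left.trans h), ihT (Set.subset_union_right.trans h)⟩
  | res L T ih => exact ⟨trivial, ih (Set.subset_union_right.trans h)⟩
  | fix T ih => exact ih h

end Term

theorem FinDist.finite_channels {C : Type u} (μ : FinDist (Proc C)) :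
    (FinDist.channels μ).Finite :=
  Set.Finite.biUnion (Finset.finite_toSet _) fun P _ => Term.finite_channels P

theorem FinDist.all_fresh {C : Type u} {μ : FinDist (Proc C)} {w : C}
    (h : w ∉ FinDist.channels μ) : μ.All (Term.Fresh w) := fun P hP =>
  Term.fresh_iff.2 fun hw => h (Set.mem_biUnion (x := P) hP hw)

/-! ### Transitions and syntactic restrictions -/

section Step

variable {C : Type u}

/-- Syntactic restrictions are invariant under transitions and bound the actions that can occur.
Hence the processes obeying one form a family to which the cover lemmas apply. -/
theorem Step.ok {A : Set (Act C)} {M : Set (Finset C)} {b : Prop} {P : Proc C} {β : Act C}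
    {ρ : FinDist (Proc C)} (hs : Step P β ρ) (h : P.Ok A M b) :
    (β = .tau ∨ β ∈ A) ∧ ρ.All (Term.Ok A M b) := by
  induction hs with
  | sum m α T i => exact ⟨.inr (h i).1, FinDist.all_dirac.2 (h i).2⟩
  | psum m p hp hsum T =>
    exact ⟨.inl rfl, FinDist.All.convexComb fun i => FinDist.all_dirac.2 (h.2 i)⟩
  | parL _ ih =>
    exact ⟨(ih h.1).1, (ih h.1).2.map₂ (FinDist.all_dirac.2 h.2) fun _ _ h h' => ⟨h, h'⟩⟩
  | parR _ ih =>
    exact ⟨(ih h.2).1, (FinDist.all_dirac.2 h.1).map₂ (ih h.2).2 fun _ _ h h' => ⟨h, h'⟩⟩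
  | comm _ _ ih₁ ih₂ =>
    exact ⟨.inl rfl, (ih₁ h.1).2.map₂ (ih₂ h.2).2 fun _ _ h h' => ⟨h, h'⟩⟩
  | res _ _ ih => exact ⟨(ih h.2).1, FinDist.all_map.2 ((ih h.2).2.mono fun _ h' => ⟨h.1, h'⟩)⟩
  | @fix T _ _ _ ih => exact ih (Term.Ok.subst (T := T) h fun _ => h)

theorem Step.label_mem {A : Set (Act C)} {M : Set (Finset C)} {b : Prop} {P : Proc C}
    {l : Label C} {ρ : FinDist (Proc C)} (hs : Step P (.ext l) ρ) (h : P.Ok A M b) :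
    .ext l ∈ A := (hs.ok h).1.resolve_left (by simp)

/-- The processes that can immediately perform an external action in `Λ`. -/
def can (Λ : Set (Label C)) : Set (Proc C) := {P | ∃ l ∈ Λ, ∃ ρ, Step P (.ext l) ρ}

theorem psiExt_eq_can : psiExt C = can Set.univ := by
  ext P; simp [psiExt, can]

theorem psiOmega_eq_can : psiOmega C = can {.pos none} := by
  ext P; simp [psiOmega, can]

theorem mem_can_singleton {l : Label C} {P : Proc C} : P ∈ can {l} ↔ ∃ ρ, Step P (.ext l) ρ := by
  simp [can]

end Step

/-! ### Injective renaming -/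

/-- Applying a function on channels to a label. -/
def Label.map {C : Type u} {C' : Type v} (f : C → C') : Label C → Label C'
  | .pos a => .pos (f a)
  | .neg a => .neg (f a)

namespace Term

variable {C : Type u} {C' : Type v}

theorem act_map_ext (f : C → C') (l : Label C) : Act.map f (.ext l) = .ext (l.map f) := by
  cases l <;> rfl

theorem act_map_channels (f : C → C') (α : Act C) : (α.map f).channels = f '' α.channels := by
  rcases α with (_ | _) | _ <;> simp [Act.map, Act.channels, Label.chan]

theorem label_map_compl (f : C → C') (l : Label C) : (l.map f).compl = l.compl.map f := by
  cases l <;> rfl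

theorem label_map_injective (e : C ↪ C') : Function.Injective (Label.map e) := by
  rintro (a | a) (b | b) h <;> simp_all [Label.map]

/-- Renaming all channels, whether global or localized, along an embedding. -/
noncomputable abbrev emb (e : C ↪ C') {n : ℕ} (T : Term C n) : Term C' n := T.rename e e

theorem emb_res (e : C ↪ C') {n : ℕ} (L : Finset C) (T : Term C n) :
    emb e (.res L T) = .res (L.map e) (emb e T) := by
  simp only [emb, rename, ite_self]

theorem emb_renVar (e : C ↪ C') {n k : ℕ} (T : Term C n) (r : Fin n → Fin k) :
    emb e (T.renVar r) = (emb e T).renVar r := by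
  induction T generalizing k with
  | nil | var => rfl
  | sum m α T ih => simp only [rename, renVar, ih]
  | psum m p hp hs T ih => simp only [rename, renVar, ih]
  | par S T ihS ihT => simp only [rename, renVar, ihS, ihT]
  | res L T ih => simp only [emb_res, renVar, ih]
  | fix T ih => simp only [rename, renVar, ih]

theorem emb_subst (e : C ↪ C') {n k : ℕ} (T : Term C n) (σ : Fin n → Term C k) :
    emb e (T.subst σ) = (emb e T).subst fun i => emb e (σ i) := by
  induction T generalizing k with
  | nil | var => rfl
  | sum m α T ih => simp only [rename, subst, ih]
  | psum m p hp hs T ih => simp only [rename, subst, ih]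
  | par S T ihS ihT => simp only [rename, subst, ihS, ihT]
  | res L T ih => simp only [emb_res, subst, ih]
  | fix T ih =>
    simp only [rename, subst, ih]
    congr 2
    funext i
    cases i using Fin.cases
    · rfl
    · simp only [Fin.cases_succ, emb_renVar]

end Term

section Equivariance

variable {C : Type u} {C' : Type v}

open Term

theorem Step.emb (e : C ↪ C') {P : Proc C} {β : Act C} {ρ : FinDist (Proc C)} (h : Step P β ρ) :
    Step (emb e P) (β.map e) (ρ.map (emb e)) := by
  induction h with
  | sum m α T i =>
    rw [Convexity.StdSimplex.map_single]
    exact Step.sum m (fun i => (α i).map e) (fun i => Term.emb e (T i)) i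
  | psum m p hp hsum T =>
    convert Step.psum m p hp hsum fun i => Term.emb e (T i) using 1
    · rfl
    · rfl
    exact FinDist.ext_ev fun f => by simp [FinDist.ev_convexComb]
  | @parL S T β ρ _ ih =>
    convert Step.parL (T := Term.emb e T) ih using 1
    · rfl
    exact FinDist.ext_ev fun f => by simp [Term.rename]
  | @parR S T β ρ _ ih =>
    convert Step.parR (S := Term.emb e S) ih using 1
    · rfl
    exact FinDist.ext_ev fun f => by simp [Term.rename]
  | @comm S T l ρ₁ ρ₂ _ _ ih₁ ih₂ =>
    rw [act_map_ext] at ih₁ ih₂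
    rw [← label_map_compl] at ih₂
    convert Step.comm ih₁ ih₂ using 1
    · rfl
    · rfl
    exact FinDist.ext_ev fun f => by simp [Term.rename]
  | @res T L β ρ _ hL ih =>
    have : ∀ c ∈ (β.map e).channels, c ∉ L.map e := by
      rw [act_map_channels]
      rintro _ ⟨c, hc, rfl⟩
      simpa using hL c hc
    convert Step.res ih this using 1
    · exact emb_res e L T
    · exact FinDist.ext_ev fun f => by simp [emb_res]
  | fix _ ih =>
    rw [emb_subst] at ih
    exact Step.fix ih

/-- Injectivity is essential for reflecting transitions: otherwise renaming could create new
communications or make an action collide with a localized channel. -/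
theorem Step.of_emb (e : C ↪ C') {Q : Proc C'} {β' : Act C'} {ρ' : FinDist (Proc C')}
    (h : Step Q β' ρ') : ∀ P : Proc C, Q = Term.emb e P →
      ∃ β ρ, β' = β.map e ∧ ρ' = ρ.map (Term.emb e) ∧ Step P β ρ := by
  induction h with
  | sum m α T i =>
    rintro P hP
    cases P <;> simp only [Term.rename, reduceCtorEq] at hP
    · injection hP with _ h1 h2 h3
      subst h1
      obtain rfl := eq_of_heq h2
      obtain rfl := eq_of_heq h3
      exact ⟨_, _, rfl, (Convexity.StdSimplex.map_single _ _).symm, Step.sum _ _ _ i⟩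
  | psum m p hp hsum T =>
    rintro P hP
    cases P <;> simp only [Term.rename, reduceCtorEq] at hP
    · injection hP with _ h1 h2 h3
      subst h1
      obtain rfl := eq_of_heq h2
      obtain rfl := eq_of_heq h3
      refine ⟨.tau, _, rfl, ?_, Step.psum _ _ _ _ _⟩
      exact FinDist.ext_ev fun f => by simp [FinDist.ev_convexComb]
  | parL _ ih =>
    rintro P hP
    cases P <;> simp only [Term.rename, reduceCtorEq] at hP
    · injection hP with _ h1 h2
      obtain ⟨β, ρ, rfl, rfl, hs⟩ := ih _ h1
      refine ⟨β, _, rfl, ?_, Step.parL hs⟩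
      exact FinDist.ext_ev fun f => by simp [Term.rename, h2]
  | parR _ ih =>
    rintro P hP
    cases P <;> simp only [Term.rename, reduceCtorEq] at hP
    · injection hP with _ h1 h2
      obtain ⟨β, ρ, rfl, rfl, hs⟩ := ih _ h2
      refine ⟨β, _, rfl, ?_, Step.parR hs⟩
      exact FinDist.ext_ev fun f => by simp [Term.rename, h1]
  | @comm _ _ l _ _ _ _ ih₁ ih₂ =>
    rintro P hP
    cases P <;> simp only [Term.rename, reduceCtorEq] at hP
    · injection hP with _ h1 h2
      obtain ⟨β, ρ, hβ, rfl, hs⟩ := ih₁ _ h1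
      obtain ⟨β', ρ', hβ', rfl, hs'⟩ := ih₂ _ h2
      rcases β with k | _
      · rcases β' with k' | _
        · rw [act_map_ext] at hβ hβ'
          injection hβ with hβ
          injection hβ' with hβ'
          subst hβ
          rw [label_map_compl] at hβ'
          obtain rfl := label_map_injective e hβ'
          refine ⟨.tau, _, rfl, ?_, Step.comm hs hs'⟩
          exact FinDist.ext_ev fun f => by simp [Term.rename]
        · simp [Act.map] at hβ'
      · simp [Act.map] at hβ
  | res _ hL ih =>
    rintro P hP
    cases P
    case res L T =>
      rw [emb_res] at hP
      injection hP with _ h1 h2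
      obtain ⟨β, ρ, rfl, rfl, hs⟩ := ih _ h2
      refine ⟨β, ρ.res L, rfl, ?_, Step.res hs fun c hc hcL => ?_⟩
      · exact FinDist.ext_ev fun f => by simp [emb_res, h1]
      · refine hL (e c) ?_ ?_
        · rw [act_map_channels]; exact ⟨c, hc, rfl⟩
        · rw [h1]; simpa using hcL
    case var j => exact j.elim0
    all_goals simp only [Term.rename, reduceCtorEq] at hP
  | fix _ ih =>
    rintro P hP
    cases P <;> simp only [Term.rename, reduceCtorEq] at hP
    · rename_i T
      injection hP with _ h1
      obtain ⟨β, ρ, rfl, rfl, hs⟩ := ih (T.subst fun _ => .fix T) (by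
        rw [emb_subst, h1]
        rfl)
      exact ⟨β, ρ, rfl, rfl, Step.fix hs⟩

theorem tauSpan_emb (e : C ↪ C') (l : Label C) :
    TauSpan (can {l}) (can {l.map e}) (fun P : Proc C => P) (Term.emb e) where
  obs P := by
    simp only [mem_can_singleton]
    constructor
    · rintro ⟨ρ, h⟩
      have := h.emb e
      rw [act_map_ext] at this
      exact ⟨_, this⟩
    · rintro ⟨ρ, h⟩
      obtain ⟨β, ρ, hβ, -, hs⟩ := h.of_emb e P rfl
      rcases β with k | _
      · rw [act_map_ext] at hβ
        injection hβ with hβ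
        obtain rfl := label_map_injective e hβ
        exact ⟨_, hs⟩
      · simp [Act.map] at hβ
  forth P ρ h := ⟨ρ, (Convexity.StdSimplex.map_id ρ).symm, h.emb e⟩
  back P ρ h := by
    obtain ⟨β, ρ, hβ, rfl, hs⟩ := h.of_emb e P rfl
    rcases β with k | _
    · rw [act_map_ext] at hβ
      simp at hβ
    · refine ⟨ρ, rfl, ?_⟩
      erw [Convexity.StdSimplex.map_id ρ]
      exact hs

theorem chi_map_emb (m : Mode) (e : C ↪ C') (l : Label C) (μ : FinDist (Proc C)) :
    m.chi (can {l.map e}) (μ.map (Term.emb e)) = m.chi (can {l}) μ := by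
  rw [m.chi_eq_ev, m.chi_eq_ev, FinDist.ev_map]
  exact FinDist.ev_congr fun P _ => ((tauSpan_emb e l).val_eq m P).symm

end Equivariance
open Term

/-! ### Structural laws of parallel composition and localization -/

section Spans

variable {C : Type u}

/-- Reshapes the residual of a transition into the form a span demands; the required identity is
checked on expectations. -/
theorem Step.of_ev {P : Proc C} {β : Act C} {ρ ρ' : FinDist (Proc C)} (h : Step P β ρ)
    (he : ∀ f, ρ.ev f = ρ'.ev f) : Step P β ρ' := FinDist.ext_ev he ▸ h

/-- A span of processes that is a strong bisimulation. -/
structure StrongSpan {X : Type*} (f g : X → Proc C) : Prop where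
  forth : ∀ x β ρ, Step (f x) β ρ → ∃ σ : FinDist X, ρ = σ.map f ∧ Step (g x) β (σ.map g)
  back : ∀ x β ρ, Step (g x) β ρ → ∃ σ : FinDist X, ρ = σ.map g ∧ Step (f x) β (σ.map f)

theorem StrongSpan.tauSpan {X : Type*} {f g : X → Proc C} (h : StrongSpan f g)
    (Λ : Set (Label C)) : TauSpan (can Λ) (can Λ) f g where
  obs x := by
    constructor
    · rintro ⟨l, hl, ρ, hs⟩
      obtain ⟨σ, -, hs'⟩ := h.forth x _ _ hs
      exact ⟨l, hl, _, hs'⟩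
    · rintro ⟨l, hl, ρ, hs⟩
      obtain ⟨σ, -, hs'⟩ := h.back x _ _ hs
      exact ⟨l, hl, _, hs'⟩
  forth x := h.forth x .tau
  back x := h.back x .tau

theorem StrongSpan.val_eq {X : Type*} {f g : X → Proc C} (h : StrongSpan f g) (m : Mode)
    (Λ : Set (Label C)) (x : X) : m.val (can Λ) (f x) = m.val (can Λ) (g x) :=
  (h.tauSpan Λ).val_eq m x

theorem strongSpan_comm :
    StrongSpan (fun x : Proc C × Proc C => .par x.1 x.2) (fun x => .par x.2 x.1) := by
  have key : ∀ (P Q : Proc C) β ρ, Step (.par P Q) β ρ →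
      ∃ σ : FinDist (Proc C × Proc C), ρ = σ.map (fun x => .par x.1 x.2) ∧
        Step (.par Q P) β (σ.map fun x => .par x.2 x.1) := by
    intro P Q β ρ h
    cases h with
    | @parL _ _ _ ρ h =>
      exact ⟨ρ.map fun A => (A, Q), FinDist.ext_ev fun f => by simp,
        h.parR.of_ev fun f => by simp⟩
    | @parR _ _ _ ρ h =>
      exact ⟨ρ.map fun A => (P, A), FinDist.ext_ev fun f => by simp,
        h.parL.of_ev fun f => by simp⟩
    | @comm _ _ l ρ₁ ρ₂ h₁ h₂ =>
      have h₁' : Step P (.ext l.compl.compl) ρ₁ := by cases l <;> exact h₁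
      exact ⟨FinDist.map₂ Prod.mk ρ₁ ρ₂, FinDist.ext_ev fun f => by simp,
        (Step.comm h₂ h₁').of_ev fun f => by simp [FinDist.ev_comm ρ₂ ρ₁]⟩
  refine ⟨fun x β ρ h => key _ _ _ _ h, fun x β ρ h => ?_⟩
  obtain ⟨σ, rfl, hs⟩ := key _ _ _ _ h
  exact ⟨σ.map Prod.swap, FinDist.ext_ev fun f => by simp, hs.of_ev fun f => by simp⟩

theorem strongSpan_assoc :
    StrongSpan (fun x : Proc C × Proc C × Proc C => .par (.par x.1 x.2.1) x.2.2)
      (fun x => .par x.1 (.par x.2.1 x.2.2)) where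
  forth := by
    rintro ⟨P, Q, R⟩ β ρ h
    cases h with
    | parL h =>
      cases h with
      | @parL _ _ _ ρ h =>
        exact ⟨ρ.map fun A => (A, Q, R), FinDist.ext_ev fun f => by simp,
          h.parL.of_ev fun f => by simp⟩
      | @parR _ _ _ ρ h =>
        exact ⟨ρ.map fun A => (P, A, R), FinDist.ext_ev fun f => by simp,
          h.parL.parR.of_ev fun f => by simp⟩
      | @comm _ _ l ρ₁ ρ₂ h₁ h₂ =>
        exact ⟨FinDist.map₂ (fun A B => (A, B, R)) ρ₁ ρ₂, FinDist.ext_ev fun f => by simp,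
          (Step.comm h₁ h₂.parL).of_ev fun f => by simp⟩
    | @parR _ _ _ ρ h =>
      exact ⟨ρ.map fun A => (P, Q, A), FinDist.ext_ev fun f => by simp,
        h.parR.parR.of_ev fun f => by simp⟩
    | @comm _ _ l ρ₁ ρ₂ h₁ h₂ =>
      cases h₁ with
      | @parL _ _ _ ρ₁ h₁ =>
        exact ⟨FinDist.map₂ (fun A B => (A, Q, B)) ρ₁ ρ₂, FinDist.ext_ev fun f => by simp,
          (Step.comm h₁ h₂.parR).of_ev fun f => by simp⟩
      | @parR _ _ _ ρ₁ h₁ =>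
        exact ⟨FinDist.map₂ (fun A B => (P, A, B)) ρ₁ ρ₂, FinDist.ext_ev fun f => by simp,
          (Step.comm h₁ h₂).parR.of_ev fun f => by simp⟩
  back := by
    rintro ⟨P, Q, R⟩ β ρ h
    cases h with
    | @parL _ _ _ ρ h =>
      exact ⟨ρ.map fun A => (A, Q, R), FinDist.ext_ev fun f => by simp,
        h.parL.parL.of_ev fun f => by simp⟩
    | parR h =>
      cases h with
      | @parL _ _ _ ρ h =>
        exact ⟨ρ.map fun A => (P, A, R), FinDist.ext_ev fun f => by simp,
          h.parR.parL.of_ev fun f => by simp⟩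
      | @parR _ _ _ ρ h =>
        exact ⟨ρ.map fun A => (P, Q, A), FinDist.ext_ev fun f => by simp,
          h.parR.of_ev fun f => by simp⟩
      | @comm _ _ l ρ₁ ρ₂ h₁ h₂ =>
        exact ⟨FinDist.map₂ (fun A B => (P, A, B)) ρ₁ ρ₂, FinDist.ext_ev fun f => by simp,
          (Step.comm h₁.parR h₂).of_ev fun f => by simp⟩
    | @comm _ _ l ρ₁ ρ₂ h₁ h₂ =>
      cases h₂ with
      | @parL _ _ _ ρ₂ h₂ =>
        exact ⟨FinDist.map₂ (fun A B => (A, B, R)) ρ₁ ρ₂, FinDist.ext_ev fun f => by simp,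
          (Step.comm h₁ h₂).parL.of_ev fun f => by simp⟩
      | @parR _ _ _ ρ₂ h₂ =>
        exact ⟨FinDist.map₂ (fun A B => (A, Q, B)) ρ₁ ρ₂, FinDist.ext_ev fun f => by simp,
          (Step.comm h₁.parL h₂).of_ev fun f => by simp⟩

theorem StrongSpan.par {X : Type*} {f g : X → Proc C} (h : StrongSpan f g) :
    StrongSpan (fun x : X × Proc C => .par (f x.1) x.2) (fun x => .par (g x.1) x.2) := by
  have key : ∀ {f g : X → Proc C}, (∀ x β ρ, Step (f x) β ρ →
      ∃ σ : FinDist X, ρ = σ.map f ∧ Step (g x) β (σ.map g)) → ∀ (x : X × Proc C) β ρ,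
      Step (.par (f x.1) x.2) β ρ → ∃ σ : FinDist (X × Proc C),
        ρ = σ.map (fun x => .par (f x.1) x.2) ∧
          Step (.par (g x.1) x.2) β (σ.map fun x => .par (g x.1) x.2) := by
    rintro f g h ⟨x, R⟩ β ρ hs
    cases hs with
    | parL hs =>
      obtain ⟨σ, rfl, hs'⟩ := h _ _ _ hs
      exact ⟨σ.map fun x => (x, R), FinDist.ext_ev fun f => by simp,
        hs'.parL.of_ev fun f => by simp⟩
    | @parR _ _ _ ρ hs =>
      exact ⟨ρ.map fun A => (x, A), FinDist.ext_ev fun f => by simp,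
        hs.parR.of_ev fun f => by simp⟩
    | @comm _ _ l ρ₁ ρ₂ h₁ h₂ =>
      obtain ⟨σ, rfl, hs'⟩ := h _ _ _ h₁
      exact ⟨FinDist.map₂ Prod.mk σ ρ₂, FinDist.ext_ev fun f => by simp,
        (hs'.comm h₂).of_ev fun f => by simp⟩
  exact ⟨key h.forth, key h.back⟩

theorem label_chan_compl (l : Label C) : l.compl.chan = l.chan := by cases l <;> rfl

/-- Localizing one component of a parallel composition has the same internal behaviour as
localizing the other one. -/
theorem tauSpan_res_par (L : Finset C) {w : C} (hw : w ∉ L) :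
    TauSpan (can {.pos w}) (can {.pos w}) (fun x : Proc C × Proc C => .par (.res L x.1) x.2)
      (fun x => .par x.1 (.res L x.2)) where
  obs := by
    have hL : ∀ c ∈ (Act.ext (Label.pos w)).channels, c ∉ L := by
      rintro c (rfl : c = w); exact hw
    rintro ⟨P, Q⟩
    simp only [mem_can_singleton]
    constructor
    · rintro ⟨ρ, h⟩
      cases h with
      | parL h => cases h with | res h _ => exact ⟨_, h.parL⟩
      | parR h => exact ⟨_, (h.res hL).parR⟩
    · rintro ⟨ρ, h⟩
      cases h with
      | parL h => exact ⟨_, (h.res hL).parL⟩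
      | parR h => cases h with | res h _ => exact ⟨_, h.parR⟩
  forth := by
    rintro ⟨P, Q⟩ ρ h
    cases h with
    | parL h =>
      cases h with
      | @res _ _ _ ρ h _ =>
        exact ⟨ρ.map fun A => (A, Q), FinDist.ext_ev fun f => by simp,
          h.parL.of_ev fun f => by simp⟩
    | @parR _ _ _ ρ h =>
      exact ⟨ρ.map fun A => (P, A), FinDist.ext_ev fun f => by simp,
        (h.res (L := L) (by simp [Act.channels])).parR.of_ev fun f => by simp⟩
    -- The localized partner offers a channel outside `L`. The complementary action uses the same
    -- channel, so it would pass the localization on the other side too.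
    | @comm _ _ l _ ρ₂ h₁ h₂ =>
      cases h₁ with
      | @res _ _ _ ρ₁ h₁ hL =>
        exact ⟨FinDist.map₂ Prod.mk ρ₁ ρ₂, FinDist.ext_ev fun f => by simp,
          (h₁.comm (h₂.res (L := L) (by
            simpa [Act.channels, label_chan_compl] using hL))).of_ev fun f => by simp⟩
  back := by
    rintro ⟨P, Q⟩ ρ h
    cases h with
    | @parL _ _ _ ρ h =>
      exact ⟨ρ.map fun A => (A, Q), FinDist.ext_ev fun f => by simp,
        (h.res (L := L) (by simp [Act.channels])).parL.of_ev fun f => by simp⟩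
    | parR h =>
      cases h with
      | @res _ _ _ ρ h _ =>
        exact ⟨ρ.map fun A => (P, A), FinDist.ext_ev fun f => by simp,
          h.parR.of_ev fun f => by simp⟩
    | @comm _ _ l ρ₁ _ h₁ h₂ =>
      cases h₂ with
      | @res _ _ _ ρ₂ h₂ hL =>
        exact ⟨FinDist.map₂ Prod.mk ρ₁ ρ₂, FinDist.ext_ev fun f => by simp,
          ((h₁.res (L := L) (by
            simpa [Act.channels, label_chan_compl] using hL)).comm h₂).of_ev fun f => by simp⟩

/-- Localizing all channels but `w` turns the observation of `w` into the observation of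
arbitrary external actions. -/
theorem tauSpan_res (L : Finset C) {w : C} (hw : w ∉ L) :
    TauSpan (can {.pos w}) (can Set.univ)
      (fun x : {P : Proc C // P.Ok {α | ∀ l, α = .ext l → l.chan ∈ L ∨ l = .pos w} Set.univ False} =>
        x.1) (fun x => .res L x.1) where
  obs := by
    rintro ⟨P, hP⟩
    simp only [mem_can_singleton]
    constructor
    · rintro ⟨ρ, h⟩
      exact ⟨_, trivial, _, h.res (L := L) (by rintro c (rfl : c = w); exact hw)⟩
    · rintro ⟨l, -, ρ, h⟩
      cases h with
      | res h hL =>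
        rcases h.label_mem hP l rfl with h' | rfl
        · exact absurd h' (hL _ rfl)
        · exact ⟨_, h⟩
  forth := by
    rintro ⟨P, hP⟩ ρ h
    obtain ⟨σ, rfl⟩ := FinDist.exists_map_subtype (h.ok hP).2
    exact ⟨σ, rfl, (h.res (L := L) (by simp [Act.channels])).of_ev fun f => by simp⟩
  back := by
    rintro ⟨P, hP⟩ ρ h
    cases h with
    | res h hL =>
      obtain ⟨σ, rfl⟩ := FinDist.exists_map_subtype (h.ok hP).2
      exact ⟨σ, FinDist.ext_ev fun f => by simp, h⟩

theorem Mode.chi_par (m : Mode) (φ : Set (Proc C)) (μ ν : FinDist (Proc C)) :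
    m.chi φ (μ.par ν) = μ.ev fun P => ν.ev fun Q => m.val φ (.par P Q) := by
  rw [m.chi_eq_ev, FinDist.ev_par]

theorem chi_par_assoc (m : Mode) (Λ : Set (Label C)) (μ ν κ : FinDist (Proc C)) :
    m.chi (can Λ) ((μ.par ν).par κ) = m.chi (can Λ) (μ.par (ν.par κ)) := by
  simp only [m.chi_eq_ev, FinDist.ev_par]
  exact FinDist.ev_congr fun P _ => FinDist.ev_congr fun Q _ => FinDist.ev_congr fun R _ =>
    strongSpan_assoc.val_eq m Λ (P, Q, R)

theorem chi_res_par (m : Mode) {L : Finset C} {w : C} (hw : w ∉ L) (μ ν : FinDist (Proc C)) :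
    m.chi (can {.pos w}) ((μ.res L).par ν) = m.chi (can {.pos w}) (μ.par (ν.res L)) := by
  simp only [m.chi_eq_ev, FinDist.ev_par, FinDist.ev_res]
  exact FinDist.ev_congr fun P _ => FinDist.ev_congr fun Q _ =>
    (tauSpan_res_par L hw).val_eq m (P, Q)

theorem chi_res (m : Mode) {L : Finset C} {w : C} (hw : w ∉ L) {μ : FinDist (Proc C)}
    (hμ : μ.All (Term.Ok {α | ∀ l, α = .ext l → l.chan ∈ L ∨ l = .pos w} Set.univ False)) :
    m.chi (can {.pos w}) μ = m.chi (can Set.univ) (μ.res L) := by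
  rw [m.chi_eq_ev, m.chi_eq_ev, FinDist.ev_res]
  exact FinDist.ev_congr fun P hP => (tauSpan_res L hw).val_eq m ⟨P, hμ P hP⟩

theorem Mode.val_nonneg (m : Mode) (φ : Set (Proc C)) (P : Proc C) : 0 ≤ m.val φ P := by
  cases m
  · exact may_nonneg P
  · exact fair_nonneg P

theorem Mode.val_le_may (m : Mode) (φ : Set (Proc C)) (P : Proc C) : m.val φ P ≤ RCCS.may φ P := by
  cases m
  · exact le_rfl
  · exact fair_le_may P

/-- Processes without an observable action have characteristic zero. -/
theorem may_eq_zero {A : Set (Act C)} {M : Set (Finset C)} {b : Prop} {Λ : Set (Label C)}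
    (hA : ∀ l ∈ Λ, .ext l ∉ A) {P : Proc C} (hP : P.Ok A M b) : may (can Λ) P = 0 := by
  refine le_antisymm (may_le_of_cover (fun x : {P : Proc C // P.Ok A M b} => x.1) (fun _ => 0)
    (fun _ => le_rfl) ?_ ?_ ⟨P, hP⟩) (may_nonneg P)
  · rintro ⟨P, hP⟩ ⟨l, hl, ρ, h⟩
    exact absurd (h.label_mem hP) (hA l hl)
  · rintro ⟨P, hP⟩ ρ h
    obtain ⟨σ, rfl⟩ := FinDist.exists_map_subtype (h.ok hP).2
    exact ⟨σ, rfl, by simp⟩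

theorem val_eq_zero (m : Mode) {A : Set (Act C)} {M : Set (Finset C)} {b : Prop}
    {Λ : Set (Label C)} (hA : ∀ l ∈ Λ, .ext l ∉ A) {P : Proc C} (hP : P.Ok A M b) :
    m.val (can Λ) P = 0 :=
  le_antisymm ((m.val_le_may _ P).trans_eq (may_eq_zero hA hP)) (m.val_nonneg _ P)

/-! ### Finite choices and the copying observer -/

/-- The restrictions `A`, `M`, `b` are quantified after the witness, so that one choice process can
be shown to satisfy several of them, such as being CCS and using a channel only positively. -/
theorem exists_choice {s : Finset (Act C × Proc C)} (hs : s.Nonempty) :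
    ∃ K : Proc C, (∀ β ρ, Step K β ρ ↔ ∃ x ∈ s, β = x.1 ∧ ρ = dirac x.2) ∧
      ∀ (A : Set (Act C)) (M : Set (Finset C)) (b : Prop),
        (∀ x ∈ s, x.1 ∈ A ∧ x.2.Ok A M b) → K.Ok A M b := by
  obtain ⟨m, hm⟩ := Nat.exists_eq_succ_of_ne_zero hs.card_pos.ne'
  let e : s ≃ Fin (m + 1) := s.equivFinOfCardEq hm
  refine ⟨.sum m (fun i => (e.symm i).1.1) fun i => (e.symm i).1.2, fun β ρ => ⟨fun h => ?_, ?_⟩,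
    fun A M b h i => h _ (e.symm i).2⟩
  · cases h with
    | sum _ _ _ i => exact ⟨_, (e.symm i).2, rfl, rfl⟩
  · rintro ⟨x, hx, rfl, rfl⟩
    have := Step.sum m (fun i => (e.symm i).1.1) (fun i => (e.symm i).1.2) (e ⟨x, hx⟩)
    simpa using this

/-- The process `w.0`. -/
abbrev single (w : C) : Proc C := .sum 0 (fun _ => .ext (.pos w)) fun _ => .nil

theorem par_single_mem_can (w : C) (P : Proc C) : .par P (single w) ∈ can {.pos w} :=
  mem_can_singleton.2 ⟨_, (Step.sum 0 (fun _ => .ext (.pos w)) (fun _ => .nil) 0).parR⟩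

/-- `K` offers the actions in `Λ`, each followed by the action `w`. -/
def IsCopier (Λ : Set (Label C)) (w : C) (K : Proc C) : Prop :=
  ∀ β ρ, Step K β ρ ↔ ∃ l ∈ Λ, β = .ext l ∧ ρ = dirac (single w)

theorem exists_isCopier {Λ : Set (Label C)} (hf : Λ.Finite) (hne : Λ.Nonempty) {w : C}
    (hw : .neg w ∉ Λ) : ∃ K : Proc C, IsCopier Λ w K ∧ K.IsCCS ∧ K.Positive w := by
  classical
  obtain ⟨K, hK, hok⟩ := exists_choice (s := hf.toFinset.image fun l => (.ext l, single w))
    (by simpa using hne)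
  refine ⟨K, fun β ρ => ?_, isCCS_iff_ok.2 (hok _ _ _ ?_), hok _ _ _ ?_⟩
  · rw [hK]; simp
  · simp [Ok]
  · simp only [Finset.mem_image, Set.Finite.mem_toFinset, Set.mem_ofPred_eq, ne_eq,
      forall_exists_index, and_imp]
    rintro _ l hl rfl
    refine ⟨?_, fun _ => ⟨by simp, trivial⟩⟩
    rintro h
    injection h with h
    exact hw (h ▸ hl)

variable {Λ Λ' : Set (Label C)} {w : C} {K : Proc C}

theorem Fresh.not_step {P : Proc C} (hP : P.Fresh w) {l : Label C} (hl : l.chan = w)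
    {ρ : FinDist (Proc C)} : ¬ Step P (.ext l) ρ := fun h =>
  h.label_mem hP hl.symm

/-- Before `K` is triggered nothing can signal `w`, as `P` is fresh and `K` does not start with `w`.
`K` can be triggered exactly when `P` offers an action of `Λ'`, and then the signal is available at
once. So success of the composition amounts to reaching `can Λ'`; after the trigger the trivial
bound 1 suffices. -/
theorem may_par_copier (hK : IsCopier Λ w K) (hw : .pos w ∉ Λ)
    (hΛ : ∀ l, l ∈ Λ' ↔ l.compl ∈ Λ) {P : Proc C} (hP : P.Fresh w) :
    may (can {.pos w}) (.par P K) = may (can Λ') P := by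
  apply le_antisymm
  · refine may_le_of_cover
      (Sum.elim (fun x : {P : Proc C // P.Fresh w} => .par x.1 K) (fun P : Proc C => P))
      (Sum.elim (fun x => may (can Λ') x.1) fun _ => 1) ?_ ?_ ?_ (Sum.inl ⟨P, hP⟩)
    · rintro (x | x)
      · exact may_nonneg _
      · exact zero_le_one
    · rintro (⟨P, hP⟩ | P)
      · intro h
        obtain ⟨ρ, h⟩ := mem_can_singleton.1 h
        cases h with
        | parL h => exact absurd h (Fresh.not_step hP rfl)
        | parR h =>
          obtain ⟨l, hl, h', -⟩ := (hK _ _).1 h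
          injection h' with h'
          exact absurd (h' ▸ hl) hw
      · exact fun _ => le_rfl
    · rintro (⟨P, hP⟩ | P) ρ h
      · change Step (.par P K) .tau ρ at h
        cases h with
        | @parL _ _ _ ρ h =>
          obtain ⟨σ, rfl⟩ := FinDist.exists_map_subtype (h.ok hP).2
          refine ⟨σ.map Sum.inl, FinDist.ext_ev fun f => by simp, ?_⟩
          simpa using h.ev_may_le (φ := can Λ')
        | parR h =>
          obtain ⟨l, hl, h', -⟩ := (hK _ _).1 h
          exact absurd h' (by simp)
        | @comm _ _ l ρ₁ ρ₂ h₁ h₂ =>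
          obtain ⟨l', hl, h', -⟩ := (hK _ _).1 h₂
          injection h' with h'
          refine ⟨(ρ₁.par ρ₂).map Sum.inr, FinDist.ext_ev fun f => by simp, ?_⟩
          have : P ∈ can Λ' := ⟨l, (hΛ l).2 (h' ▸ hl), _, h₁⟩
          simp [may_eq_one this]
      · exact ⟨ρ.map Sum.inr, FinDist.ext_ev fun f => by simp, by simp⟩
  · refine may_le_of_superharmonic (f := fun P => may (can {.pos w}) (.par P K))
      (fun _ => may_nonneg _) ?_ ?_ P
    · rintro P ⟨l, hl, ρ, h⟩
      -- After this communication every residual contains `single w`, so its expected value is 1.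
      have hs := h.comm ((hK (.ext l.compl) _).2 ⟨_, (hΛ l).1 hl, rfl, rfl⟩)
      have := hs.ev_may_le (φ := can {.pos w})
      simp only [FinDist.ev_par, FinDist.ev_dirac, may_eq_one (par_single_mem_can w _),
        FinDist.ev_const] at this
      exact this
    · intro P ρ h
      simpa using (h.parL (T := K)).ev_may_le (φ := can {.pos w})

/-- As long as `K` is idle, both sides evolve alike and have equal may values. Once `K` has been
triggered the signal cannot be lost, so those states contribute 1; for this the residuals of `P`
must be tracked as fresh. -/
theorem fair_par_copier (hK : IsCopier Λ w K) (hw : .pos w ∉ Λ)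
    (hΛ : ∀ l, l ∈ Λ' ↔ l.compl ∈ Λ) {P : Proc C} (hP : P.Fresh w) :
    fair (can {.pos w}) (.par P K) = fair (can Λ') P := by
  apply le_antisymm
  · have key := le_fair_of_cover (φ := can Λ') (fun x : {P : Proc C // P.Fresh w} => x.1)
      (fun x => fair (can {.pos w}) (.par x.1 K)) ?_ ?_
    · exact key ⟨P, hP⟩
    · rintro ⟨P, hP⟩
      exact (fair_le_may _).trans_eq (may_par_copier hK hw hΛ hP)
    · rintro ⟨P, hP⟩ ρ h
      obtain ⟨σ, rfl⟩ := FinDist.exists_map_subtype (h.ok hP).2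
      exact ⟨σ, rfl, by simpa using (h.parL (T := K)).le_ev_fair (φ := can {.pos w})⟩
  · refine le_fair_of_cover
      (Sum.elim (fun x : {P : Proc C // P.Fresh w} => .par x.1 K)
        (fun x : {P : Proc C // P.Fresh w} => .par x.1 (single w)))
      (Sum.elim (fun x => fair (can Λ') x.1) fun _ => 1) ?_ ?_ (Sum.inl ⟨P, hP⟩)
    · rintro (⟨P, hP⟩ | ⟨P, hP⟩)
      · exact (fair_le_may _).trans_eq (may_par_copier hK hw hΛ hP).symm
      · exact (may_eq_one (par_single_mem_can w P)).ge
    · rintro (⟨P, hP⟩ | ⟨P, hP⟩) ρ h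
      · change Step (.par P K) .tau ρ at h
        cases h with
        | @parL _ _ _ ρ h =>
          obtain ⟨σ, rfl⟩ := FinDist.exists_map_subtype (h.ok hP).2
          refine ⟨σ.map Sum.inl, FinDist.ext_ev fun f => by simp, ?_⟩
          simpa using h.le_ev_fair (φ := can Λ')
        | parR h =>
          obtain ⟨l, hl, h', -⟩ := (hK _ _).1 h
          exact absurd h' (by simp)
        | @comm _ _ l ρ₁ ρ₂ h₁ h₂ =>
          obtain ⟨l', hl, h', rfl⟩ := (hK _ _).1 h₂
          obtain ⟨σ, rfl⟩ := FinDist.exists_map_subtype (h₁.ok hP).2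
          refine ⟨σ.map Sum.inr, FinDist.ext_ev fun f => by simp, ?_⟩
          simpa using (fair_le_may P).trans (may_le_one P)
      · change Step (.par P (single w)) .tau ρ at h
        generalize hβ : Act.tau = β at h
        cases h with
        | @parL _ _ _ ρ h =>
          obtain ⟨σ, rfl⟩ := FinDist.exists_map_subtype (h.ok hP).2
          exact ⟨σ.map Sum.inr, FinDist.ext_ev fun f => by simp, by simp⟩
        | parR h =>
          cases h
          exact absurd hβ (by simp)
        -- This is the only way to consume the signal, and it would need an action on `w` by a fresh
        -- process.
        | @comm _ _ l ρ₁ ρ₂ h₁ h₂ =>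
          generalize hl : l.compl = l' at h₂
          cases h₂
          refine absurd h₁ (Fresh.not_step hP ?_)
          rw [← label_chan_compl, hl]
          rfl

theorem val_par_copier (m : Mode) (hK : IsCopier Λ w K) (hw : .pos w ∉ Λ)
    (hΛ : ∀ l, l ∈ Λ' ↔ l.compl ∈ Λ) {P : Proc C} (hP : P.Fresh w) :
    m.val (can {.pos w}) (.par P K) = m.val (can Λ') P := by
  cases m
  · exact may_par_copier hK hw hΛ hP
  · exact fair_par_copier hK hw hΛ hP

/-- Enlarging the set of observed actions by actions that do not occur. -/
theorem can_congr_of_ok (m : Mode) {A : Set (Act C)} {M : Set (Finset C)} {b : Prop}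
    (h : ∀ l, .ext l ∈ A → (l ∈ Λ ↔ l ∈ Λ')) {P : Proc C} (hP : P.Ok A M b) :
    m.val (can Λ) P = m.val (can Λ') P := by
  have : TauSpan (can Λ) (can Λ') (fun x : {P : Proc C // P.Ok A M b} => x.1) (fun x => x.1) := by
    refine ⟨?_, ?_, ?_⟩
    · rintro ⟨P, hP⟩
      exact ⟨fun ⟨l, hl, ρ, hs⟩ => ⟨l, (h l (hs.label_mem hP)).1 hl, ρ, hs⟩,
        fun ⟨l, hl, ρ, hs⟩ => ⟨l, (h l (hs.label_mem hP)).2 hl, ρ, hs⟩⟩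
    all_goals
      rintro ⟨P, hP⟩ ρ hs
      obtain ⟨σ, rfl⟩ := FinDist.exists_map_subtype (hs.ok hP).2
      exact ⟨σ, rfl, hs⟩
  exact this.val_eq m ⟨P, hP⟩

end Spans
/-! ### Observers over the original set of channels -/

section Observers

variable {C : Type u}

namespace Term

variable {C' : Type v}

theorem act_map_congr {f f' : C → C'} {B : Set C} (h : ∀ c ∈ B, f c = f' c) {α : Act C}
    (hα : α.channels ⊆ B) : α.map f = α.map f' := by
  rcases α with (a | a) | _
  · simp [Act.map, h a (hα rfl)]
  · simp [Act.map, h a (hα rfl)]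
  · rfl

/-- The embeddings act only on localized channels, so they may differ at `w`, which is never
localized. The functions need only agree on a set containing all channels of actions. -/
theorem rename_congr {e e' : C ↪ C'} {w : C} {B : Set C} (he : ∀ c, c ≠ w → e c = e' c) {n : ℕ}
    {T : Term C n} {f f' : C → C'} (hf : ∀ c ∈ B, f c = f' c)
    (hT : T.Ok {α | α.channels ⊆ B} {L | w ∉ L} False) : T.rename e f = T.rename e' f' := by
  induction T generalizing f f' with
  | nil | var => rfl
  | sum m α T ih =>
    simp only [rename, Term.sum.injEq, heq_eq_eq, true_and]
    exact ⟨funext fun i => act_map_congr hf (hT i).1, funext fun i => ih i hf (hT i).2⟩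
  | psum m p hp hs T ih =>
    simp only [rename, Term.psum.injEq, heq_eq_eq, true_and]
    exact funext fun i => ih i hf (hT.2 i)
  | par S T ihS ihT => simp only [rename, ihS hf hT.1, ihT hf hT.2]
  | res L T ih =>
    have hL : ∀ c ∈ L, e c = e' c := fun c hc => he c fun h => hT.1 (h ▸ hc)
    simp only [rename, Term.res.injEq]
    refine ⟨?_, ih (fun c hc => ?_) hT.2⟩
    · ext d
      simp only [Finset.mem_map]
      exact exists_congr fun c => and_congr_right fun hc => by rw [hL c hc]
    · split_ifs with h
      · exact hL c h
      · exact hf c hc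
  | fix T ih => simp only [rename, ih hf hT]

theorem emb_rename {C'' : Type*} (e : C' ↪ C'') (e₁ : C ↪ C') {n : ℕ} (T : Term C n)
    (g : C → C') : emb e (T.rename e₁ g) = T.rename (e₁.trans e) fun c => e (g c) := by
  induction T generalizing g with
  | nil | var => rfl
  | sum m α T ih =>
    simp only [rename, ih, Term.sum.injEq, heq_eq_eq, true_and, and_true]
    funext i
    rcases α i with (a | a) | _ <;> rfl
  | psum m p hp hs T ih => simp only [rename, ih]
  | par S T ihS ihT => simp only [rename, ihS, ihT]
  | res L T ih =>
    rw [rename, emb_res, ih, rename, Finset.map_map]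
    congr 2
    funext c
    split_ifs <;> rfl
  | fix T ih => simp only [rename, ih]

/-- The only new name introduced is `w`, which no localization of the term binds. This licenses the
closure of testing contexts under renaming. -/
theorem captureFree_of_fresh {w : C} {n : ℕ} {T : Term C n} (hT : T.Fresh w) {f : C → C}
    (hf : ∀ c, f c = c ∨ f c = w) : T.CaptureFree f := by
  induction T generalizing f with
  | nil | var => trivial
  | sum m α T ih => exact fun i => ih i (hT i).2 hf
  | psum m p hp hs T ih => exact fun i => ih i (hT.2 i) hf
  | par S T ihS ihT => exact ⟨ihS hT.1 hf, ihT hT.2 hf⟩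
  | res L T ih =>
    refine ⟨fun c _ hc => ?_, ih hT.2 fun c => ?_⟩
    · rcases hf c with h | h
      · rwa [h]
      · rw [h]; exact hT.1
    · split_ifs
      · exact .inl rfl
      · exact hf c
  | fix T ih => exact ih hT hf

end Term

open Classical in
/-- The embedding of channels that identifies `w` with `ω`. -/
noncomputable def omegaEmb (w : C) : C ↪ Option C :=
  -- Following the inclusion by the transposition of `ω` and `w` makes injectivity automatic.
  Function.Embedding.some.trans (Equiv.swap none (some w)).toEmbedding

open Classical in
theorem omegaEmb_apply (w c : C) : omegaEmb w c = if c = w then none else some c := by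
  simp only [omegaEmb, Function.Embedding.trans_apply, Function.Embedding.some_apply,
    Equiv.coe_toEmbedding]
  split_ifs with h
  · rw [h, Equiv.swap_apply_right]
  · rw [Equiv.swap_apply_of_ne_of_ne (by simp) (by simpa using h)]

theorem omegaEmb_of_ne {w c : C} (h : c ≠ w) : omegaEmb w c = some c := by
  rw [omegaEmb_apply, if_neg h]

theorem isOmega_emb_iff {w : C} {n : ℕ} {T : Term C n} :
    (emb (omegaEmb w) T).IsOmega ↔ T.Positive w := by
  induction T with
  | nil | var => exact Iff.rfl
  | sum m α T ih =>
    simp only [rename, IsOmega, ih, Ok]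
    refine forall_congr' fun i => and_congr_left fun _ => not_congr ?_
    rcases α i with (a | a) | _
    · simp [Act.map]
    · by_cases h : a = w <;> simp [Act.map, omegaEmb_apply, h]
    · simp [Act.map]
  | psum m p hp hs T ih => simp [rename, IsOmega, ih, Ok]
  | par S T ihS ihT => simp [rename, IsOmega, ihS, ihT, Ok]
  | res L T ih =>
    simp only [emb_res, IsOmega, ih, Ok]
    refine and_congr_left fun _ => not_congr ?_
    constructor
    · intro h
      obtain ⟨c, hc, h⟩ := Finset.mem_map.1 h
      by_cases hcw : c = w
      · exact hcw ▸ hc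
      · rw [omegaEmb_of_ne hcw] at h
        simp at h
    · intro h
      exact Finset.mem_map.2 ⟨w, h, by simp [omegaEmb_apply]⟩
  | fix T ih => simp [rename, IsOmega, ih, Ok]

theorem withOmega_eq {μ : FinDist (Proc C)} {w : C} (h : μ.All (Fresh w)) :
    withOmega μ = μ.map (emb (omegaEmb w)) := by
  refine FinDist.ext_ev fun f => ?_
  simp only [withOmega, FinDist.ev_map]
  refine FinDist.ev_congr fun P hP => ?_
  congr 1
  refine rename_congr (w := w) (B := {w}ᶜ) (fun c hc => (omegaEmb_of_ne hc).symm)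
    (fun c hc => (omegaEmb_of_ne hc).symm) ((h P hP).mono ?_ subset_rfl id)
  rintro α hα c hc rfl
  exact hα hc

theorem toOmega_eq {o : FinDist (Proc C)} {w : C}
    (h : o.All (Ok Set.univ {L | w ∉ L} False)) : toOmega w o = o.map (emb (omegaEmb w)) := by
  refine FinDist.ext_ev fun f => ?_
  simp only [toOmega, FinDist.ev_map]
  refine FinDist.ev_congr fun P hP => ?_
  congr 1
  refine rename_congr (w := w) (B := Set.univ) (fun c hc => (omegaEmb_of_ne hc).symm)
    (fun c _ => (omegaEmb_apply w c).symm) ((h P hP).mono ?_ subset_rfl id)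
  exact fun α _ => Set.subset_univ _

-- Renaming `a` to `ω` factors through renaming `a` to the fresh channel `w` inside the original
-- calculus. Localized occurrences of `a` stay put under both routes.
open Classical in
theorem toOmega_eq_rename {o : FinDist (Proc C)} {w : C} (h : o.All (Fresh w)) (a : C) :
    toOmega a o =
      (o.rename fun c => if c = a then w else c).map (emb (omegaEmb w)) := by
  refine FinDist.ext_ev fun f => ?_
  simp only [toOmega, FinDist.rename, FinDist.ev_map]
  refine FinDist.ev_congr fun P hP => ?_
  rw [emb_rename]
  congr 1
  refine rename_congr (w := w) (B := {w}ᶜ) (fun c hc => (omegaEmb_of_ne hc).symm)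
    (fun c hc => ?_) ((h P hP).mono ?_ subset_rfl id)
  · split_ifs with hca
    · simp [omegaEmb_apply]
    · exact (omegaEmb_of_ne hc).symm
  · rintro α hα c hc rfl
    exact hα hc

theorem chi_emb_par (m : Mode) (w : C) (μ ν : FinDist (Proc C)) :
    m.chi (psiOmega C) (FinDist.par (μ.map (emb (omegaEmb w))) (ν.map (emb (omegaEmb w)))) =
      m.chi (can {.pos w}) (μ.par ν) := by
  rw [psiOmega_eq_can, ← chi_map_emb m (omegaEmb w) (.pos w)]
  congr 1
  · simp [Label.map, omegaEmb_apply]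
  · exact FinDist.ext_ev fun f => by simp [rename]

/-! ### Testing equivalence expressed through a fresh channel -/

/-- The may or the fair testing equivalence. -/
def TestEq (m : Mode) (D : Set (FinDist (Proc C))) : DistRel C := fun μ₁ μ₂ =>
  ∀ o ∈ observers D,
    m.chi (psiOmega C) ((withOmega μ₁).par o) = m.chi (psiOmega C) ((withOmega μ₂).par o)

theorem testEq_may (D : Set (FinDist (Proc C))) : TestEq .may D = May D := by
  funext μ₁ μ₂
  exact propext (may_iff D μ₁ μ₂).symm

theorem testEq_fair (D : Set (FinDist (Proc C))) : TestEq .fair D = Fair D := by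
  funext μ₁ μ₂
  exact propext (fair_iff D μ₁ μ₂).symm

variable {m : Mode} {D : Set (FinDist (Proc C))} {μ₁ μ₂ : FinDist (Proc C)}

/-- Testing equivalent distributions cannot be distinguished by observing a fresh channel. -/
theorem TestEq.chi_eq (h : TestEq m D μ₁ μ₂) {w : C} (h₁ : μ₁.All (Fresh w))
    (h₂ : μ₂.All (Fresh w)) {o : FinDist (Proc C)} (ho : o ∈ D) (hw : o.All (Positive w)) :
    m.chi (can {.pos w}) (μ₁.par o) = m.chi (can {.pos w}) (μ₂.par o) := by
  by_cases hmem : w ∈ FinDist.channels o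
  · have heq : toOmega w o = o.map (emb (omegaEmb w)) :=
      toOmega_eq (hw.mono fun P hP => hP.mono (Set.subset_univ _) subset_rfl id)
    have := h (toOmega w o) ⟨?_, o, ho, w, hmem, rfl⟩
    · rwa [heq, withOmega_eq h₁, withOmega_eq h₂, chi_emb_par, chi_emb_par] at this
    · rw [heq]
      exact FinDist.all_map.2 (hw.mono fun P hP => isOmega_emb_iff.2 hP)
  -- If `w` does not occur in `o`, it induces no observer; but then nobody can signal `w`, and both
  -- characteristics vanish.
  · have hfo := FinDist.all_fresh hmem
    have key : ∀ μ : FinDist (Proc C), μ.All (Fresh w) →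
        m.chi (can {.pos w}) (μ.par o) = 0 := by
      intro μ hμ
      rw [m.chi_par]
      refine (FinDist.ev_congr fun P hP => ?_).trans (FinDist.ev_const μ 0)
      refine (FinDist.ev_congr fun Q hQ => ?_).trans (FinDist.ev_const o 0)
      refine val_eq_zero m (A := {α | w ∉ α.channels}) ?_
        (show (Term.par P Q).Fresh w from ⟨hμ P hP, hfo Q hQ⟩)
      rintro _ rfl h
      exact h rfl
    rw [key _ h₁, key _ h₂]

theorem TestEq.equivalence (m : Mode) (D : Set (FinDist (Proc C))) : Equivalence (TestEq m D) :=
  ⟨fun _ _ _ => rfl, fun h o ho => (h o ho).symm, fun h h' o ho => (h o ho).trans (h' o ho)⟩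

/-- The characteristic of a composition with a fixed observer is affine in the tested distribution.
-/
theorem TestEq.convexClosed (m : Mode) (D : Set (FinDist (Proc C))) :
    ConvexClosed (TestEq m D) := by
  intro k p hp hsum μ ν h o ho
  simp only [m.chi_par, withOmega, FinDist.ev_map, FinDist.ev_convexComb]
  refine Finset.sum_congr rfl fun i _ => ?_
  have := h i o ho
  simp only [m.chi_par, withOmega, FinDist.ev_map] at this
  rw [this]

variable [Infinite C]

theorem exists_notMem_finite {F : Set C} (hF : F.Finite) : ∃ w, w ∉ F :=
  hF.infinite_compl.nonempty

/-- Testing equivalence can be checked by observing almost all fresh channels. -/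
theorem IsTestingContext.testEq (hD : IsTestingContext D) {F : Set C} (hF : F.Finite)
    (h : ∀ w ∉ F, ∀ o ∈ D, o.All (Positive w) →
      m.chi (can {.pos w}) (μ₁.par o) = m.chi (can {.pos w}) (μ₂.par o)) :
    TestEq m D μ₁ μ₂ := by
  classical
  rintro o' ⟨hΩ, o, ho, a, -, rfl⟩
  -- With `w` fresh for everything involved, the given observer is the image of the renaming of `a`
  -- to `w` in `o`. That renaming moves a single channel, so its result is again in `D`.
  obtain ⟨w, hw⟩ := exists_notMem_finite (((hF.union (FinDist.finite_channels μ₁)).union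
    (FinDist.finite_channels μ₂)).union (FinDist.finite_channels o))
  simp only [Set.mem_union, not_or] at hw
  have hwo := FinDist.all_fresh hw.2
  rw [toOmega_eq_rename hwo] at hΩ ⊢
  rw [withOmega_eq (FinDist.all_fresh hw.1.1.2), withOmega_eq (FinDist.all_fresh hw.1.2),
    chi_emb_par, chi_emb_par]
  refine h w hw.1.1.1 _ (hD.rename o ho _ ?_ ?_) fun P hP => isOmega_emb_iff.1 ?_
  · refine (Set.finite_singleton a).subset fun c hc => ?_
    by_contra hca
    exact hc (if_neg hca)
  · intro P hP
    refine captureFree_of_fresh (hwo P hP) fun c => ?_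
    split_ifs <;> simp
  · exact (FinDist.all_map.1 (show FinDist.All Term.IsOmega _ from hΩ)) P hP

/-! ### Preservation properties -/

/-- By associativity `ν` joins the observer, and `D` is closed under composition. Choosing `w` fresh
for `ν` keeps the new observer positive. -/
theorem IsTestingContext.compositional (hD : IsTestingContext D) (m : Mode) :
    Compositional D (TestEq m D) := by
  intro μ₁ μ₂ h ν hν
  refine hD.testEq (((FinDist.finite_channels μ₁).union (FinDist.finite_channels μ₂)).union
    (FinDist.finite_channels ν)) fun w hw o ho hwo => ?_
  simp only [Set.mem_union, not_or] at hw
  rw [chi_par_assoc, chi_par_assoc]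
  exact h.chi_eq (FinDist.all_fresh hw.1.1) (FinDist.all_fresh hw.1.2) (hD.par ν hν o ho)
    (((FinDist.all_fresh hw.2).mono fun P hP => hP.positive).map₂ hwo fun _ _ h h' => ⟨h, h'⟩)

/-- For `w` outside `L`, localizing the tested process or the observer gives the same internal
behaviour, and `D` is closed under localization. -/
theorem IsTestingContext.localizable (hD : IsTestingContext D) (m : Mode) :
    Localizable (TestEq m D) := by
  intro μ₁ μ₂ h L
  refine hD.testEq (((FinDist.finite_channels μ₁).union (FinDist.finite_channels μ₂)).union
    (Finset.finite_toSet L)) fun w hw o ho hwo => ?_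
  simp only [Set.mem_union, not_or] at hw
  have hwL : w ∉ L := hw.2
  rw [chi_res_par m hwL, chi_res_par m hwL]
  exact h.chi_eq (FinDist.all_fresh hw.1.1) (FinDist.all_fresh hw.1.2) (hD.res o ho L)
    (FinDist.all_map.2 (hwo.mono fun P hP => ⟨hwL, hP⟩))

theorem IsTestingContext.isPreserved (hD : IsTestingContext D) (m : Mode) :
    IsPreserved D (TestEq m D) :=
  ⟨TestEq.equivalence m D, hD.compositional m, hD.localizable m, TestEq.convexClosed m D⟩

/-- Testing equivalent distributions have the same characteristic for external actions. -/
theorem IsTestingContext.chi_psiExt_eq (hD : IsTestingContext D) (h : TestEq m D μ₁ μ₂) :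
    m.chi (psiExt C) μ₁ = m.chi (psiExt C) μ₂ := by
  have hF := (FinDist.finite_channels μ₁).union (FinDist.finite_channels μ₂)
  obtain ⟨g, hg⟩ := exists_notMem_finite hF
  -- The extra channel `g` guarantees a nonempty set of labels for the copier, even when no channel
  -- occurs in the two distributions.
  set F := insert g (FinDist.channels μ₁ ∪ FinDist.channels μ₂) with hFdef
  have hF' : F.Finite := hF.insert g
  obtain ⟨w, hw⟩ := exists_notMem_finite hF'
  -- All labels over `F`: closed under complement and containing every external action of the two
  -- distributions, so the copier reports any of them.
  set Λ : Set (Label C) := {l | l.chan ∈ F}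
  have hΛ : Λ.Finite := by
    refine ((hF'.image Label.pos).union (hF'.image Label.neg)).subset ?_
    rintro (a | a) ha
    · exact .inl ⟨a, ha, rfl⟩
    · exact .inr ⟨a, ha, rfl⟩
  obtain ⟨K, hK, hccs, hpos⟩ := exists_isCopier hΛ (w := w) ⟨.pos g, Set.mem_insert _ _⟩ hw
  rw [hFdef, Set.mem_insert_iff, Set.mem_union, not_or, not_or] at hw
  have h₁ := FinDist.all_fresh hw.2.1
  have h₂ := FinDist.all_fresh hw.2.2
  have key : ∀ μ : FinDist (Proc C), FinDist.channels μ ⊆ F → μ.All (Fresh w) →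
      m.chi (can {.pos w}) (μ.par (dirac K)) = m.chi (psiExt C) μ := by
    intro μ hμ hwμ
    rw [m.chi_par, psiExt_eq_can, m.chi_eq_ev]
    refine FinDist.ev_congr fun P hP => ?_
    rw [FinDist.ev_dirac, val_par_copier m hK (Λ' := Λ) _ _ (hwμ P hP)]
    · refine can_congr_of_ok m (fun l hl => ?_) (ok_channels P (S := F) fun c hc =>
        hμ (Set.mem_biUnion (x := P) hP hc))
      exact iff_of_true (hl rfl) trivial
    · intro hwΛ
      have : w ∈ F := hwΛ
      rw [hFdef, Set.mem_insert_iff, Set.mem_union] at this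
      tauto
    · intro l
      change l.chan ∈ F ↔ l.compl.chan ∈ F
      rw [label_chan_compl]
  rw [← key μ₁ (fun c hc => Set.mem_insert_of_mem _ (.inl hc)) h₁,
    ← key μ₂ (fun c hc => Set.mem_insert_of_mem _ (.inr hc)) h₂]
  exact h.chi_eq h₁ h₂ (hD.diracCCS_subset ⟨K, hccs, rfl⟩) (FinDist.all_dirac.2 hpos)

/-- The largest extensional relation respecting the characteristic for external actions is the
corresponding testing equivalence. -/
theorem IsTestingContext.exists_extensional_iff (hD : IsTestingContext D) :
    (∃ R : DistRel C, (∀ μ₁ μ₂, R μ₁ μ₂ → m.chi (psiExt C) μ₁ = m.chi (psiExt C) μ₂) ∧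
      Extensional D R ∧ R μ₁ μ₂) ↔ TestEq m D μ₁ μ₂ := by
  constructor
  · rintro ⟨R, hR, ⟨hc, hl⟩, h⟩
    refine hD.testEq ((FinDist.finite_channels μ₁).union (FinDist.finite_channels μ₂))
      fun w hw o ho hwo => ?_
    rw [Set.mem_union, not_or] at hw
    -- All channels in play except `w`. Once they are localized, a visible action of the composition
    -- can only be `w`, and the hypothesis on `R` applies.
    have hfin : (((FinDist.channels μ₁ ∪ FinDist.channels μ₂) ∪
        FinDist.channels o) \ {w}).Finite :=
      (((FinDist.finite_channels μ₁).union (FinDist.finite_channels μ₂)).union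
        (FinDist.finite_channels o)).sdiff
    have hwL : w ∉ hfin.toFinset := by simp
    have key : ∀ μ : FinDist (Proc C),
        FinDist.channels μ ⊆ FinDist.channels μ₁ ∪ FinDist.channels μ₂ → μ.All (Fresh w) →
        (μ.par o).All (Ok {α | ∀ l, α = .ext l → l.chan ∈ hfin.toFinset ∨ l = .pos w}
          Set.univ False) := by
      intro μ hμ hwμ
      refine FinDist.All.map₂ (p := Ok {α | ∀ l, α = .ext l → l.chan ∈ hfin.toFinset ∨ l = .pos w}
        Set.univ False) (q := Ok {α | ∀ l, α = .ext l → l.chan ∈ hfin.toFinset ∨ l = .pos w}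
        Set.univ False) ?_ ?_ fun _ _ h h' => ⟨h, h'⟩
      · intro P hP
        refine ((hwμ P hP).inter (ok_channels P subset_rfl)).mono ?_ (Set.subset_univ _) False.elim
        rintro _ ⟨hα, hα'⟩ l rfl
        left
        rw [Set.Finite.mem_toFinset]
        exact ⟨.inl (hμ (Set.mem_biUnion (x := P) hP (hα' rfl))), fun h => hα h.symm⟩
      · intro Q hQ
        refine ((hwo Q hQ).inter (ok_channels Q subset_rfl)).mono ?_ (Set.subset_univ _) False.elim
        rintro _ ⟨hα, hα'⟩ l rfl
        by_cases hl : l.chan = w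
        · right
          rcases l with a | a
          · exact congrArg _ hl
          · exact absurd (congrArg (fun a => Act.ext (Label.neg a)) hl) hα
        · left
          rw [Set.Finite.mem_toFinset]
          exact ⟨.inr (Set.mem_biUnion (x := Q) hQ (hα' rfl)), hl⟩
    rw [chi_res m hwL (key μ₁ Set.subset_union_left (FinDist.all_fresh hw.1)),
      chi_res m hwL (key μ₂ Set.subset_union_right (FinDist.all_fresh hw.2)), ← psiExt_eq_can]
    exact hR _ _ (hl _ _ (hc _ _ h o ho) _)
  · exact fun h => ⟨TestEq m D, fun _ _ h => hD.chi_psiExt_eq h,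
      ⟨hD.compositional m, hD.localizable m⟩, h⟩

theorem IsTestingContext.diamond_eq (hD : IsTestingContext D) : Diamond D = May D := by
  rw [← testEq_may]
  funext μ₁ μ₂
  exact propext (hD.exists_extensional_iff (m := .may))

theorem IsTestingContext.box_eq (hD : IsTestingContext D) : Box D = Fair D := by
  rw [← testEq_fair]
  funext μ₁ μ₂
  exact propext (hD.exists_extensional_iff (m := .fair))

end Observers
/-! ### Contexts of processes -/

section TestingProcesses

variable {C : Type u}

/-- `D` is a testing context of distributions over the processes of a class, containing all Dirac
distributions at processes of this class. -/
structure IsClassContext (D : Set (FinDist (Proc C))) (b : Prop) : Prop where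
  testing : IsTestingContext D
  all : ∀ μ ∈ D, μ.All (Cls b)
  dirac_mem : ∀ P : Proc C, P.Cls b → dirac P ∈ D

theorem isClassContext_univ : IsClassContext (Set.univ : Set (FinDist (Proc C))) False :=
  ⟨⟨Set.subset_univ _, fun _ _ _ _ => trivial, fun _ _ _ => trivial, fun _ _ _ _ _ => trivial⟩,
    fun _ _ P _ => cls_of_not P id, fun _ _ => trivial⟩

theorem Term.IsCCS.rename {C' : Type v} (e : C ↪ C') {n : ℕ} {T : Term C n} (h : T.IsCCS)
    (f : C → C') : (T.rename e f).IsCCS := by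
  induction T generalizing f with
  | nil | var => trivial
  | sum m α T ih => exact fun i => ih i (h i) f
  | psum m p hp hs T ih => exact h
  | par S T ihS ihT => exact ⟨ihS h.1 f, ihT h.2 f⟩
  | res L T ih => exact ih h _
  | fix T ih => exact ih h f

theorem isClassContext_diracCCS : IsClassContext (diracCCS C) True where
  testing := by
    refine ⟨subset_rfl, ?_, ?_, ?_⟩
    · rintro _ ⟨P, hP, rfl⟩ _ ⟨Q, hQ, rfl⟩
      exact ⟨.par P Q, ⟨hP, hQ⟩, FinDist.ext_ev fun f => by simp⟩
    · rintro _ ⟨P, hP, rfl⟩ L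
      exact ⟨.res L P, hP, FinDist.ext_ev fun f => by simp⟩
    · rintro _ ⟨P, hP, rfl⟩ f - -
      exact ⟨_, hP.rename (Function.Embedding.refl C) f,
        FinDist.ext_ev fun g => by simp [FinDist.rename]⟩
  all := by
    rintro _ ⟨P, hP, rfl⟩
    exact FinDist.all_dirac.2 (isCCS_iff_ok.1 hP)
  dirac_mem P hP := ⟨P, isCCS_iff_ok.2 hP, rfl⟩

/-- Observers of the class that use the channel `w` only to report success. -/
abbrev Observer (b : Prop) (w : C) (O : Proc C) : Prop :=
  O.Ok {α | α ≠ .ext (.neg w)} {L | w ∉ L} b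

/-- The characteristic of a process in presence of an observer. -/
noncomputable abbrev tval (m : Mode) (w : C) (O P : Proc C) : ℝ :=
  m.val (can {.pos w}) (.par P O)

/-! ### Matching transitions -/

/-- Every transition of `P` is matched by a transition of `Q` with the same observations of the
residuals. -/
def Matches (m : Mode) (b : Prop) (w : C) (P Q : Proc C) : Prop :=
  ∀ β ρ, Step P β ρ → ∃ ρ', Step Q β ρ' ∧
    ∀ O, Observer b w O → ρ.ev (tval m w O) = ρ'.ev (tval m w O)

/-- While `P` is idle only the observer moves, and the bound is the value of `Q` with the current
observer. When `P` makes its first transition, `Q` matches it with the same expected value; from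
then on the actual may value is used as bound. -/
theorem Matches.may_le {b : Prop} {w : C} {P Q : Proc C} (h : Matches .may b w P Q) {O : Proc C}
    (hO : Observer b w O) : tval .may w O P ≤ tval .may w O Q := by
  have key := may_le_of_cover (φ := can {.pos w})
    (Sum.elim (fun x : {O : Proc C // Observer b w O} => .par P x.1) (fun P : Proc C => P))
    (Sum.elim (fun x => may (can {.pos w}) (.par Q x.1)) fun P => may (can {.pos w}) P) ?_ ?_ ?_
  · exact key (Sum.inl ⟨O, hO⟩)
  · rintro (x | x)
    · exact may_nonneg _
    · exact may_nonneg _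
  · rintro (⟨O, hO⟩ | P')
    · intro hc
      obtain ⟨ρ, hs⟩ := mem_can_singleton.1 hc
      refine (may_eq_one (mem_can_singleton.2 ?_)).ge
      cases hs with
      | parL hs =>
        obtain ⟨ρ', hs', -⟩ := h _ _ hs
        exact ⟨_, hs'.parL⟩
      | parR hs => exact ⟨_, hs.parR⟩
    · exact fun hP => (may_eq_one hP).ge
  · rintro (⟨O, hO⟩ | P') ρ hs
    · change Step (.par P O) .tau ρ at hs
      cases hs with
      | @parL _ _ _ ρ hs =>
        obtain ⟨ρ', hs', he⟩ := h _ _ hs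
        refine ⟨(ρ.par (dirac O)).map Sum.inr, FinDist.ext_ev fun f => by simp, ?_⟩
        have := (hs'.parL (T := O)).ev_may_le (φ := can {.pos w})
        simp only [FinDist.ev_map, FinDist.ev_par, FinDist.ev_dirac, Sum.elim_inr,
          Sum.elim_inl] at this ⊢
        exact (he O hO).trans_le this
      | @parR _ _ _ ρ hs =>
        obtain ⟨σ, rfl⟩ := FinDist.exists_map_subtype (hs.ok hO).2
        refine ⟨σ.map Sum.inl, FinDist.ext_ev fun f => by simp, ?_⟩
        simpa using (hs.parR (S := Q)).ev_may_le (φ := can {.pos w})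
      | @comm _ _ l ρ₁ ρ₂ h₁ h₂ =>
        obtain ⟨ρ', hs', he⟩ := h _ _ h₁
        refine ⟨(ρ₁.par ρ₂).map Sum.inr, FinDist.ext_ev fun f => by simp, ?_⟩
        have := (hs'.comm h₂).ev_may_le (φ := can {.pos w})
        simp only [FinDist.ev_map, FinDist.ev_par, Sum.elim_inr, Sum.elim_inl] at this ⊢
        -- Matching equates averages over the residual of `P` for a fixed observer, so the average
        -- over the observer's residual must be taken last.
        rw [FinDist.ev_comm] at this ⊢
        refine le_trans (le_of_eq ?_) this
        exact FinDist.ev_congr fun O' hO' => he O' ((h₂.ok hO).2 O' hO')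
    · exact ⟨ρ.map Sum.inr, FinDist.ext_ev fun f => by simp, by
        simpa using Step.ev_may_le (φ := can {.pos w}) hs⟩

/-- The inequality is reversed compared with may: matched moves of `P` bound the fair value of `P`
from below. The equality of may values supplies the condition that a lower bound for fair lie below
may. -/
theorem Matches.fair_le {b : Prop} {w : C} {P Q : Proc C} (h : Matches .fair b w P Q)
    (hm : ∀ O, Observer b w O → tval .may w O Q = tval .may w O P) {O : Proc C}
    (hO : Observer b w O) : tval .fair w O Q ≤ tval .fair w O P := by
  have key := le_fair_of_cover (φ := can {.pos w})
    (Sum.elim (fun x : {O : Proc C // Observer b w O} => .par P x.1) (fun P : Proc C => P))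
    (Sum.elim (fun x => fair (can {.pos w}) (.par Q x.1)) fun P => fair (can {.pos w}) P) ?_ ?_
  · exact key (Sum.inl ⟨O, hO⟩)
  · rintro (⟨O, hO⟩ | P')
    · exact (fair_le_may _).trans_eq (hm O hO)
    · exact fair_le_may _
  · rintro (⟨O, hO⟩ | P') ρ hs
    · change Step (.par P O) .tau ρ at hs
      cases hs with
      | @parL _ _ _ ρ hs =>
        obtain ⟨ρ', hs', he⟩ := h _ _ hs
        refine ⟨(ρ.par (dirac O)).map Sum.inr, FinDist.ext_ev fun f => by simp, ?_⟩
        have := (hs'.parL (T := O)).le_ev_fair (φ := can {.pos w})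
        simp only [FinDist.ev_map, FinDist.ev_par, FinDist.ev_dirac, Sum.elim_inr,
          Sum.elim_inl] at this ⊢
        exact this.trans_eq (he O hO).symm
      | @parR _ _ _ ρ hs =>
        obtain ⟨σ, rfl⟩ := FinDist.exists_map_subtype (hs.ok hO).2
        refine ⟨σ.map Sum.inl, FinDist.ext_ev fun f => by simp, ?_⟩
        simpa using (hs.parR (S := Q)).le_ev_fair (φ := can {.pos w})
      | @comm _ _ l ρ₁ ρ₂ h₁ h₂ =>
        obtain ⟨ρ', hs', he⟩ := h _ _ h₁
        refine ⟨(ρ₁.par ρ₂).map Sum.inr, FinDist.ext_ev fun f => by simp, ?_⟩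
        have := (hs'.comm h₂).le_ev_fair (φ := can {.pos w})
        simp only [FinDist.ev_map, FinDist.ev_par, Sum.elim_inr, Sum.elim_inl] at this ⊢
        rw [FinDist.ev_comm] at this ⊢
        refine this.trans_eq ?_
        exact FinDist.ev_congr fun O' hO' => (he O' ((h₂.ok hO).2 O' hO')).symm
    · exact ⟨ρ.map Sum.inr, FinDist.ext_ev fun f => by simp, by
        simpa using Step.le_ev_fair (φ := can {.pos w}) hs⟩

theorem tval_may_eq_of_matches {b : Prop} {w : C} {P Q : Proc C} (h : Matches .may b w P Q)
    (h' : Matches .may b w Q P) {O : Proc C} (hO : Observer b w O) :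
    tval .may w O P = tval .may w O Q :=
  le_antisymm (h.may_le hO) (h'.may_le hO)

theorem tval_fair_eq_of_matches {b : Prop} {w : C} {P Q : Proc C} (h : Matches .fair b w P Q)
    (h' : Matches .fair b w Q P) (hm : ∀ O, Observer b w O → tval .may w O P = tval .may w O Q)
    {O : Proc C} (hO : Observer b w O) : tval .fair w O P = tval .fair w O Q :=
  le_antisymm (h'.fair_le hm hO) (h.fair_le (fun O hO => (hm O hO).symm) hO)

theorem matches_sum {m : Mode} {b : Prop} {w : C} {k : ℕ} (α : Fin (k + 1) → Act C)
    {S T : Fin (k + 1) → Proc C}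
    (h : ∀ i O, Observer b w O → tval m w O (S i) = tval m w O (T i)) :
    Matches m b w (.sum k α S) (.sum k α T) := by
  intro β ρ hs
  cases hs with
  | sum _ _ _ i => exact ⟨_, Step.sum k α T i, fun O hO => by simpa using h i O hO⟩

theorem matches_psum {m : Mode} {b : Prop} {w : C} {k : ℕ} (p : Fin (k + 1) → ℝ)
    (hp : ∀ i, 0 < p i ∧ p i < 1) (hsum : ∑ i, p i = 1) {S T : Fin (k + 1) → Proc C}
    (h : ∀ i O, Observer b w O → tval m w O (S i) = tval m w O (T i)) :
    Matches m b w (.psum k p hp hsum S) (.psum k p hp hsum T) := by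
  intro β ρ hs
  cases hs with
  | psum =>
    refine ⟨_, Step.psum k p hp hsum T, fun O hO => ?_⟩
    rw [FinDist.ev_convexComb, FinDist.ev_convexComb]
    exact Finset.sum_congr rfl fun i _ => by
      simp only [FinDist.ev_dirac, h i O hO]

theorem step_fix_iff {T : Term C 1} {β : Act C} {ρ : FinDist (Proc C)} :
    Step (.fix T) β ρ ↔ Step (T.subst fun _ => .fix T) β ρ :=
  ⟨fun h => by cases h with | fix h => exact h, Step.fix⟩

/-- A recursion and its unfolding have the same transitions with identical residuals; besides this
one pair the span consists of identical pairs. -/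
theorem tval_fix (m : Mode) (w : C) (O : Proc C) (T : Term C 1) :
    tval m w O (.fix T) = tval m w O (T.subst fun _ => .fix T) := by
  have hs : StrongSpan
      (Sum.elim (fun _ : Unit => (.fix T : Proc C)) (fun P : Proc C => P))
      (Sum.elim (fun _ => T.subst fun _ => .fix T) fun P => P) := by
    constructor
    all_goals
      rintro (_ | P) β ρ h
      · exact ⟨ρ.map Sum.inr, FinDist.ext_ev fun f => by simp,
          Step.of_ev (by first | exact step_fix_iff.1 h | exact step_fix_iff.2 h)
            fun f => by simp⟩
      · exact ⟨ρ.map Sum.inr, FinDist.ext_ev fun f => by simp, Step.of_ev h fun f => by simp⟩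
  exact hs.par.val_eq m {.pos w} (Sum.inl (), O)

/-! ### Fair testing equivalence is included in may testing equivalence -/

/-- An observer that withdraws its success signal `w'` as soon as it receives `w`. -/
theorem fair_par_eq {w w' : C} {K : Proc C}
    (hK : ∀ β ρ, Step K β ρ ↔ (β = .ext (.neg w) ∨ β = .ext (.pos w')) ∧ ρ = dirac .nil)
    {P : Proc C} (hP : P.Fresh w') :
    fair (can {.pos w'}) (.par P K) = 1 - may (can {.pos w}) P := by
  have hzero : ∀ P : Proc C, P.Fresh w' → may (can {.pos w'}) (.par P .nil) = 0 := by
    refine fun P hP => may_eq_zero (A := {α | w' ∉ α.channels}) ?_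
      (show (Term.par P .nil).Fresh w' from ⟨hP, trivial⟩)
    rintro _ rfl h
    exact h rfl
  have hone : ∀ P : Proc C, may (can {.pos w'}) (.par P K) = 1 := fun P =>
    may_eq_one (mem_can_singleton.2 ⟨_, ((hK _ _).2 ⟨.inr rfl, rfl⟩).parR⟩)
  apply le_antisymm
  -- One minus the fair value bounds the may value of `P`: whenever `P` can do `w`, a communication
  -- leads to states where `w'` is lost for good, so the fair value there is 0.
  · rw [le_sub_comm]
    have key := may_le_of_cover (φ := can {.pos w}) (fun x : {P : Proc C // P.Fresh w'} => x.1)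
      (fun x => 1 - fair (can {.pos w'}) (.par x.1 K)) ?_ ?_ ?_
    · exact key ⟨P, hP⟩
    · exact fun x => sub_nonneg.2 ((fair_le_may _).trans (may_le_one _))
    · rintro ⟨P, hP⟩ hc
      obtain ⟨ρ, hs⟩ := mem_can_singleton.1 hc
      have h1 := (hs.comm ((hK (.ext (.neg w)) _).2 ⟨.inl rfl, rfl⟩)).le_ev_fair
        (φ := can {.pos w'})
      have h2 : (ρ.par (dirac .nil)).ev (fair (can {.pos w'})) ≤ 0 := by
        rw [FinDist.ev_par]
        refine FinDist.ev_le fun Q hQ => ?_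
        rw [FinDist.ev_dirac]
        exact (fair_le_may _).trans_eq (hzero Q ((hs.ok hP).2 Q hQ))
      linarith
    · rintro ⟨P, hP⟩ ρ hs
      obtain ⟨σ, rfl⟩ := FinDist.exists_map_subtype (hs.ok hP).2
      refine ⟨σ, rfl, ?_⟩
      have := (hs.parL (T := K)).le_ev_fair (φ := can {.pos w'})
      simp only [FinDist.ev_par, FinDist.ev_map, FinDist.ev_dirac] at this
      rw [FinDist.ev_const_sub]
      linarith
  -- Before the withdrawal the lower bound is one minus the may value, afterwards 0. They fit
  -- together since only a process offering `w`, hence of may value 1, can trigger the withdrawal.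
  · have key := le_fair_of_cover (φ := can {.pos w'})
      (Sum.elim (fun x : {P : Proc C // P.Fresh w'} => .par x.1 K)
        (fun x : {P : Proc C // P.Fresh w'} => .par x.1 .nil))
      (Sum.elim (fun x => 1 - may (can {.pos w}) x.1) fun _ => 0) ?_ ?_
    · exact key (Sum.inl ⟨P, hP⟩)
    · rintro (⟨P, hP⟩ | ⟨P, hP⟩)
      · exact (sub_le_self _ (may_nonneg _)).trans_eq (hone P).symm
      · exact may_nonneg _
    · rintro (⟨P, hP⟩ | ⟨P, hP⟩) ρ hs
      · change Step (.par P K) .tau ρ at hs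
        cases hs with
        | @parL _ _ _ ρ hs =>
          obtain ⟨σ, rfl⟩ := FinDist.exists_map_subtype (hs.ok hP).2
          refine ⟨σ.map Sum.inl, FinDist.ext_ev fun f => by simp, ?_⟩
          have := hs.ev_may_le (φ := can {.pos w})
          simp only [FinDist.ev_map, Sum.elim_inl, FinDist.ev_const_sub] at this ⊢
          linarith
        | parR hs =>
          obtain ⟨h | h, -⟩ := (hK _ _).1 hs <;> simp at h
        | @comm _ _ l ρ₁ ρ₂ h₁ h₂ =>
          obtain ⟨hl, rfl⟩ := (hK _ _).1 h₂
          obtain ⟨σ, rfl⟩ := FinDist.exists_map_subtype (h₁.ok hP).2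
          refine ⟨σ.map Sum.inr, FinDist.ext_ev fun f => by simp, ?_⟩
          have hPw : P ∈ can {.pos w} := by
            rcases l with a | a
            · rcases hl with hl | hl
              · obtain rfl : a = w := by simpa [Label.compl] using hl
                exact mem_can_singleton.2 ⟨_, h₁⟩
              · simp [Label.compl] at hl
            · rcases hl with hl | hl
              · simp [Label.compl] at hl
              · obtain rfl : a = w' := by simpa [Label.compl] using hl
                exact absurd h₁ (Fresh.not_step hP rfl)
          simp [may_eq_one hPw]
      · change Step (.par P .nil) .tau ρ at hs
        cases hs with
        | @parL _ _ _ ρ hs =>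
          obtain ⟨σ, rfl⟩ := FinDist.exists_map_subtype (hs.ok hP).2
          exact ⟨σ.map Sum.inr, FinDist.ext_ev fun f => by simp, by simp⟩
        | parR hs => cases hs
        | comm h₁ h₂ => generalize Act.ext _ = β at h₂; cases h₂

/-- A may test reporting on `w` is extended by a process that offers the fresh signal `w'` and drops
it on receiving `w`. The fair value for `w'` is one minus the may value for `w`. -/
theorem IsTestingContext.testEq_may_of_fair [Infinite C] {D : Set (FinDist (Proc C))}
    (hD : IsTestingContext D) {μ₁ μ₂ : FinDist (Proc C)} (h : TestEq .fair D μ₁ μ₂) :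
    TestEq .may D μ₁ μ₂ := by
  classical
  refine hD.testEq Set.finite_empty fun w _ o ho hwo => ?_
  obtain ⟨w', hw'⟩ := exists_notMem_finite ((((FinDist.finite_channels μ₁).union
    (FinDist.finite_channels μ₂)).union (FinDist.finite_channels o)).insert w)
  simp only [Set.mem_insert_iff, Set.mem_union, not_or] at hw'
  obtain ⟨hne, ⟨h₁, h₂⟩, h₃⟩ := hw'
  replace h₁ := FinDist.all_fresh h₁
  replace h₂ := FinDist.all_fresh h₂
  replace h₃ := FinDist.all_fresh h₃
  obtain ⟨K, hK, hok⟩ := exists_choice (s := {(Act.ext (.neg w), (.nil : Proc C)),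
    (Act.ext (.pos w'), .nil)}) (by simp)
  have hK' : ∀ β ρ, Step K β ρ ↔
      (β = .ext (.neg w) ∨ β = .ext (.pos w')) ∧ ρ = dirac .nil := by
    intro β ρ
    rw [hK]
    simp only [Finset.mem_insert, Finset.mem_singleton, exists_eq_or_imp, exists_eq_left]
    exact or_and_right.symm
  have hccs : K.IsCCS := isCCS_iff_ok.2 (hok _ _ _ (by simp [Ok]))
  have hpos : K.Positive w' := hok _ _ _ (by simp [Ok, Ne.symm hne])
  have key : ∀ μ : FinDist (Proc C), μ.All (Fresh w') →
      Mode.fair.chi (can {.pos w'}) (μ.par (o.par (dirac K))) =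
        1 - Mode.may.chi (can {.pos w}) (μ.par o) := by
    intro μ hμ
    rw [← chi_par_assoc, Mode.chi_par, Mode.chi_eq_ev, ← FinDist.ev_const_sub]
    refine FinDist.ev_congr fun P hP => ?_
    rw [FinDist.ev_dirac]
    exact fair_par_eq hK' (hμ.map₂ h₃ (fun _ _ h h' => ⟨h, h'⟩) P hP)
  have := h.chi_eq h₁ h₂ (hD.par o ho _ (hD.diracCCS_subset ⟨K, hccs, rfl⟩))
    ((h₃.mono fun P hP => hP.positive).map₂ (FinDist.all_dirac.2 hpos) fun _ _ h h' => ⟨h, h'⟩)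
  rw [key μ₁ h₁, key μ₂ h₂] at this
  linarith

end TestingProcesses
/-! ### Unfolding a recursion along finitely many transitions -/

section Families

variable {C : Type u}

theorem Term.Ok.of_subst {A : Set (Act C)} {M : Set (Finset C)} {b : Prop} {n k : ℕ}
    {T : Term C n} {σ : Fin n → Term C k} (h : (T.subst σ).Ok A M b) : T.Ok A M b := by
  induction T generalizing k with
  | nil | var => trivial
  | sum m α T ih => exact fun i => ⟨(h i).1, ih i (h i).2⟩
  | psum m p hp hs T ih => exact ⟨h.1, fun i => ih i (h.2 i)⟩
  | par S T ihS ihT => exact ⟨ihS h.1, ihT h.2⟩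
  | res L T ih => exact ⟨h.1, ih h.2⟩
  | fix T ih =>
    simp only [Ok] at h ⊢
    exact ih h

/-- Terms of arbitrary arity. -/
abbrev Family (C : Type u) : Type u := (k : ℕ) × Term C k

namespace Family

/-- The instance of a family by a sequence of processes. -/
def fill (φ : ℕ → Proc C) (F : Family C) : Proc C := F.2.subst fun i => φ i

/-- Parallel composition of families. -/
def par (F G : Family C) : Family C :=
  -- The variables are shared, not renamed apart: index `i` stands for the same entry of the
  -- sequence in both components.
  ⟨max F.1 G.1, .par (F.2.renVar (Fin.castLE (le_max_left _ _)))
    (G.2.renVar (Fin.castLE (le_max_right _ _)))⟩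

/-- Localization of a family. -/
def res (L : Finset C) (F : Family C) : Family C := ⟨F.1, .res L F.2⟩

@[simp] theorem fill_par (φ : ℕ → Proc C) (F G : Family C) :
    fill φ (F.par G) = .par (fill φ F) (fill φ G) := by
  simp only [fill, par, subst, subst_renVar]
  rfl

@[simp] theorem fill_res (φ : ℕ → Proc C) (L : Finset C) (F : Family C) :
    fill φ (F.res L) = .res L (fill φ F) := rfl

end Family

open Family

/-- The first `d` entries of the sequence are obtained from their successors by applying `S`. -/
def IsChain (S : Term C 1) (d : ℕ) (φ : ℕ → Proc C) : Prop :=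
  ∀ i < d, φ i = S.subst fun _ => φ (i + 1)

theorem IsChain.mono {S : Term C 1} {d d' : ℕ} {φ : ℕ → Proc C} (h : IsChain S d φ)
    (hd : d' ≤ d) : IsChain S d' φ := fun i hi => h i (hi.trans_le hd)

/-- A transition of a family filled with a recursive process unfolds the recursion only finitely
often. -/
theorem Step.exists_fill {S : Term C 1} {P : Proc C} {β : Act C} {ρ : FinDist (Proc C)}
    (h : Step P β ρ) : ∀ F : Family C, P = fill (fun _ => .fix S) F →
      ∃ (d : ℕ) (γ : FinDist (Family C)), ρ = γ.map (fill fun _ => .fix S) ∧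
        ∀ φ, IsChain S d φ → Step (fill φ F) β (γ.map (fill φ)) := by
  induction h with
  | sum m α T i =>
    rintro ⟨k, F⟩ hF
    cases F <;> simp only [fill, subst, reduceCtorEq] at hF
    rename_i T'
    injection hF with _ h1 h2 h3
    subst h1
    obtain rfl := eq_of_heq h2
    obtain rfl := eq_of_heq h3
    refine ⟨0, dirac ⟨k, T' i⟩, by rw [Convexity.StdSimplex.map_single]; rfl, fun φ _ => ?_⟩
    rw [Convexity.StdSimplex.map_single]
    exact Step.sum m α (fun i => fill φ ⟨k, T' i⟩) i
  | psum m p hp hsum T =>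
    rintro ⟨k, F⟩ hF
    cases F <;> simp only [fill, subst, reduceCtorEq] at hF
    rename_i T'
    injection hF with _ h1 h2 h3
    subst h1
    obtain rfl := eq_of_heq h2
    obtain rfl := eq_of_heq h3
    refine ⟨0, convexComb p (fun i => (hp i).1.le) hsum fun i => dirac ⟨k, T' i⟩,
      FinDist.ext_ev fun f => by simp [FinDist.ev_convexComb, fill], fun φ _ => ?_⟩
    exact (Step.psum m p hp hsum fun i => fill φ ⟨k, T' i⟩).of_ev fun f => by
      simp [FinDist.ev_convexComb]
  | parL _ ih =>
    rintro ⟨k, F⟩ hF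
    cases F <;> simp only [fill, subst, reduceCtorEq] at hF
    rename_i F₁ F₂
    injection hF with _ h1 h2
    obtain rfl : _ = fill (fun _ => .fix S) ⟨k, F₂⟩ := h2
    obtain ⟨d, γ, rfl, hγ⟩ := ih ⟨k, F₁⟩ h1
    refine ⟨d, γ.map fun G => G.par ⟨k, F₂⟩, FinDist.ext_ev fun f => by simp,
      fun φ hφ => ?_⟩
    exact ((hγ φ hφ).parL (T := fill φ ⟨k, F₂⟩)).of_ev fun f => by simp
  | parR _ ih =>
    rintro ⟨k, F⟩ hF
    cases F <;> simp only [fill, subst, reduceCtorEq] at hF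
    rename_i F₁ F₂
    injection hF with _ h1 h2
    obtain rfl : _ = fill (fun _ => .fix S) ⟨k, F₁⟩ := h1
    obtain ⟨d, γ, rfl, hγ⟩ := ih ⟨k, F₂⟩ h2
    refine ⟨d, γ.map fun G => Family.par ⟨k, F₁⟩ G, FinDist.ext_ev fun f => by simp,
      fun φ hφ => ?_⟩
    exact ((hγ φ hφ).parR (S := fill φ ⟨k, F₁⟩)).of_ev fun f => by simp
  | comm _ _ ih₁ ih₂ =>
    rintro ⟨k, F⟩ hF
    cases F <;> simp only [fill, subst, reduceCtorEq] at hF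
    rename_i F₁ F₂
    injection hF with _ h1 h2
    obtain ⟨d₁, γ₁, rfl, hγ₁⟩ := ih₁ ⟨k, F₁⟩ h1
    obtain ⟨d₂, γ₂, rfl, hγ₂⟩ := ih₂ ⟨k, F₂⟩ h2
    refine ⟨max d₁ d₂, FinDist.map₂ Family.par γ₁ γ₂, FinDist.ext_ev fun f => by simp,
      fun φ hφ => ?_⟩
    exact ((hγ₁ φ (hφ.mono (le_max_left _ _))).comm (hγ₂ φ (hφ.mono (le_max_right _ _)))).of_ev
      fun f => by simp
  | @res _ L _ _ _ hL ih =>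
    rintro ⟨k, F⟩ hF
    cases F <;> simp only [fill, subst, reduceCtorEq] at hF
    rename_i L' F
    injection hF with _ h1 h2
    subst h1
    obtain ⟨d, γ, rfl, hγ⟩ := ih ⟨k, F⟩ h2
    refine ⟨d, γ.map (Family.res L), FinDist.ext_ev fun f => by simp, fun φ hφ => ?_⟩
    exact ((hγ φ hφ).res hL).of_ev fun f => by simp
  | @fix T β ρ _ ih =>
    rintro ⟨k, F⟩ hF
    cases F <;> simp only [fill, subst, reduceCtorEq] at hF
    · rename_i i
      injection hF with _ h1
      subst h1
      -- Here the filled-in recursion itself is unfolded: entry `i` becomes the body applied to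
      -- entry `i + 1`. Arity `i + 2` makes that variable available, and the chain must reach at
      -- least depth `i + 1`.
      obtain ⟨d, γ, rfl, hγ⟩ := ih ⟨i + 2, T.subst fun _ => var ⟨i + 1, by omega⟩⟩ (by
        simp only [fill, subst_subst, subst])
      refine ⟨max d (i + 1), γ, rfl, fun φ hφ => ?_⟩
      have := hγ φ (hφ.mono (le_max_left _ _))
      simp only [fill, subst_subst, subst] at this ⊢
      rw [hφ i (by omega)]
      exact this
    · rename_i F
      injection hF with _ h1
      -- Here the recursion belongs to the family, so it is unfolded syntactically and costs no
      -- entry of the chain.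
      have key : ∀ φ : ℕ → Proc C, fill φ ⟨k, F.subst (Fin.cases (.fix F) var)⟩ =
          F.subst (Fin.cases (fill φ ⟨k, .fix F⟩) fun i => φ i) := by
        intro φ
        simp only [fill, subst_subst]
        congr 1
        funext i
        cases i using Fin.cases <;> rfl
      obtain ⟨d, γ, rfl, hγ⟩ := ih ⟨k, F.subst (Fin.cases (.fix F) var)⟩ (by
        rw [key, h1, subst_lift_subst]
        rfl)
      refine ⟨d, γ, rfl, fun φ hφ => ?_⟩
      have := hγ φ hφ
      rw [key] at this
      refine Step.fix ?_
      rw [subst_lift_subst]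
      exact this

theorem FinDist.weights_eq_ev {X : Type*} [DecidableEq X] (μ : FinDist X) (x : X) :
    μ.weights x = μ.ev fun y => if y = x then 1 else 0 := by
  rw [ev_eq_sum]
  simp +contextual

/-- Finite internal transition sequences from a family filled with a recursive process unfold the
recursion only finitely often. -/
theorem Reach.exists_fill {S : Term C 1} {μ ν : FinDist (Proc C)} (h : Reach μ ν)
    {γ : FinDist (Family C)} (hγ : μ = γ.map (fill fun _ => .fix S)) :
    ∃ (d : ℕ) (γ' : FinDist (Family C)), ν = γ'.map (fill fun _ => .fix S) ∧
      ∀ φ, IsChain S d φ → Reach (γ.map (fill φ)) (γ'.map (fill φ)) := by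
  classical
  induction h with
  | refl => exact ⟨0, γ, hγ, fun φ _ => .refl⟩
  | @tail κ ν _ hs ih =>
    obtain ⟨d, γ', rfl, hr⟩ := ih
    obtain ⟨p, hp, hp1, P, -, ρ, hst, hν⟩ := hs
    -- Several families may become the active process `P` when filled with `fix S`, though their
    -- other fillings differ. Each of them performs the step with the same relative probability `p`,
    -- the others rest.
    have h1 : ∀ F : Family C, ∃ (d : ℕ) (κ : FinDist (Family C)),
        (∀ f, κ.ev (fun G => f (fill (fun _ => .fix S) G)) =
          f (fill (fun _ => .fix S) F) +
            (if fill (fun _ => .fix S) F = P then 1 else 0) * (p * (ρ.ev f - f P))) ∧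
        ∀ φ, IsChain S d φ → Reach (dirac (fill φ F)) (κ.map (fill φ)) := by
      intro F
      by_cases hF : P = fill (fun _ => .fix S) F
      · obtain ⟨d, κ, rfl, hκ⟩ := hst.exists_fill F hF
        have hmix : ∀ g : Family C → ℝ, FinDist.ev (Convexity.convexCombPair (1 - p) p
            (sub_nonneg.2 hp1) hp.le (by ring) (dirac F) κ) g = (1 - p) * g F + p * κ.ev g := by
          intro g
          rw [FinDist.ev, Convexity.StdSimplex.weights_convexCombPair]
          simp only [Convexity.StdSimplex.weights_single, map_add, map_smul, smul_eq_mul,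
            Finsupp.linearCombination_single, one_mul, FinDist.ev]
        refine ⟨d, Convexity.convexCombPair (1 - p) p (sub_nonneg.2 hp1) hp.le (by ring)
          (dirac F) κ, fun f => ?_, fun φ hφ => .single ⟨p, hp, hp1, fill φ F, by simp, _, hκ φ hφ,
          ?_⟩⟩
        · rw [hmix, if_pos hF.symm, FinDist.ev_map, hF]
          ring
        · rw [Convexity.StdSimplex.weights_map, Convexity.StdSimplex.weights_convexCombPair,
            Finsupp.mapDomain_add, Finsupp.mapDomain_smul, Finsupp.mapDomain_smul]
          simp only [Convexity.StdSimplex.weights_single, Finsupp.mapDomain_single,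
            Finsupp.single_eq_same, Convexity.StdSimplex.weights_map]
          module
      · exact ⟨0, dirac F, fun f => by rw [if_neg (Ne.symm hF)]; simp, fun φ _ => by
          rw [Convexity.StdSimplex.map_single]; exact .refl⟩
    choose dF κ hκ hreach using h1
    -- Finite support bounds the number of unfoldings needed by all families together.
    refine ⟨max d (γ'.weights.support.sup dF), γ'.bind κ, FinDist.ext_ev fun f => ?_,
      fun φ hφ => (hr φ (hφ.mono (le_max_left _ _))).trans ?_⟩
    · rw [FinDist.ev_map, FinDist.ev_bind, FinDist.ev_congr fun F _ => hκ F f, FinDist.ev_add,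
        FinDist.ev, hν, map_add, map_smul, map_sub]
      change FinDist.ev _ _ + _ • (FinDist.ev _ _ - FinDist.ev _ _) = _
      rw [FinDist.weights_eq_ev, FinDist.ev_map, FinDist.ev_map, FinDist.ev_dirac, smul_eq_mul]
      congr 1
      simp only [FinDist.ev_eq_sum, Finset.sum_mul]
      exact Finset.sum_congr rfl fun F _ => by ring
    · have hk : ∀ F, ∃ ν, Reach (dirac (fill φ F)) ν ∧
          (F ∈ γ'.weights.support → ν = (κ F).map (fill φ)) := by
        intro F
        by_cases hF : F ∈ γ'.weights.support
        · exact ⟨_, hreach F φ (hφ.mono ((Finset.le_sup hF).trans (le_max_right _ _))),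
            fun _ => rfl⟩
        · exact ⟨_, .refl, fun h => absurd h hF⟩
      choose k hk hk' using hk
      have := reach_bind_map (μ := γ') (f := fill φ) hk
      have he : γ'.bind k = (γ'.bind κ).map (fill φ) := by
        refine FinDist.ext_ev fun f => ?_
        rw [FinDist.ev_bind, FinDist.ev_map, FinDist.ev_bind]
        exact FinDist.ev_congr fun F hF => by rw [hk' F hF, FinDist.ev_map]
      rwa [he] at this

/-! ### Approximation of a recursive process by iterates -/

/-- Iterated application of a unary term to a process. -/
def iter (S : Term C 1) (P : Proc C) : ℕ → Proc C
  | 0 => P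
  | n + 1 => S.subst fun _ => iter S P n

/-- The order is reversed: entry 0 is the `d`-fold iterate, and each further entry has one layer
less. From index `d` on truncated subtraction yields `P`, where no chain condition is imposed. -/
theorem isChain_iter (S : Term C 1) (P : Proc C) (d : ℕ) :
    IsChain S d fun i => iter S P (d - i) := by
  intro i hi
  obtain ⟨k, hk⟩ := Nat.exists_eq_add_of_lt hi
  have h1 : d - i = k + 1 := by omega
  have h2 : d - (i + 1) = k := by omega
  simp only [h1, h2, iter]

theorem dirac_par_eq_fill (O : Proc C) (φ : ℕ → Proc C) :
    (dirac (.par (φ 0) O) : FinDist (Proc C)) =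
      (dirac (Family.par ⟨1, var 0⟩ ⟨0, O⟩) : FinDist (Family C)).map (fill φ) := by
  rw [Convexity.StdSimplex.map_single, fill_par]
  simp only [fill, subst_closed]
  rfl

/-- A recursive process succeeds at most as often as its finite unfoldings. -/
theorem may_fix_le {S : Term C 1} {B O : Proc C} {Λ : Set (Label C)} {c : ℝ}
    (h : ∀ n, may (can Λ) (.par (iter S B n) O) ≤ c) : may (can Λ) (.par (.fix S) O) ≤ c := by
  classical
  refine chiMay_le fun ν hν => ?_
  obtain ⟨d, γ, rfl, hγ⟩ := Reach.exists_fill (S := S) hν (dirac_par_eq_fill O fun _ => .fix S)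
  -- Success is witnessed by a transition too, so finitely many further unfoldings reproduce it.
  have h1 : ∀ F : Family C, ∃ d, fill (fun _ => .fix S) F ∈ can Λ →
      ∀ φ, IsChain S d φ → fill φ F ∈ can Λ := by
    intro F
    by_cases hF : fill (fun _ => .fix S) F ∈ can Λ
    · obtain ⟨l, hl, ρ, hs⟩ := hF
      obtain ⟨d, κ, -, hκ⟩ := hs.exists_fill F rfl
      exact ⟨d, fun _ φ hφ => ⟨l, hl, _, hκ φ hφ⟩⟩
    · exact ⟨0, fun h => absurd h hF⟩
  choose dF hdF using h1
  set N := max d (γ.weights.support.sup dF)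
  have hc := isChain_iter S B N
  have hr := hγ _ (hc.mono (le_max_left _ _))
  rw [← dirac_par_eq_fill] at hr
  refine le_trans ?_ (hr.prob_le_chiMay.trans (h N))
  rw [FinDist.prob_eq_ev, FinDist.prob_eq_ev, FinDist.ev_map, FinDist.ev_map]
  refine FinDist.ev_mono fun F hF => ?_
  by_cases hFc : fill (fun _ => .fix S) F ∈ can Λ
  · rw [if_pos hFc, if_pos (hdF F hFc _ (hc.mono ((Finset.le_sup hF).trans (le_max_right _ _))))]
  · rw [if_neg hFc]
    split_ifs <;> simp

/-- A lower bound on the fair characteristic of a recursive process in terms of its finite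
unfoldings. -/
theorem le_fair_fix {S : Term C 1} {B O : Proc C} {Λ : Set (Label C)} {c : ℝ}
    (h : ∀ n, c ≤ fair (can Λ) (.par (iter S B n) O)) {p : Proc C → Prop}
    (hp : ∀ P ρ, p P → Step P .tau ρ → ρ.All p) (hO : p (.par (.fix S) O))
    (hm : ∀ (F : Family C) (d : ℕ), p (fill (fun _ => .fix S) F) →
      may (can Λ) (fill (fun i => iter S B (d - i)) F) ≤
        may (can Λ) (fill (fun _ => .fix S) F)) : c ≤ fair (can Λ) (.par (.fix S) O) := by
  refine le_chiFair fun ν hν => ?_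
  have hall := hν.all (FinDist.all_dirac.2 hO) hp
  obtain ⟨d, γ, rfl, hγ⟩ := Reach.exists_fill (S := S) hν (dirac_par_eq_fill O fun _ => .fix S)
  -- The run of `fix S` is copied by the `d`-fold iterate; its target bounds the fair value of that
  -- iterate, and `hm` transfers the bound to the original target.
  have hr := hγ _ (isChain_iter S B d)
  rw [← dirac_par_eq_fill] at hr
  refine ((h d).trans hr.chiFair_le).trans ?_
  rw [chiMay_eq_ev, chiMay_eq_ev, FinDist.ev_map, FinDist.ev_map]
  exact FinDist.ev_mono fun F hF => hm F d (FinDist.all_map.1 hall F hF)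

end Families

/-! ### Congruence -/

section Congruence

variable {C : Type u}

/-- Testing equivalence of processes of the class `b`. -/
structure ProcEq (m : Mode) (D : Set (FinDist (Proc C))) (b : Prop) (P Q : Proc C) : Prop where
  left : P.Cls b
  right : Q.Cls b
  testEq : TestEq m D (dirac P) (dirac Q)

variable {m : Mode} {D : Set (FinDist (Proc C))} {b : Prop}

theorem ProcEq.refl {P : Proc C} (hP : P.Cls b) : ProcEq m D b P P :=
  ⟨hP, hP, (TestEq.equivalence m D).refl _⟩

theorem ProcEq.symm {P Q : Proc C} (h : ProcEq m D b P Q) : ProcEq m D b Q P :=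
  ⟨h.right, h.left, (TestEq.equivalence m D).symm h.testEq⟩

theorem ProcEq.trans {P Q R : Proc C} (h : ProcEq m D b P Q) (h' : ProcEq m D b Q R) :
    ProcEq m D b P R :=
  ⟨h.left, h'.right, (TestEq.equivalence m D).trans h.testEq h'.testEq⟩

theorem ProcEq.tval_eq (hD : IsClassContext D b) {P Q : Proc C} (h : ProcEq m D b P Q) {w : C}
    (hP : P.Fresh w) (hQ : Q.Fresh w) {O : Proc C} (hO : Observer b w O) :
    tval m w O P = tval m w O Q := by
  have := h.testEq.chi_eq (w := w) (FinDist.all_dirac.2 hP) (FinDist.all_dirac.2 hQ)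
    (hD.dirac_mem O (hO.mono (Set.subset_univ _) (Set.subset_univ _) id))
    (FinDist.all_dirac.2 (hO.mono subset_rfl subset_rfl False.elim))
  simpa [Mode.chi_par] using this

theorem Fresh.iter {S : Term C 1} {P : Proc C} {w : C} (hS : S.Fresh w) (hP : P.Fresh w) (n : ℕ) :
    (iter S P n).Fresh w := by
  induction n with
  | zero => exact hP
  | succ n ih => exact hS.subst fun _ => ih

variable [Infinite C]

theorem IsClassContext.procEq (hD : IsClassContext D b) {P Q : Proc C} (hP : P.Cls b)
    (hQ : Q.Cls b) {F : Set C} (hF : F.Finite)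
    (h : ∀ w ∉ F, ∀ O, Observer b w O → tval m w O P = tval m w O Q) : ProcEq m D b P Q := by
  refine ⟨hP, hQ, hD.testing.testEq hF fun w hw o ho hwo => ?_⟩
  simp only [Mode.chi_par, FinDist.ev_dirac]
  refine FinDist.ev_congr fun O hO => h w hw O ?_
  exact ((hD.all o ho O hO).inter (hwo O hO)).mono Set.inter_subset_right Set.inter_subset_right
    Or.inl

theorem ProcEq.may_of_fair (hD : IsClassContext D b) {P Q : Proc C}
    (h : ProcEq .fair D b P Q) : ProcEq .may D b P Q :=
  ⟨h.left, h.right, hD.testing.testEq_may_of_fair h.testEq⟩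

theorem ProcEq.res (hD : IsClassContext D b) {P Q : Proc C} (h : ProcEq m D b P Q)
    (L : Finset C) : ProcEq m D b (.res L P) (.res L Q) := by
  refine ⟨⟨trivial, h.left⟩, ⟨trivial, h.right⟩, ?_⟩
  have := hD.testing.localizable m _ _ h.testEq L
  rwa [FinDist.res, FinDist.res, Convexity.StdSimplex.map_single,
    Convexity.StdSimplex.map_single] at this

theorem ProcEq.par_right (hD : IsClassContext D b) {P Q R : Proc C} (h : ProcEq m D b P Q)
    (hR : R.Cls b) : ProcEq m D b (.par P R) (.par Q R) := by
  refine ⟨⟨h.left, hR⟩, ⟨h.right, hR⟩, ?_⟩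
  have := hD.testing.compositional m _ _ h.testEq _ (hD.dirac_mem R hR)
  rwa [FinDist.par_dirac, FinDist.par_dirac, Convexity.StdSimplex.map_single,
    Convexity.StdSimplex.map_single] at this

theorem ProcEq.par_comm (hD : IsClassContext D b) {P Q : Proc C} (hP : P.Cls b) (hQ : Q.Cls b) :
    ProcEq m D b (.par P Q) (.par Q P) :=
  hD.procEq ⟨hP, hQ⟩ ⟨hQ, hP⟩ Set.finite_empty fun w _ O _ =>
    strongSpan_comm.par.val_eq m {.pos w} ((P, Q), O)

theorem ProcEq.par (hD : IsClassContext D b) {P P' Q Q' : Proc C} (h : ProcEq m D b P Q)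
    (h' : ProcEq m D b P' Q') : ProcEq m D b (.par P P') (.par Q Q') :=
  (h.par_right hD h'.left).trans <| (ProcEq.par_comm hD h.right h'.left).trans <|
    (h'.par_right hD h.right).trans (ProcEq.par_comm hD h'.right h.right)

theorem ProcEq.unfold (hD : IsClassContext D b) {T : Term C 1} (hT : T.Cls b) :
    ProcEq m D b (.fix T) (T.subst fun _ => .fix T) :=
  hD.procEq hT (hT.subst (σ := fun _ => .fix T) fun _ => hT) Set.finite_empty
    fun w _ O _ => tval_fix m w O T

/-- The two choices match each other's transitions. In fair mode the may equality required in
addition comes from fair equivalence implying may equivalence. -/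
theorem ProcEq.sum (hD : IsClassContext D b) {k : ℕ} (α : Fin (k + 1) → Act C)
    {S T : Fin (k + 1) → Proc C} (h : ∀ i, ProcEq m D b (S i) (T i)) :
    ProcEq m D b (.sum k α S) (.sum k α T) := by
  have hF : (⋃ i, ((S i).channels ∪ (T i).channels)).Finite :=
    Set.finite_iUnion fun i => (finite_channels _).union (finite_channels _)
  have hS : ∀ {w}, w ∉ (⋃ i, ((S i).channels ∪ (T i).channels)) → ∀ i, (S i).Fresh w :=
    fun hw i => fresh_iff.2 fun h => hw (Set.mem_iUnion.2 ⟨i, .inl h⟩)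
  have hT : ∀ {w}, w ∉ (⋃ i, ((S i).channels ∪ (T i).channels)) → ∀ i, (T i).Fresh w :=
    fun hw i => fresh_iff.2 fun h => hw (Set.mem_iUnion.2 ⟨i, .inr h⟩)
  refine hD.procEq (fun i => ⟨trivial, (h i).left⟩) (fun i => ⟨trivial, (h i).right⟩) hF
    fun w hw O hO => ?_
  have key : ∀ {m : Mode}, (∀ i, ProcEq m D b (S i) (T i)) →
      ∀ i O, Observer b w O → tval m w O (S i) = tval m w O (T i) :=
    fun h i O hO => (h i).tval_eq hD (hS hw i) (hT hw i) hO
  have hmay : (∀ i, ProcEq .may D b (S i) (T i)) → ∀ O, Observer b w O →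
      tval .may w O (.sum k α S) = tval .may w O (.sum k α T) := fun h O hO =>
    tval_may_eq_of_matches (matches_sum α (key h))
      (matches_sum α fun i O hO => (key h i O hO).symm) hO
  cases m
  · exact hmay h O hO
  · exact tval_fair_eq_of_matches (matches_sum α (key h))
      (matches_sum α fun i O hO => (key h i O hO).symm)
      (hmay fun i => (h i).may_of_fair hD) hO

theorem ProcEq.psum (hD : IsClassContext D b) {k : ℕ} (p : Fin (k + 1) → ℝ)
    (hp : ∀ i, 0 < p i ∧ p i < 1) (hsum : ∑ i, p i = 1) {S T : Fin (k + 1) → Proc C} (hb : ¬ b)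
    (h : ∀ i, ProcEq m D b (S i) (T i)) :
    ProcEq m D b (.psum k p hp hsum S) (.psum k p hp hsum T) := by
  have hF : (⋃ i, ((S i).channels ∪ (T i).channels)).Finite :=
    Set.finite_iUnion fun i => (finite_channels _).union (finite_channels _)
  have hS : ∀ {w}, w ∉ (⋃ i, ((S i).channels ∪ (T i).channels)) → ∀ i, (S i).Fresh w :=
    fun hw i => fresh_iff.2 fun h => hw (Set.mem_iUnion.2 ⟨i, .inl h⟩)
  have hT : ∀ {w}, w ∉ (⋃ i, ((S i).channels ∪ (T i).channels)) → ∀ i, (T i).Fresh w :=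
    fun hw i => fresh_iff.2 fun h => hw (Set.mem_iUnion.2 ⟨i, .inr h⟩)
  refine hD.procEq ⟨hb, fun i => (h i).left⟩ ⟨hb, fun i => (h i).right⟩ hF
    fun w hw O hO => ?_
  have key : ∀ {m : Mode}, (∀ i, ProcEq m D b (S i) (T i)) →
      ∀ i O, Observer b w O → tval m w O (S i) = tval m w O (T i) :=
    fun h i O hO => (h i).tval_eq hD (hS hw i) (hT hw i) hO
  have hmay : (∀ i, ProcEq .may D b (S i) (T i)) → ∀ O, Observer b w O →
      tval .may w O (.psum k p hp hsum S) = tval .may w O (.psum k p hp hsum T) := fun h O hO =>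
    tval_may_eq_of_matches (matches_psum p hp hsum (key h))
      (matches_psum p hp hsum fun i O hO => (key h i O hO).symm) hO
  cases m
  · exact hmay h O hO
  · exact tval_fair_eq_of_matches (matches_psum p hp hsum (key h))
      (matches_psum p hp hsum fun i O hO => (key h i O hO).symm)
      (hmay fun i => (h i).may_of_fair hD) hO

/-- May equivalent processes agree on the observation of any of their actions. -/
theorem ProcEq.may_can_eq (hD : IsClassContext D b) {P Q : Proc C} (h : ProcEq .may D b P Q)
    (w : C) : may (can {.pos w}) P = may (can {.pos w}) Q := by
  obtain ⟨w', hw'⟩ := exists_notMem_finite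
    (((finite_channels P).union (finite_channels Q)).insert w)
  simp only [Set.mem_insert_iff, Set.mem_union, not_or] at hw'
  obtain ⟨hne, hP, hQ⟩ := hw'
  -- Since `w` may occur in `P` and `Q`, it is not itself a legitimate success signal; `K` copies
  -- its observation to the fresh channel `w'`.
  obtain ⟨K, hK, hccs, hpos⟩ := exists_isCopier (Set.finite_singleton (Label.neg w))
    (Set.singleton_nonempty _) (w := w') (by simpa using hne)
  have hΛ : ∀ l : Label C, l ∈ ({.pos w} : Set (Label C)) ↔ l.compl ∈ ({.neg w} : Set (Label C)) := by
    rintro (a | a) <;> simp [Label.compl]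
  have hobs : Observer b w' K :=
    (hpos.inter (isCCS_iff_ok.1 hccs)).mono Set.inter_subset_left Set.inter_subset_left
      fun _ => .inr trivial
  have := h.tval_eq hD (fresh_iff.2 hP) (fresh_iff.2 hQ) hobs
  simp only [tval] at this
  rwa [val_par_copier .may hK (by simp) hΛ (fresh_iff.2 hP),
    val_par_copier .may hK (by simp) hΛ (fresh_iff.2 hQ)] at this

/-- A unary term preserves the equivalence of processes. -/
def Substitutive (m : Mode) (D : Set (FinDist (Proc C))) (b : Prop) (T : Term C 1) : Prop :=
  ∀ P Q, ProcEq m D b P Q → ProcEq m D b (T.subst fun _ => P) (T.subst fun _ => Q)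

/-- Starting the iteration at `fix T` makes every iterate equivalent to `fix T`: one layer of `S`
may be exchanged for one layer of `T`, which is then folded back. -/
theorem ProcEq.iter (hD : IsClassContext D b) {S T : Term C 1} (hTc : T.Cls b)
    (hS : Substitutive m D b S)
    (h : ∀ P : Proc C, P.Cls b → ProcEq m D b (S.subst fun _ => P) (T.subst fun _ => P)) (n : ℕ) :
    ProcEq m D b (iter S (.fix T) n) (.fix T) := by
  induction n with
  | zero => exact ProcEq.refl hTc
  | succ n ih =>
    exact (hS _ _ ih).trans ((h _ hTc).trans (ProcEq.unfold hD hTc).symm)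

/-- Iterates of `S` from `fix T` have the value of `fix T` and exhaust what `fix S` can achieve, so
one inequality holds; the situation is symmetric. -/
theorem ProcEq.fix_may (hD : IsClassContext D b) {S T : Term C 1} (hSc : S.Cls b) (hTc : T.Cls b)
    (hS : Substitutive .may D b S) (hT : Substitutive .may D b T)
    (h : ∀ P : Proc C, P.Cls b →
      ProcEq .may D b (S.subst fun _ => P) (T.subst fun _ => P)) :
    ProcEq .may D b (.fix S) (.fix T) := by
  refine hD.procEq hSc hTc ((finite_channels S).union (finite_channels T)) fun w hw O hO => ?_
  rw [Set.mem_union, not_or] at hw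
  have hSw := fresh_iff.2 hw.1
  have hTw := fresh_iff.2 hw.2
  have key : ∀ {S T : Term C 1}, T.Cls b → Substitutive .may D b S → S.Fresh w → T.Fresh w →
      (∀ P : Proc C, P.Cls b → ProcEq .may D b (S.subst fun _ => P) (T.subst fun _ => P)) →
      tval .may w O (.fix S) ≤ tval .may w O (.fix T) := by
    intro S T hTc hS hSw hTw h
    refine may_fix_le (B := .fix T) fun n => le_of_eq ?_
    exact (ProcEq.iter hD hTc hS h n).tval_eq hD (Fresh.iter hSw (P := .fix T) hTw n) hTw hO
  exact le_antisymm (key hTc hS hSw hTw h) (key hSc hT hTw hSw fun P hP => (h P hP).symm)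

/-- Copying a run of `fix S` in an iterate relates its target to the same term filled with iterates.
Comparing the may values of such fillings requires may equivalence to be preserved by arbitrary
terms, which is `hmay`. -/
theorem ProcEq.fix_fair (hD : IsClassContext D b) {S T : Term C 1} (hSc : S.Cls b) (hTc : T.Cls b)
    (hS : Substitutive .fair D b S) (hT : Substitutive .fair D b T)
    (hmay : ∀ {n : ℕ} (T : Term C n), T.Cls b → ∀ σ τ : Fin n → Proc C,
      (∀ i, ProcEq .may D b (σ i) (τ i)) → ProcEq .may D b (T.subst σ) (T.subst τ))
    (h : ∀ P : Proc C, P.Cls b →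
      ProcEq .fair D b (S.subst fun _ => P) (T.subst fun _ => P)) :
    ProcEq .fair D b (.fix S) (.fix T) := by
  have hfix : ProcEq .may D b (.fix S) (.fix T) := ProcEq.fix_may hD hSc hTc
    (fun P Q h => hmay S hSc _ _ fun _ => h) (fun P Q h => hmay T hTc _ _ fun _ => h)
    fun P hP => (h P hP).may_of_fair hD
  refine hD.procEq hSc hTc ((finite_channels S).union (finite_channels T)) fun w hw O hO => ?_
  rw [Set.mem_union, not_or] at hw
  have hSw := fresh_iff.2 hw.1
  have hTw := fresh_iff.2 hw.2
  have key : ∀ {S T : Term C 1}, S.Cls b → T.Cls b → Substitutive .fair D b S → S.Fresh w →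
      T.Fresh w →
      (∀ P : Proc C, P.Cls b → ProcEq .fair D b (S.subst fun _ => P) (T.subst fun _ => P)) →
      ProcEq .may D b (.fix S) (.fix T) → tval .fair w O (.fix T) ≤ tval .fair w O (.fix S) := by
    intro S T hSc hTc hS hSw hTw h hfix
    have hiter := ProcEq.iter hD hTc hS h
    refine le_fair_fix (B := .fix T) (fun n => le_of_eq ?_) (p := Cls b)
      (fun P ρ hP hs => (hs.ok hP).2)
      ⟨hSc, hO.mono (Set.subset_univ _) (Set.subset_univ _) id⟩ fun F d hF => le_of_eq ?_
    · exact ((hiter n).tval_eq hD (Fresh.iter hSw (P := .fix T) hTw n) hTw hO).symm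
    · exact (hmay F.2 hF.of_subst _ _ fun i =>
        ((hiter _).may_of_fair hD).trans hfix.symm).may_can_eq hD w
  exact le_antisymm (key hTc hSc hT hTw hSw (fun P hP => (h P hP).symm) hfix.symm)
    (key hSc hTc hS hSw hTw h hfix)

/-- Substitution preserves process equivalence, given that recursion does. -/
theorem ProcEq.subst_of_fix (hD : IsClassContext D b)
    (hfix : ∀ S T : Term C 1, S.Cls b → T.Cls b → Substitutive m D b S → Substitutive m D b T →
      (∀ P : Proc C, P.Cls b → ProcEq m D b (S.subst fun _ => P) (T.subst fun _ => P)) →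
      ProcEq m D b (.fix S) (.fix T)) {n : ℕ} (T : Term C n) (hT : T.Cls b)
    (σ τ : Fin n → Proc C) (h : ∀ i, ProcEq m D b (σ i) (τ i)) :
    ProcEq m D b (T.subst σ) (T.subst τ) := by
  induction T with
  | nil => exact ProcEq.refl trivial
  | var i => exact h i
  | sum k α T ih => exact ProcEq.sum hD α fun i => ih i (hT i).2 σ τ h
  | psum k p hp hsum T ih => exact ProcEq.psum hD p hp hsum hT.1 fun i => ih i (hT.2 i) σ τ h
  | par S T ihS ihT => exact ProcEq.par hD (ihS hT.1 σ τ h) (ihT hT.2 σ τ h)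
  | res L T ih => exact (ih hT.2 σ τ h).res hD L
  | fix T ih =>
    have hc : ∀ {σ : Fin _ → Proc C}, (∀ i, (σ i).Cls b) →
        (T.subst (Fin.cases (var 0) fun i => (σ i).renVar Fin.succ) : Term C 1).Cls b := by
      intro σ hσ
      refine Term.Ok.subst (T := T) hT fun i => ?_
      cases i using Fin.cases
      · trivial
      · exact (hσ _).renVar _
    have key : ∀ {σ τ : Fin _ → Proc C} {P Q : Proc C}, (∀ i, ProcEq m D b (σ i) (τ i)) →
        ProcEq m D b P Q → ProcEq m D b (T.subst (Fin.cases P σ)) (T.subst (Fin.cases Q τ)) := by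
      intro σ τ P Q h hPQ
      refine ih hT _ _ fun i => ?_
      cases i using Fin.cases
      · exact hPQ
      · exact h _
    refine hfix _ _ (hc fun i => (h i).left) (hc fun i => (h i).right) ?_ ?_ ?_
    · intro P Q hPQ
      rw [subst_lift_subst, subst_lift_subst]
      exact key (fun i => ProcEq.refl (h i).left) hPQ
    · intro P Q hPQ
      rw [subst_lift_subst, subst_lift_subst]
      exact key (fun i => ProcEq.refl (h i).right) hPQ
    · intro P hP
      rw [subst_lift_subst, subst_lift_subst]
      exact key h (ProcEq.refl hP)

/-- May recursion needs no substitution result beyond its hypotheses, so it yields substitutivity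
for may; that in turn is the input for fair recursion, which avoids a circle. -/
theorem ProcEq.fix (hD : IsClassContext D b) {S T : Term C 1} (hSc : S.Cls b) (hTc : T.Cls b)
    (hS : Substitutive m D b S) (hT : Substitutive m D b T)
    (h : ∀ P : Proc C, P.Cls b → ProcEq m D b (S.subst fun _ => P) (T.subst fun _ => P)) :
    ProcEq m D b (.fix S) (.fix T) := by
  cases m
  · exact ProcEq.fix_may hD hSc hTc hS hT h
  · exact ProcEq.fix_fair hD hSc hTc hS hT
      (ProcEq.subst_of_fix hD fun S T hSc hTc hS hT h => ProcEq.fix_may hD hSc hTc hS hT h) h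

theorem ProcEq.subst (hD : IsClassContext D b) {n : ℕ} (T : Term C n) (hT : T.Cls b)
    (σ τ : Fin n → Proc C) (h : ∀ i, ProcEq m D b (σ i) (τ i)) :
    ProcEq m D b (T.subst σ) (T.subst τ) :=
  ProcEq.subst_of_fix hD (fun _ _ hSc hTc hS hT h => ProcEq.fix hD hSc hTc hS hT h) T hT σ τ h

/-- Testing equivalence of processes is a congruence. -/
theorem IsClassContext.isCongruence (hD : IsClassContext D b) (m : Mode)
    {K : (n : ℕ) → Set (Term C n)} (hK : ∀ n (T : Term C n), T ∈ K n ↔ T.Cls b) :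
    IsCongruence K (proj (K 0) (TestEq m D)) := by
  have hp : ∀ {P Q : Proc C}, proj (K 0) (TestEq m D) P Q ↔ ProcEq m D b P Q := fun {P Q} =>
    ⟨fun h => ⟨(hK _ _).1 h.1, (hK _ _).1 h.2.1, h.2.2⟩,
      fun h => ⟨(hK _ _).2 h.left, (hK _ _).2 h.right, h.testEq⟩⟩
  have ho : ∀ {n : ℕ} {S T : Term C n}, OpenRel K (proj (K 0) (TestEq m D)) S T ↔
      S.Cls b ∧ T.Cls b ∧ ∀ σ : Fin n → Proc C, (∀ i, (σ i).Cls b) →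
        ProcEq m D b (S.subst σ) (T.subst σ) := by
    intro n S T
    simp only [OpenRel, hK, hp]
  constructor
  · exact fun P hP => hp.2 (ProcEq.refl ((hK _ _).1 hP))
  · exact fun h => hp.2 (hp.1 h).symm
  · exact fun h h' => hp.2 ((hp.1 h).trans (hp.1 h'))
  · intro n k α S T h
    simp only [ho] at h ⊢
    exact ⟨fun i => ⟨trivial, (h i).1⟩, fun i => ⟨trivial, (h i).2.1⟩,
      fun σ hσ => ProcEq.sum hD α fun i => (h i).2.2 σ hσ⟩
  · intro n k p hp hsum S T h hS hT
    rw [hK] at hS hT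
    simp only [ho] at h ⊢
    exact ⟨hS, hT, fun σ hσ => ProcEq.psum hD p hp hsum hS.1 fun i => (h i).2.2 σ hσ⟩
  · intro n S₁ T₁ S₂ T₂ h₁ h₂
    simp only [ho] at h₁ h₂ ⊢
    exact ⟨⟨h₁.1, h₂.1⟩, ⟨h₁.2.1, h₂.2.1⟩,
      fun σ hσ => ProcEq.par hD (h₁.2.2 σ hσ) (h₂.2.2 σ hσ)⟩
  · intro n L S T h
    simp only [ho] at h ⊢
    exact ⟨⟨trivial, h.1⟩, ⟨trivial, h.2.1⟩, fun σ hσ => (h.2.2 σ hσ).res hD L⟩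
  · intro n S T h
    simp only [ho] at h ⊢
    refine ⟨h.1, h.2.1, fun σ hσ => ?_⟩
    have hc : ∀ {T : Term C (n + 1)}, T.Cls b →
        (T.subst (Fin.cases (var 0) fun i => (σ i).renVar Fin.succ) : Term C 1).Cls b := by
      intro T hT
      refine hT.subst fun i => ?_
      cases i using Fin.cases
      · trivial
      · exact (hσ _).renVar _
    have hs : ∀ {T : Term C (n + 1)}, T.Cls b →
        Substitutive m D b (T.subst (Fin.cases (var 0) fun i => (σ i).renVar Fin.succ)) := by
      intro T hT P Q hPQ
      rw [subst_lift_subst, subst_lift_subst]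
      refine ProcEq.subst hD T hT _ _ fun i => ?_
      cases i using Fin.cases
      · exact hPQ
      · exact ProcEq.refl (hσ _)
    refine ProcEq.fix hD (hc h.1) (hc h.2.1) (hs h.1) (hs h.2.1) fun P hP => ?_
    rw [subst_lift_subst, subst_lift_subst]
    refine h.2.2 _ fun i => ?_
    cases i using Fin.cases
    · exact hP
    · exact hσ _

end Congruence
end RCCS

theorem mainTheorem3 {C : Type u} [Infinite C] :
    -- preservation, for every testing context
    (∀ D : Set (RCCS.FinDist (RCCS.Proc C)), RCCS.IsTestingContext D →
      RCCS.IsPreserved D (RCCS.Diamond D) ∧ RCCS.IsPreserved D (RCCS.Box D) ∧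
      RCCS.IsPreserved D (RCCS.Fair D) ∧ RCCS.IsPreserved D (RCCS.May D)) ∧
    -- diamond and box: probabilistic observers on RCCS, classical observers on CCS
    (RCCS.IsCongruence (RCCS.rccsTerms C)
        (RCCS.proj (RCCS.rccsTerms C 0) (RCCS.Diamond Set.univ)) ∧
      RCCS.IsCongruence (RCCS.rccsTerms C)
        (RCCS.proj (RCCS.rccsTerms C 0) (RCCS.Box Set.univ)) ∧
      RCCS.IsCongruence (RCCS.ccsTerms C)
        (RCCS.proj (RCCS.ccsTerms C 0) (RCCS.Diamond (RCCS.diracCCS C))) ∧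
      RCCS.IsCongruence (RCCS.ccsTerms C)
        (RCCS.proj (RCCS.ccsTerms C 0) (RCCS.Box (RCCS.diracCCS C)))) ∧
    -- may and fair: probabilistic observers on RCCS, classical observers on CCS
    (RCCS.IsCongruence (RCCS.rccsTerms C)
        (RCCS.proj (RCCS.rccsTerms C 0) (RCCS.May Set.univ)) ∧
      RCCS.IsCongruence (RCCS.rccsTerms C)
        (RCCS.proj (RCCS.rccsTerms C 0) (RCCS.Fair Set.univ)) ∧
      RCCS.IsCongruence (RCCS.ccsTerms C)
        (RCCS.proj (RCCS.ccsTerms C 0) (RCCS.May (RCCS.diracCCS C))) ∧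
      RCCS.IsCongruence (RCCS.ccsTerms C)
        (RCCS.proj (RCCS.ccsTerms C 0) (RCCS.Fair (RCCS.diracCCS C)))) := by
  have hu := RCCS.isClassContext_univ (C := C)
  have hc := RCCS.isClassContext_diracCCS (C := C)
  have ku := fun m : RCCS.Mode => hu.isCongruence m (K := RCCS.rccsTerms C)
    fun n T => iff_of_true trivial (RCCS.Term.cls_of_not T id)
  have kc := fun m : RCCS.Mode => hc.isCongruence m (K := RCCS.ccsTerms C)
    fun n T => RCCS.Term.isCCS_iff_ok
  refine ⟨fun D hD => ?_, ?_, ?_⟩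
  -- Diamond and box are the may and fair equivalences, so one treatment of `TestEq` covers all four
  -- relations.
  · rw [hD.diamond_eq, hD.box_eq, ← RCCS.testEq_may, ← RCCS.testEq_fair]
    exact ⟨hD.isPreserved .may, hD.isPreserved .fair, hD.isPreserved .fair, hD.isPreserved .may⟩
  · rw [hu.testing.diamond_eq, hu.testing.box_eq, hc.testing.diamond_eq, hc.testing.box_eq,
      ← RCCS.testEq_may, ← RCCS.testEq_fair, ← RCCS.testEq_may, ← RCCS.testEq_fair]
    exact ⟨ku .may, ku .fair, kc .may, kc .fair⟩
  · rw [← RCCS.testEq_may, ← RCCS.testEq_fair, ← RCCS.testEq_may, ← RCCS.testEq_fair]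
    exact ⟨ku .may, ku .fair, kc .may, kc .fair⟩
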